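/- **Setting.** Let $m\ge 2$ and let $M=\mathbb S^1\times[0,1]^{m-1}$, $\mathbb S^1=\mathbb R/\mathbb Z$, with coordinates $(\theta,r_1,\dots,r_{m-1})=(x_1,\dots,x_m)$ and Lebesgue measure $\mu$. Put $R_\alpha(\theta,r)=(\theta+\alpha,r)$. A diffeomorphism $F$ of $M$ (smooth up to the boundary) is described by coordinate functions $F_1,\dots,F_m$ on $\mathbb R\times[0,1]^{m-1}$. For a function $u$ let $\|u\|_0=\sup_{(0,1)^m}|u|$, and put $\|DF\|_0=\max_{i,j}\|\partial_jF_i\|_0$, $$\tilde d_0(F,G)=\max_i\inf_{p\in\mathbb Z}\|F_i-G_i+p\|_0,\qquad \tilde d_k(F,G)=\max\{\tilde d_0(F,G),\ \|D_{\vec a}(F_i-G_i)\|_0: 1\le i\le m,\ 1\le|\vec a|\le k\},$$ $$d_k(F,G)=\max\{\tilde d_k(F,G),\tilde d_k(F^{-1},G^{-1})\}.$$ Convergence in $\mathrm{Diff}^\infty(M)$ means convergence in $d_k$ for every $k$. A transformation $T$ is weakly mixing if it preserves $\mu$ and every measurable $h:M\to\mathbb C$ with $h\circ T=\lambda h$ a.e.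 for some $\lambda\in\mathbb C$ is a.e. constant. **Parameters.** Let $\sigma\in(0,1)$ and, for $n\ge1$, $\alpha_n=p_n/q_n$ with $p_n=260n^4\tilde p_n$, $q_n=260n^4\tilde q_n$, where $\tilde p_n\in\mathbb Z$ and $\tilde q_n\ge1$ are coprime integers, and $$q_{n+1}\ \ge\ 64\cdot260\,(n+1)^4\,n^{11}\,q_n^{(m-1)n^2+3}\qquad(n\ge1).$$ **The maps $\phi_n$.** For $n\ge1$ and $2\le j\le m$ let $\varphi_{\varepsilon,1,j}$, with $\varepsilon=\frac1{60n^4}$ and with $\varepsilon=\frac1{22n^4}$, be any smooth volume-preserving diffeomorphisms of $\mathbb R^m$ that equal the rotation by $\pi/2$ about $(\frac12,\dots,\frac12)$ in the $x_1$-$x_j$-plane, $(x_1,x_j)\mapsto(1-x_j,x_1)$, on $[2\varepsilon,1-2\varepsilon]^m$ and the identity outside $[\varepsilon,1-\varepsilon]^m$. For a positive integer $\kappa$ let $\psi_{\kappa,j}$ be the identity outside $[\delta',1-\delta']^m$, $\delta'=\frac1{10n^4}$, and on $[\delta',1-\delta']^m$, divided into cubes of side $1/\kappa$, let it act on each such cube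 as the rescaled copy of $\varphi^{-1}_{1/(22n^4),1,j}$. For a positive integer $\lambda$ put $C_\lambda(x)=(\lambda x_1,x_2,\dots,x_m)$ and let $\tilde\phi^{(j)}_{\lambda,\kappa}$ be $C_\lambda^{-1}\circ\psi_{\kappa,j}\circ\varphi_{1/(60n^4),1,j}\circ C_\lambda$ on $[0,\frac1\lambda]\times[0,1]^{m-1}$, extended so as to commute with $R_{1/\lambda}$. On $[\frac{k-1}{nq_n},\frac k{nq_n}]\times[0,1]^{m-1}$, $1\le k\le n$, put $$\phi_n=\tilde\phi^{(m)}_{\lambda_m,q_n^k}\circ\dots\circ\tilde\phi^{(2)}_{\lambda_2,q_n^k},\qquad \lambda_j=n\,q_n^{1+(m-1)\frac{k(k-1)}2+(j-2)k},$$ and extend $\phi_n$ so as to commute with $R_{1/q_n}$. **The maps $g_n$.** For $n\ge1$ let $\varepsilon=\frac1{8n^4}$, $\delta=\frac1{32n^4}$, $b=\lfloor nq_n^\sigma\rfloor$. Let $G_n$ be any smooth volume-preserving diffeomorphism of $\mathbb R^m$ that fixes the coordinates $x_3,\dots,x_m$, such that: $G_n$ equals the shear $(x_1,x_2,\dots)\mapsto(x_1+\varepsilon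 x_2,x_2,\dots)$ wherever $(x_1,x_2)\notin[\varepsilon,1-\varepsilon]^2$; for $(x_3,\dots,x_m)\in[\delta,1-\delta]^{m-2}$ its action on $(x_1,x_2)$ does not depend on $(x_3,\dots,x_m)$ and is the identity on $[4\varepsilon,1-4\varepsilon]^2$; and for some $\delta''\in(0,\delta)$, $G_n$ equals the shear wherever $(x_3,\dots,x_m)\notin[\delta'',1-\delta'']^{m-2}$ (the conditions on $x_3,\dots,x_m$ are void for $m=2$). On $[\frac{k-1}{nq_n},\frac k{nq_n}]\times[0,1]^{m-1}$, $1\le k\le n$, put $a=n\,q_n^{1+(m-1)\frac{k(k+1)}2}$ and $D(\theta,r_1,r_2,\dots)=(a\theta,\frac{ba}\varepsilon r_1,r_2,\dots)$; for $r_1\in[\delta,1-\delta]$ define $g_n$ by $$g_n\Big(\theta+\tfrac ia,\ r_1+l\tfrac{\varepsilon}{ba},\ r_2,\dots\Big)=\Big(\tfrac ia+l\tfrac\varepsilon a,\ l\tfrac\varepsilon{ba},\ 0,\dots,0\Big)+D^{-1}G_nD(\theta,r_1,r_2,\dots),\qquad \theta\in[0,\tfrac1a],\ r_1\in[0,\tfrac\varepsilon{ba}],\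 i,l\in\mathbb Z,$$ (the condition $[\delta,1-\delta]$ being imposed on the second coordinate of the argument of $g_n$), and put $g_n(\theta,r)=(\theta+br_1,r)$ otherwise. Extend $g_n$ so as to commute with $R_{1/q_n}$. **The sequence.** Let $H_0=\mathrm{id}$, $H_n=h_1\circ\dots\circ h_n$ with $h_n=g_n\circ\phi_n$, let $f_n=H_n\circ R_{\alpha_{n+1}}\circ H_n^{-1}$, and let $m_n$ be the least integer $t$ with $1\le t\le q_{n+1}$ and $$\inf_{k\in\mathbb Z}\Big|t\,\frac{p_{n+1}}{q_{n+1}}-\frac1{nq_n}+\frac k{q_n}\Big|\le\frac{260(n+1)^4}{q_{n+1}}.$$ **Proposition (criterion for weak mixing).** Suppose that $f_n$ converges in $\mathrm{Diff}^\infty(M)$ to a diffeomorphism $f$, that $d_0(f^{m_n},f_n^{m_n})<2^{-n}$ for every $n\ge1$, and that $\|DH_{n-1}\|_0\le\frac{\ln q_n}n$ for every $n\ge1$. Then $f$ is weakly mixing. -/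

import Mathlib

open MeasureTheory Filter Topology Set
open scoped ContDiff ENNReal

noncomputable section

namespace AbC

/-! The manifold is the product of the circle and a cube, of dimension `m = d + 2`.  Coordinates on
its universal cover are indexed by `Fin (d + 2)`: index `0` is the angle, index `1` is the first
radial coordinate, and `i.succ` for `i : Fin (d + 1)` runs over all radial coordinates. -/

/-- The space `ℝ^m` with `m = d + 2`. -/
abbrev Coord (d : ℕ) : Type := Fin (d + 2) → ℝ

/-- The manifold `M`, the product of `ℝ/ℤ` and `[0,1]^(m-1)`; its measure is `volume`. -/
abbrev Cyl (d : ℕ) : Type := UnitAddCircle × (Fin (d + 1) → unitInterval)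

/-- The universal cover `ℝ × [0,1]^(m-1)` of the manifold. -/
def strip (d : ℕ) : Set (Coord d) := {x | ∀ i : Fin (d + 1), x i.succ ∈ Icc (0 : ℝ) 1}

/-- The open cube `(0,1)^m`. -/
def openCube (d : ℕ) : Set (Coord d) := {x | ∀ i, x i ∈ Ioo (0 : ℝ) 1}

/-- The covering projection (meaningful on `strip d`). -/
def proj {d : ℕ} (x : Coord d) : Cyl d :=
  ((x 0 : UnitAddCircle), fun i => projIcc (0 : ℝ) 1 zero_le_one (x i.succ))

/-! ### Smooth diffeomorphisms of the manifold and their distances -/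

/-- A smooth diffeomorphism of the manifold, together with coordinate functions (lifts to the
universal cover) of it and of its inverse; smoothness is meant up to the boundary. -/
structure CylDiffeo (d : ℕ) where
  toEquiv : Cyl d ≃ Cyl d
  lift : Coord d → Coord d
  liftInv : Coord d → Coord d
  mapsTo_lift : MapsTo lift (strip d) (strip d)
  mapsTo_liftInv : MapsTo liftInv (strip d) (strip d)
  contDiffOn_lift : ContDiffOn ℝ ∞ lift (strip d)
  contDiffOn_liftInv : ContDiffOn ℝ ∞ liftInv (strip d)
  proj_lift : ∀ x ∈ strip d, proj (lift x) = toEquiv (proj x)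
  proj_liftInv : ∀ x ∈ strip d, proj (liftInv x) = toEquiv.symm (proj x)

/-- `‖F‖₀`, the supremum of `|F|` over the open unit cube, with values in `[0,∞]`. -/
def supNorm {d : ℕ} (F : Coord d → ℝ) : ℝ≥0∞ := ⨆ z ∈ openCube d, ENNReal.ofReal |F z|

/-- The partial derivative of order `l` in the coordinate directions `v 0, …, v (l - 1)`. -/
def partialD {d l : ℕ} (v : Fin l → Fin (d + 2)) (F : Coord d → ℝ) (z : Coord d) : ℝ :=
  iteratedFDeriv ℝ l F z (fun t => Pi.single (v t) (1 : ℝ))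

/-- The one-sided distance of order zero of two maps given by coordinate functions. -/
def tildeDist0 {d : ℕ} (F G : Coord d → Coord d) : ℝ≥0∞ :=
  ⨆ i : Fin (d + 2), ⨅ p : ℤ, supNorm (fun z => (F z i - G z i) + (p : ℝ))

/-- The one-sided distance of order `k`. -/
def tildeDist {d : ℕ} (k : ℕ) (F G : Coord d → Coord d) : ℝ≥0∞ :=
  max (tildeDist0 F G)
    (⨆ (l : ℕ) (_ : 1 ≤ l ∧ l ≤ k) (v : Fin l → Fin (d + 2)) (i : Fin (d + 2)),
      supNorm (partialD v (fun z => F z i - G z i)))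

/-- The distance `d_k` between two diffeomorphisms with lifts `F`, `G`, whose inverses have lifts
`F'`, `G'`. -/
def diffDist {d : ℕ} (k : ℕ) (F F' G G' : Coord d → Coord d) : ℝ≥0∞ :=
  max (tildeDist k F G) (tildeDist k F' G')

/-- `‖DF‖₀`, the largest sup norm of a first-order partial derivative of a coordinate function. -/
def supNormD {d : ℕ} (F : Coord d → Coord d) : ℝ≥0∞ :=
  ⨆ (i : Fin (d + 2)) (j : Fin (d + 2)),
    supNorm (fun z => fderiv ℝ (fun x => F x i) z (Pi.single j (1 : ℝ)))

/-- Weak mixing: the transformation preserves the measure and every measurable eigenfunction is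
almost everywhere constant. -/
def WeaklyMixing {X : Type*} [MeasurableSpace X] (μ : Measure X) (T : X → X) : Prop :=
  MeasurePreserving T μ μ ∧
    ∀ (h : X → ℂ) (c : ℂ), Measurable h → (∀ᵐ x ∂μ, h (T x) = c * h x) →
      ∃ a : ℂ, ∀ᵐ x ∂μ, h x = a

/-! ### Elementary bijections of `ℝ^m` -/

/-- The translation by `α` in the angular coordinate. -/
def rot {d : ℕ} (α : ℝ) : Equiv.Perm (Coord d) :=
  Equiv.addRight (Pi.single 0 α : Coord d)

/-- The shear `(θ, r₁, …) ↦ (θ + b r₁, r₁, …)`. -/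
def shear {d : ℕ} (b : ℝ) : Equiv.Perm (Coord d) where
  toFun x := x + Pi.single 0 (b * x 1)
  invFun x := x - Pi.single 0 (b * x 1)
  left_inv x := by
    have : (x + Pi.single 0 (b * x 1) : Coord d) 1 = x 1 := by simp
    simp [this]
  right_inv x := by
    have : (x - Pi.single 0 (b * x 1) : Coord d) 1 = x 1 := by simp
    simp [this]

/-- The diagonal map with entries `c i`. -/
def scale {d : ℕ} (c : Coord d) (hc : ∀ i, c i ≠ 0) : Equiv.Perm (Coord d) where
  toFun x := fun i => c i * x i
  invFun x := fun i => (c i)⁻¹ * x i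
  left_inv x := by
    ext i; simp [hc i]
  right_inv x := by
    ext i; simp [hc i]

/-- The quarter turn about the centre of the unit cube in the plane of the coordinates `0` and
`j.succ`. -/
def quarterTurn {d : ℕ} (j : Fin (d + 1)) (x : Coord d) : Coord d :=
  Function.update (Function.update x 0 (1 - x j.succ)) j.succ (x 0)

/-- A bijection that is the identity off `T` preserves `T`. -/
theorem perm_mem_iff {X : Type*} {P : Equiv.Perm X} {T : Set X} (hP : ∀ x, x ∉ T → P x = x)
    (x : X) : P x ∈ T ↔ x ∈ T := by
  constructor
  · intro h
    by_contra hx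
    rw [hP x hx] at h
    exact hx h
  · intro h
    by_contra hx
    have h1 := P.injective (hP (P x) hx)
    rw [h1] at hx
    exact hx h

theorem perm_symm_eq {X : Type*} {P : Equiv.Perm X} {T : Set X} (hP : ∀ x, x ∉ T → P x = x)
    (x : X) (hx : x ∉ T) : P.symm x = x := by
  rw [Equiv.symm_apply_eq, hP x hx]

/-- The points whose coordinates with index in `s` lie in `[0,1)`. -/
def cellSet {d : ℕ} (s : Finset (Fin (d + 2))) : Set (Coord d) :=
  {x | ∀ i ∈ s, x i ∈ Ico (0 : ℝ) 1}

/-- The integer parts of the coordinates with index in `s`, and zero elsewhere. -/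
def base {d : ℕ} (s : Finset (Fin (d + 2))) (x : Coord d) : Coord d :=
  fun i => if i ∈ s then ((⌊x i⌋ : ℤ) : ℝ) else 0

theorem sub_base_mem {d : ℕ} (s : Finset (Fin (d + 2))) (x : Coord d) :
    x - base s x ∈ cellSet s := by
  intro i hi
  simp only [Pi.sub_apply, base, hi, if_true]
  exact ⟨Int.fract_nonneg _, Int.fract_lt_one _⟩

theorem base_add {d : ℕ} (s : Finset (Fin (d + 2))) (x y : Coord d) (hy : y ∈ cellSet s) :
    base s (base s x + y) = base s x := by
  ext i
  by_cases hi : i ∈ s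
  · have h := hy i hi
    simp only [base, Pi.add_apply, hi, if_true]
    rw [Int.floor_intCast_add, Int.floor_eq_zero_iff.mpr h, add_zero]
  · simp [base, hi]

/-- The extension of `P` from the unit cell to all of `ℝ^m` that commutes with the integer
translations in the coordinates with index in `s`. -/
def periodize {d : ℕ} (s : Finset (Fin (d + 2))) (P : Equiv.Perm (Coord d))
    (hP : ∀ x, x ∉ cellSet s → P x = x) : Equiv.Perm (Coord d) where
  toFun x := base s x + P (x - base s x)
  invFun x := base s x + P.symm (x - base s x)
  left_inv x := by
    dsimp only
    rw [base_add s x _ ((perm_mem_iff hP _).mpr (sub_base_mem s x))]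
    simp
  right_inv x := by
    dsimp only
    rw [base_add s x _ ((perm_mem_iff (perm_symm_eq hP) _).mpr (sub_base_mem s x))]
    simp

theorem floor_periodize {d : ℕ} (s : Finset (Fin (d + 2))) (P : Equiv.Perm (Coord d))
    (hP : ∀ x, x ∉ cellSet s → P x = x) (x : Coord d) (i : Fin (d + 2)) (hi : i ∈ s) :
    ⌊periodize s P hP x i⌋ = ⌊x i⌋ := by
  have h := congrFun (base_add s x _ ((perm_mem_iff hP _).mpr (sub_base_mem s x))) i
  simp only [base, hi, if_true] at h
  exact_mod_cast h

open Classical in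
/-- `Q` on the invariant set `S`, the identity elsewhere. -/
def onSet {X : Type*} (S : Set X) (Q : Equiv.Perm X) (hQ : ∀ x, Q x ∈ S ↔ x ∈ S) :
    Equiv.Perm X where
  toFun x := if x ∈ S then Q x else x
  invFun x := if x ∈ S then Q.symm x else x
  left_inv x := by
    by_cases hx : x ∈ S
    · simp [hx, hQ]
    · simp [hx]
  right_inv x := by
    have h : Q.symm x ∈ S ↔ x ∈ S := by
      rw [← hQ (Q.symm x), Equiv.apply_symm_apply]
    by_cases hx : x ∈ S
    · simp [hx, h]
    · simp [hx]

/-- The map that acts as `e i` on the piece where `k = i`, each `e i` preserving the pieces. -/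
def glue {X ι : Type*} (e : ι → Equiv.Perm X) (k : X → ι) (h : ∀ i x, k (e i x) = k x) :
    Equiv.Perm X where
  toFun x := e (k x) x
  invFun x := (e (k x)).symm x
  left_inv x := by simp [h]
  right_inv x := by
    have h' : ∀ i x, k ((e i).symm x) = k x := fun i x => by
      rw [← h i ((e i).symm x), Equiv.apply_symm_apply]
    simp [h']

/-! ### The local building blocks -/

/-- A smooth volume-preserving diffeomorphism of `ℝ^m` which is the quarter turn in the plane of the
coordinates `0` and `j.succ` on `[2ε, 1-2ε]^m` and the identity outside `[ε, 1-ε]^m`. -/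
structure LocalRotation (d : ℕ) (ε : ℝ) (j : Fin (d + 1)) where
  toPerm : Equiv.Perm (Coord d)
  contDiff_toPerm : ContDiff ℝ ∞ toPerm
  contDiff_symm : ContDiff ℝ ∞ toPerm.symm
  measurePreserving : MeasurePreserving toPerm volume volume
  eq_quarterTurn : ∀ x, (∀ i, x i ∈ Icc (2 * ε) (1 - 2 * ε)) → toPerm x = quarterTurn j x
  eq_self : ∀ x, ¬ (∀ i, x i ∈ Icc ε (1 - ε)) → toPerm x = x

/-- A smooth volume-preserving diffeomorphism of `ℝ^m` acting only on the coordinates `0` and `1`.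
While the other coordinates stay in `[δ, 1-δ]` it is one fixed planar map, which is the identity on
`[4ε, 1-4ε]^2` and the shear `(x, y) ↦ (x + ε y, y)` outside `[ε, 1-ε]^2`.  When one of the other
coordinates is close to the boundary of `[0,1]`, it is the shear everywhere; in between it
interpolates.  If `m = 2` there are no other coordinates. -/
structure LocalShear (d : ℕ) (ε δ : ℝ) where
  toPerm : Equiv.Perm (Coord d)
  contDiff_toPerm : ContDiff ℝ ∞ toPerm
  contDiff_symm : ContDiff ℝ ∞ toPerm.symm
  measurePreserving : MeasurePreserving toPerm volume volume
  fibred : ∀ (x : Coord d) (i : Fin d), toPerm x i.succ.succ = x i.succ.succ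
  eq_shear : ∀ x : Coord d, ¬ (x 0 ∈ Icc ε (1 - ε) ∧ x 1 ∈ Icc ε (1 - ε)) →
    toPerm x = shear ε x
  planar : ∀ x y : Coord d, (∀ i : Fin d, x i.succ.succ ∈ Icc δ (1 - δ)) →
    (∀ i : Fin d, y i.succ.succ ∈ Icc δ (1 - δ)) → x 0 = y 0 → x 1 = y 1 →
      toPerm x 0 = toPerm y 0 ∧ toPerm x 1 = toPerm y 1
  eq_self : ∀ x : Coord d, (∀ i : Fin d, x i.succ.succ ∈ Icc δ (1 - δ)) →
    x 0 ∈ Icc (4 * ε) (1 - 4 * ε) → x 1 ∈ Icc (4 * ε) (1 - 4 * ε) → toPerm x = x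
  eq_shear_boundary : ∃ δ' : ℝ, 0 < δ' ∧ δ' < δ ∧ ∀ x : Coord d,
    ¬ (∀ i : Fin d, x i.succ.succ ∈ Icc δ' (1 - δ')) → toPerm x = shear ε x

section Blocks

variable {d : ℕ}

theorem LocalRotation.eq_self_off_cell {ε : ℝ} {j : Fin (d + 1)} (R : LocalRotation d ε j)
    (hε : 0 < ε) (s : Finset (Fin (d + 2))) (x : Coord d) (hx : x ∉ cellSet s) :
    R.toPerm x = x := by
  refine R.eq_self x fun h => hx fun i _ => ⟨?_, ?_⟩
  · linarith [(h i).1]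
  · linarith [(h i).2]

theorem LocalRotation.symm_eq_self {ε : ℝ} {j : Fin (d + 1)} (R : LocalRotation d ε j)
    (x : Coord d) (hx : ¬ (∀ i, x i ∈ Icc ε (1 - ε))) : R.toPerm.symm x = x := by
  rw [Equiv.symm_apply_eq, R.eq_self x hx]

/-- The inverse of `R`, repeated on all unit cubes of the integer lattice. -/
def latticeTurn {ε : ℝ} {j : Fin (d + 1)} (R : LocalRotation d ε j) (hε : 0 < ε) :
    Equiv.Perm (Coord d) :=
  periodize Finset.univ R.toPerm.symm
    (perm_symm_eq fun x hx => R.eq_self_off_cell hε Finset.univ x hx)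

theorem periodize_mem_Icc (P : Equiv.Perm (Coord d)) (s : Finset (Fin (d + 2)))
    (hP : ∀ x, x ∉ cellSet s → P x = x) (i : Fin (d + 2)) (hi : i ∈ s)
    (h0 : ∀ x : Coord d, x i = 0 → P x = x) (u v : ℤ) (x : Coord d)
    (hx : x i ∈ Icc (u : ℝ) v) : periodize s P hP x i ∈ Icc (u : ℝ) v := by
  have hf := floor_periodize s P hP x i hi
  constructor
  · rw [← Int.le_floor, hf, Int.le_floor]
    exact hx.1
  · rcases hx.2.lt_or_eq with h | h
    · have : periodize s P hP x i < v := by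
        rw [← Int.floor_lt, hf, Int.floor_lt]
        exact h
      exact this.le
    · have hz : (x - base s x) i = 0 := by
        simp [base, hi, h]
      have hfix : periodize s P hP x = x := by
        change base s x + P (x - base s x) = x
        rw [h0 _ hz]
        simp
      rw [hfix]
      exact hx.2

theorem periodize_symm (P : Equiv.Perm (Coord d)) (s : Finset (Fin (d + 2)))
    (hP : ∀ x, x ∉ cellSet s → P x = x) :
    (periodize s P hP).symm = periodize s P.symm (perm_symm_eq hP) := rfl

/-- `periodize` preserves a slab with integer faces in the coordinate `i`. -/
theorem periodize_mem_Icc_iff (P : Equiv.Perm (Coord d)) (s : Finset (Fin (d + 2)))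
    (hP : ∀ x, x ∉ cellSet s → P x = x) (i : Fin (d + 2)) (hi : i ∈ s)
    (h0 : ∀ x : Coord d, x i = 0 → P x = x) (u v : ℤ) (x : Coord d) :
    periodize s P hP x i ∈ Icc (u : ℝ) v ↔ x i ∈ Icc (u : ℝ) v := by
  refine ⟨fun h => ?_, periodize_mem_Icc P s hP i hi h0 u v x⟩
  have h0' : ∀ x : Coord d, x i = 0 → P.symm x = x := fun x hx => by
    rw [Equiv.symm_apply_eq, h0 x hx]
  have := periodize_mem_Icc P.symm s (perm_symm_eq hP) i hi h0' u v _ h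
  rwa [← periodize_symm P s hP, Equiv.symm_apply_apply] at this

/-- The map `x ↦ μ (x - δ)`, coordinate by coordinate. -/
def affine (μ δ : ℝ) (hμ : μ ≠ 0) : Equiv.Perm (Coord d) :=
  scale (fun _ => μ) (fun _ => hμ) * Equiv.subRight (fun _ => δ)

theorem affine_mem_iff (μ δ : ℝ) (hμ : 0 < μ) (x : Coord d) (i : Fin (d + 2)) :
    affine μ δ hμ.ne' x i ∈ Icc (0 : ℝ) (μ * (1 - 2 * δ)) ↔ x i ∈ Icc δ (1 - δ) := by
  have h : affine μ δ hμ.ne' x i = μ * (x i - δ) := rfl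
  rw [h, mem_Icc, mem_Icc, mul_le_mul_iff_right₀ hμ]
  constructor
  · rintro ⟨h1, h2⟩
    exact ⟨by linarith [nonneg_of_mul_nonneg_right h1 hμ], by linarith⟩
  · rintro ⟨h1, h2⟩
    exact ⟨mul_nonneg hμ.le (by linarith), by linarith⟩

/-- On `[δ, 1-δ]^m`, divided into cubes of side `1/μ`, the inverse of `R` rescaled to each of these
cubes; the identity elsewhere. -/
def psi {ε : ℝ} {j : Fin (d + 1)} (R : LocalRotation d ε j) (hε : 0 < ε) (μ δ : ℝ) (hμ : 0 < μ)
    (hδ : ∃ t : ℤ, μ * (1 - 2 * δ) = t) : Equiv.Perm (Coord d) :=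
  onSet {x | ∀ i, x i ∈ Icc δ (1 - δ)}
    ((affine μ δ hμ.ne').symm * latticeTurn R hε * affine μ δ hμ.ne') (by
      obtain ⟨t, ht⟩ := hδ
      intro x
      refine forall_congr' fun i => ?_
      rw [← affine_mem_iff μ δ hμ, ← affine_mem_iff μ δ hμ, ht, Equiv.Perm.mul_apply,
        Equiv.Perm.mul_apply, Equiv.apply_symm_apply]
      have := periodize_mem_Icc_iff R.toPerm.symm Finset.univ
        (perm_symm_eq fun x hx => R.eq_self_off_cell hε Finset.univ x hx) i (Finset.mem_univ i)
        (fun x hx => R.symm_eq_self x fun h => by linarith [(h i).1]) 0 t (affine μ δ hμ.ne' x)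
      simpa [latticeTurn] using this)

/-- The factor of the conjugation map `φ`: it is `C⁻¹ ∘ ψ ∘ φ_ε ∘ C` on the sector
`0 ≤ θ ≤ 1/Λ`, where `C` multiplies the angle by `Λ`, and commutes with the translation of the angle
by `1/Λ`. -/
def phiTilde {ε₁ ε₂ : ℝ} {j : Fin (d + 1)} (R₁ : LocalRotation d ε₁ j) (R₂ : LocalRotation d ε₂ j)
    (hε₁ : 0 < ε₁) (hε₂ : 0 < ε₂) (Λ μ δ : ℝ) (hΛ : 0 < Λ) (hμ : 0 < μ) (hδ₀ : 0 < δ)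
    (hδ : ∃ t : ℤ, μ * (1 - 2 * δ) = t) : Equiv.Perm (Coord d) :=
  let C : Equiv.Perm (Coord d) := scale (Function.update 1 0 Λ) (fun i => by
    by_cases hi : i = 0
    · subst hi; simpa using hΛ.ne'
    · simp [hi])
  C.symm * periodize {0} (psi R₂ hε₂ μ δ hμ hδ * R₁.toPerm) (fun x hx => by
    rw [Equiv.Perm.mul_apply, R₁.eq_self_off_cell hε₁ {0} x hx]
    refine if_neg fun h => hx fun i hi => ⟨?_, ?_⟩
    · linarith [(h i).1]
    · linarith [(h i).2]) * C

theorem floor_phiTilde {ε₁ ε₂ : ℝ} {j : Fin (d + 1)} (R₁ : LocalRotation d ε₁ j)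
    (R₂ : LocalRotation d ε₂ j) (hε₁ : 0 < ε₁) (hε₂ : 0 < ε₂) (Λ μ δ : ℝ) (hΛ : 0 < Λ)
    (hμ : 0 < μ) (hδ₀ : 0 < δ) (hδ : ∃ t : ℤ, μ * (1 - 2 * δ) = t) (x : Coord d) :
    ⌊Λ * phiTilde R₁ R₂ hε₁ hε₂ Λ μ δ hΛ hμ hδ₀ hδ x 0⌋ = ⌊Λ * x 0⌋ := by
  have key : ∀ (C Q : Equiv.Perm (Coord d)), (∀ y, C y 0 = Λ * y 0) →
      (∀ y, ⌊Q y 0⌋ = ⌊y 0⌋) → ⌊Λ * (C.symm * Q * C) x 0⌋ = ⌊Λ * x 0⌋ := by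
    intro C Q hC hQ
    rw [← hC, ← hC x, Equiv.Perm.mul_apply, Equiv.Perm.mul_apply, Equiv.apply_symm_apply, hQ]
  refine key _ _ (fun y => ?_) (fun y => floor_periodize _ _ _ _ _ (Finset.mem_singleton_self 0))
  simp [scale]

/-- The correction between `G` and the shear. -/
theorem LocalShear.corr_eq_self {ε δ : ℝ} (G : LocalShear d ε δ) (x : Coord d)
    (hx : ¬ (x 0 ∈ Icc ε (1 - ε) ∧ x 1 ∈ Icc ε (1 - ε))) : ((shear ε : Equiv.Perm (Coord d)).symm * G.toPerm : Equiv.Perm (Coord d)) x = x := by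
  rw [Equiv.Perm.mul_apply, G.eq_shear x hx, Equiv.symm_apply_apply]

/-- The diagonal map `(θ, r₁, r₂, …) ↦ (a θ, (b a / ε) r₁, r₂, …)`. -/
def blockScale (a b ε : ℝ) (ha : 0 < a) (hb : 0 < b) (hε : 0 < ε) : Equiv.Perm (Coord d) :=
  scale (fun i => if i = 0 then a else if i = 1 then b * a / ε else 1) (fun i => by
    split_ifs
    · exact ha.ne'
    · exact (div_pos (mul_pos hb ha) hε).ne'
    · exact one_ne_zero)

/-- The map `shear⁻¹ ∘ G`, which is the identity near the boundary of the unit cell, extended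
periodically and rescaled to cells of size `1/a` by `ε/(b a)`. -/
def blockCorr {ε δ : ℝ} (G : LocalShear d ε δ) (hε : 0 < ε) (a b : ℝ) (ha : 0 < a) (hb : 0 < b) :
    Equiv.Perm (Coord d) :=
  (blockScale a b ε ha hb hε).symm * periodize {0, 1} ((shear ε).symm * G.toPerm) (fun x hx =>
    G.corr_eq_self x fun h => hx fun i hi => by
      rcases Finset.mem_insert.mp hi with h0 | h1
      · subst h0
        exact ⟨by linarith [h.1.1], by linarith [h.1.2]⟩
      · rw [Finset.mem_singleton] at h1
        subst h1
        exact ⟨by linarith [h.2.1], by linarith [h.2.2]⟩) * blockScale a b ε ha hb hε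

/-- The cell map `g_{a,b,ε,δ}`: where `δ ≤ r₁ ≤ 1 - δ` it is the rescaled map `G` repeated along the
shear (see `gBlock_apply`); elsewhere it is the shear `θ ↦ θ + b r₁`. -/
def gBlockCorr {ε δ : ℝ} (G : LocalShear d ε δ) (hε : 0 < ε) (a b : ℝ) (ha : 0 < a) (hb : 0 < b)
    (h₁ : ∃ t : ℤ, b * a / ε * δ = t) (h₂ : ∃ t : ℤ, b * a / ε = t) : Equiv.Perm (Coord d) :=
  onSet {x | x 1 ∈ Icc δ (1 - δ)} (blockCorr G hε a b ha hb) (by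
    obtain ⟨t, ht⟩ := h₁
    obtain ⟨t', ht'⟩ := h₂
    have hN : 0 < b * a / ε := div_pos (mul_pos hb ha) hε
    have hsc : ∀ y : Coord d, blockScale a b ε ha hb hε y 1 ∈ Icc (t : ℝ) ((t' - t : ℤ) : ℝ) ↔
        y 1 ∈ Icc δ (1 - δ) := by
      intro y
      have h : blockScale a b ε ha hb hε y 1 = b * a / ε * y 1 := by
        simp [blockScale, scale]
      rw [h, Int.cast_sub, ← ht, ← ht', mem_Icc, mem_Icc, mul_le_mul_iff_right₀ hN,
        show b * a / ε - b * a / ε * δ = b * a / ε * (1 - δ) by ring, mul_le_mul_iff_right₀ hN]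
    intro x
    change _ ∈ Icc δ (1 - δ) ↔ _ ∈ Icc δ (1 - δ)
    rw [← hsc, ← hsc, blockCorr, Equiv.Perm.mul_apply,
      Equiv.Perm.mul_apply, Equiv.apply_symm_apply]
    exact periodize_mem_Icc_iff _ _ _ 1 (by simp)
      (fun y hy => G.corr_eq_self y fun h => by linarith [h.2.1]) t (t' - t) _)

/-- The cell map `g_{a,b,ε,δ}`. -/
def gBlock {ε δ : ℝ} (G : LocalShear d ε δ) (hε : 0 < ε) (a b : ℝ) (ha : 0 < a) (hb : 0 < b)
    (h₁ : ∃ t : ℤ, b * a / ε * δ = t) (h₂ : ∃ t : ℤ, b * a / ε = t) : Equiv.Perm (Coord d) :=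
  shear b * gBlockCorr G hε a b ha hb h₁ h₂

theorem gBlock_apply {ε δ : ℝ} (G : LocalShear d ε δ) (hε : 0 < ε) (a b : ℝ) (ha : 0 < a)
    (hb : 0 < b) (h₁ : ∃ t : ℤ, b * a / ε * δ = t) (h₂ : ∃ t : ℤ, b * a / ε = t) (x : Coord d) :
    gBlock G hε a b ha hb h₁ h₂ x =
      if x 1 ∈ Icc δ (1 - δ) then
        (blockScale a b ε ha hb hε).symm (G.toPerm (blockScale a b ε ha hb hε x -
            Pi.single 0 (⌊a * x 0⌋ : ℝ) - Pi.single 1 (⌊b * a / ε * x 1⌋ : ℝ))) +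
          Pi.single 0 ((⌊a * x 0⌋ : ℝ) / a + (⌊b * a / ε * x 1⌋ : ℝ) * (ε / a)) +
          Pi.single 1 ((⌊b * a / ε * x 1⌋ : ℝ) * (ε / (b * a)))
      else x + Pi.single 0 (b * x 1) := by
  by_cases hx : x 1 ∈ Icc δ (1 - δ)
  · rw [if_pos hx]
    have hc : gBlockCorr G hε a b ha hb h₁ h₂ x = blockCorr G hε a b ha hb x := if_pos hx
    have hb0 : blockScale a b ε ha hb hε x - base {0, 1} (blockScale a b ε ha hb hε x) =
        blockScale a b ε ha hb hε x -
            Pi.single 0 (⌊a * x 0⌋ : ℝ) - Pi.single 1 (⌊b * a / ε * x 1⌋ : ℝ) := by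
      ext i
      by_cases h0 : i = 0
      · subst h0; simp [base, blockScale, scale]
      · by_cases h1 : i = 1
        · subst h1; simp [base, blockScale, scale]
        · simp [base, h0, h1]
    set y := blockScale a b ε ha hb hε x -
            Pi.single 0 (⌊a * x 0⌋ : ℝ) - Pi.single 1 (⌊b * a / ε * x 1⌋ : ℝ) with hy
    have hB : blockCorr G hε a b ha hb x = (blockScale a b ε ha hb hε).symm
        (base {0, 1} (blockScale a b ε ha hb hε x) + (shear ε).symm (G.toPerm y)) := by
      rw [← hb0]; rfl
    have hne : (1 : Fin (d + 2)) ≠ 0 := by simp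
    have e0 : blockCorr G hε a b ha hb x 0 =
        a⁻¹ * ((⌊a * x 0⌋ : ℝ) + (G.toPerm y 0 - ε * G.toPerm y 1)) := by
      rw [hB]; simp [base, blockScale, scale, shear]
    have e1 : blockCorr G hε a b ha hb x 1 =
        (b * a / ε)⁻¹ * ((⌊b * a / ε * x 1⌋ : ℝ) + G.toPerm y 1) := by
      rw [hB]; simp [base, blockScale, scale, shear]
    have hg : gBlock G hε a b ha hb h₁ h₂ x = blockCorr G hε a b ha hb x +
        Pi.single 0 (b * blockCorr G hε a b ha hb x 1) := by
      rw [← hc]; rfl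
    rw [hg]
    ext i
    by_cases h0 : i = 0
    · subst h0
      simp only [Pi.add_apply, Pi.single_eq_same]
      rw [e0, e1]
      simp [blockScale, scale]
      field_simp
      ring
    · by_cases h1 : i = 1
      · subst h1
        simp only [Pi.add_apply, Pi.single_eq_same]
        rw [e1]
        simp [blockScale, scale]
        field_simp
        ring
      · rw [hB]
        simp [base, blockScale, scale, shear, h0, h1]
  · rw [if_neg hx]
    have hc : gBlockCorr G hε a b ha hb h₁ h₂ x = x := if_neg hx
    change shear b (gBlockCorr G hε a b ha hb h₁ h₂ x) = _
    rw [hc]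
    rfl

theorem floor_gBlockCorr {ε δ : ℝ} (G : LocalShear d ε δ) (hε : 0 < ε) (a b : ℝ) (ha : 0 < a)
    (hb : 0 < b) (h₁ : ∃ t : ℤ, b * a / ε * δ = t) (h₂ : ∃ t : ℤ, b * a / ε = t) (x : Coord d) :
    ⌊a * gBlockCorr G hε a b ha hb h₁ h₂ x 0⌋ = ⌊a * x 0⌋ := by
  by_cases hx : x 1 ∈ Icc δ (1 - δ)
  · have hc : gBlockCorr G hε a b ha hb h₁ h₂ x = blockCorr G hε a b ha hb x := if_pos hx
    have hs : ∀ y : Coord d, a * y 0 = blockScale a b ε ha hb hε y 0 := fun y => by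
      simp [blockScale, scale]
    rw [hc, hs, hs, blockCorr, Equiv.Perm.mul_apply, Equiv.Perm.mul_apply, Equiv.apply_symm_apply]
    exact floor_periodize _ _ _ _ _ (by simp)
  · have hc : gBlockCorr G hε a b ha hb h₁ h₂ x = x := if_neg hx
    rw [hc]

end Blocks

/-! ### The construction -/

/-- The parameters and choices of the construction. -/
structure ConjData (d : ℕ) where
  σ : ℝ
  σ_pos : 0 < σ
  σ_lt_one : σ < 1
  p : ℕ → ℤ
  q : ℕ → ℕ
  reduced : ∀ n, 1 ≤ n → ∃ (p' : ℤ) (q' : ℕ), 0 < q' ∧ IsCoprime p' (q' : ℤ) ∧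
    p n = 260 * (n : ℤ) ^ 4 * p' ∧ q n = 260 * n ^ 4 * q'
  growth : ∀ n, 1 ≤ n →
    64 * 260 * (n + 1) ^ 4 * n ^ 11 * q n ^ ((d + 1) * n ^ 2 + 3) ≤ q (n + 1)
  localShear : ∀ n : ℕ, 1 ≤ n → LocalShear d (1 / (8 * (n : ℝ) ^ 4)) (1 / (32 * (n : ℝ) ^ 4))
  outerTurn : ∀ n : ℕ, 1 ≤ n → ∀ j : Fin (d + 1), LocalRotation d (1 / (60 * (n : ℝ) ^ 4)) j
  innerTurn : ∀ n : ℕ, 1 ≤ n → ∀ j : Fin (d + 1), LocalRotation d (1 / (22 * (n : ℝ) ^ 4)) j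

namespace ConjData

variable {d : ℕ} (C : ConjData d)

/-- The rational number `α_n = p_n / q_n`. -/
def α (n : ℕ) : ℝ := (C.p n : ℝ) / (C.q n : ℝ)

theorem dvd_q (n : ℕ) (hn : 1 ≤ n) : 260 * n ^ 4 ∣ C.q n := by
  obtain ⟨p', q', -, -, -, h⟩ := C.reduced n hn
  exact ⟨q', h⟩

theorem q_pos (n : ℕ) (hn : 1 ≤ n) : 0 < C.q n := by
  obtain ⟨p', q', h0, -, -, h⟩ := C.reduced n hn
  rw [h]
  positivity

/-- The integer part of `n q_n^σ`, the strength of the shear. -/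
def b (n : ℕ) : ℝ := (⌊(n : ℝ) * (C.q n : ℝ) ^ C.σ⌋₊ : ℝ)

theorem b_pos (n : ℕ) (hn : 1 ≤ n) : 0 < C.b n := by
  have hq : (1 : ℝ) ≤ C.q n := by exact_mod_cast C.q_pos n hn
  have h1 : (1 : ℝ) ≤ (C.q n : ℝ) ^ C.σ := Real.one_le_rpow hq C.σ_pos.le
  have h2 : (1 : ℝ) ≤ n := by exact_mod_cast hn
  have h3 : (1 : ℝ) ≤ (n : ℝ) * (C.q n : ℝ) ^ C.σ := by nlinarith
  have : 0 < ⌊(n : ℝ) * (C.q n : ℝ) ^ C.σ⌋₊ := Nat.floor_pos.mpr h3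
  unfold b
  exact_mod_cast this

/-- The angular frequency `a = n q_n^(1 + (m-1) k (k+1) / 2)` of `g_n` on the section `k`. -/
def aFreq (n k : ℕ) : ℕ := n * C.q n ^ (1 + (d + 1) * (k * (k + 1) / 2))

/-- The angular frequency of the factor `j` of `φ_n` on the section `k`; the factor `j` rotates the
coordinates `0` and `j.succ`. -/
def phiFreq (n k : ℕ) (j : Fin (d + 1)) : ℕ :=
  n * C.q n ^ (1 + (d + 1) * (k * (k - 1) / 2) + (j : ℕ) * k)

/-- The sector `[0, 1/q_n]` of the angle and its translates by multiples of `1/q_n` are divided into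
`n` sections of length `1/(n q_n)`; `sec n x + 1` is the number of the section that contains `x`. -/
def sec (n : ℕ) (x : Coord d) : ℕ := (⌊((n * C.q n : ℕ) : ℝ) * x 0⌋ % (n : ℤ)).toNat

theorem sec_eq_of_floor (n N : ℕ) (hN : 0 < N) (x y : Coord d)
    (h : ⌊((n * C.q n * N : ℕ) : ℝ) * y 0⌋ = ⌊((n * C.q n * N : ℕ) : ℝ) * x 0⌋) :
    C.sec n y = C.sec n x := by
  have hN' : (N : ℝ) ≠ 0 := by exact_mod_cast hN.ne'
  have key : ∀ z : Coord d, ⌊((n * C.q n : ℕ) : ℝ) * z 0⌋ =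
      ⌊((n * C.q n * N : ℕ) : ℝ) * z 0⌋ / (N : ℤ) := by
    intro z
    rw [← Int.floor_div_natCast]
    congr 1
    push_cast
    field_simp
  unfold sec
  rw [key y, key x, h]

theorem aFreq_pos (n k : ℕ) (hn : 1 ≤ n) : (0 : ℝ) < C.aFreq n k := by
  have := C.q_pos n hn
  unfold aFreq
  exact_mod_cast (by positivity)

theorem phiFreq_pos (n k : ℕ) (j : Fin (d + 1)) (hn : 1 ≤ n) : (0 : ℝ) < C.phiFreq n k j := by
  have := C.q_pos n hn
  unfold phiFreq
  exact_mod_cast (by positivity)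

theorem pow_pos' (n : ℕ) (hn : 1 ≤ n) : (0 : ℝ) < (n : ℝ) ^ 4 := by
  have : (0 : ℝ) < n := by exact_mod_cast hn
  positivity

theorem block_int (n k : ℕ) (hn : 1 ≤ n) :
    ∃ t : ℤ, C.b n * (C.aFreq n k : ℝ) / (1 / (8 * (n : ℝ) ^ 4)) = t := by
  refine ⟨(⌊(n : ℝ) * (C.q n : ℝ) ^ C.σ⌋₊ : ℤ) * (C.aFreq n k : ℤ) * (8 * (n : ℤ) ^ 4), ?_⟩
  have := pow_pos' n hn
  unfold b
  push_cast
  field_simp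

theorem block_int' (n k : ℕ) (hn : 1 ≤ n) :
    ∃ t : ℤ, C.b n * (C.aFreq n k : ℝ) / (1 / (8 * (n : ℝ) ^ 4)) * (1 / (32 * (n : ℝ) ^ 4)) =
      t := by
  have h4 : 4 ∣ C.aFreq n k := by
    refine Dvd.dvd.mul_left (dvd_pow ?_ (by omega)) n
    exact (Dvd.dvd.mul_right (by norm_num) _).trans (C.dvd_q n hn)
  obtain ⟨c, hc⟩ := h4
  refine ⟨(⌊(n : ℝ) * (C.q n : ℝ) ^ C.σ⌋₊ : ℤ) * (c : ℤ), ?_⟩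
  have := pow_pos' n hn
  rw [hc]
  unfold b
  push_cast
  field_simp
  ring

theorem psi_int (n k : ℕ) (hn : 1 ≤ n) (hk : 1 ≤ k) :
    ∃ t : ℤ, ((C.q n : ℝ) ^ k) * (1 - 2 * (1 / (10 * (n : ℝ) ^ 4))) = t := by
  have h : 10 * n ^ 4 ∣ C.q n ^ k :=
    ((mul_dvd_mul_right (by norm_num) _).trans (C.dvd_q n hn)).trans (dvd_pow_self _ (by omega))
  obtain ⟨c, hc⟩ := h
  have hc' : (C.q n : ℝ) ^ k = 10 * (n : ℝ) ^ 4 * c := by exact_mod_cast hc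
  refine ⟨10 * (n : ℤ) ^ 4 * c - 2 * c, ?_⟩
  have := pow_pos' n hn
  rw [hc']
  push_cast
  field_simp

/-- The map that `g_n` equals on the section `k`. -/
def gSection (n : ℕ) (hn : 1 ≤ n) (k : ℕ) : Equiv.Perm (Coord d) :=
  gBlock (C.localShear n hn) (by have := pow_pos' n hn; positivity) (C.aFreq n k) (C.b n)
    (C.aFreq_pos n k hn) (C.b_pos n hn) (C.block_int' n k hn) (C.block_int n k hn)

theorem sec_gSection (n : ℕ) (hn : 1 ≤ n) (k : ℕ) (x : Coord d) :
    C.sec n (((shear (C.b n)).symm * C.gSection n hn k : Equiv.Perm (Coord d)) x) =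
      C.sec n x := by
  refine C.sec_eq_of_floor n (C.q n ^ ((d + 1) * (k * (k + 1) / 2)))
    (pow_pos (C.q_pos n hn) _) x _ ?_
  have hN : n * C.q n * C.q n ^ ((d + 1) * (k * (k + 1) / 2)) = C.aFreq n k := by
    unfold aFreq
    ring
  rw [hN, Equiv.Perm.mul_apply, gSection, gBlock, Equiv.Perm.mul_apply, Equiv.symm_apply_apply]
  exact floor_gBlockCorr _ _ _ _ _ _ _ _ _

/-- The map `g_n`, see `g_apply`. -/
def g (n : ℕ) (hn : 1 ≤ n) : Equiv.Perm (Coord d) :=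
  shear (C.b n) * glue (fun s => (shear (C.b n)).symm * C.gSection n hn (s + 1)) (C.sec n)
    (fun s x => C.sec_gSection n hn (s + 1) x)

theorem g_apply (n : ℕ) (hn : 1 ≤ n) (x : Coord d) :
    C.g n hn x = C.gSection n hn (C.sec n x + 1) x :=
  (shear (C.b n)).apply_symm_apply _

/-- The factor `j` of `φ_n` on the section `k`. -/
def phiFactor (n : ℕ) (hn : 1 ≤ n) (k : ℕ) (hk : 1 ≤ k) (j : Fin (d + 1)) :
    Equiv.Perm (Coord d) :=
  phiTilde (C.outerTurn n hn j) (C.innerTurn n hn j)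
    (by have := pow_pos' n hn; positivity) (by have := pow_pos' n hn; positivity)
    (C.phiFreq n k j) ((C.q n : ℝ) ^ k) (1 / (10 * (n : ℝ) ^ 4))
    (C.phiFreq_pos n k j hn) (pow_pos (by exact_mod_cast C.q_pos n hn) k)
    (by have := pow_pos' n hn; positivity) (C.psi_int n k hn hk)

/-- The map that `φ_n` equals on the section `k`: the composition of all factors, the factor with
`j = 0` being applied first. -/
def phiSection (n : ℕ) (hn : 1 ≤ n) (k : ℕ) (hk : 1 ≤ k) : Equiv.Perm (Coord d) :=
  (List.ofFn (C.phiFactor n hn k hk)).reverse.prod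

theorem sec_phiFactor (n : ℕ) (hn : 1 ≤ n) (k : ℕ) (hk : 1 ≤ k) (j : Fin (d + 1)) (x : Coord d) :
    C.sec n (C.phiFactor n hn k hk j x) = C.sec n x := by
  refine C.sec_eq_of_floor n (C.q n ^ ((d + 1) * (k * (k - 1) / 2) + (j : ℕ) * k))
    (pow_pos (C.q_pos n hn) _) x _ ?_
  have hN : n * C.q n * C.q n ^ ((d + 1) * (k * (k - 1) / 2) + (j : ℕ) * k) =
      C.phiFreq n k j := by
    unfold phiFreq
    ring
  rw [hN]
  exact floor_phiTilde _ _ _ _ _ _ _ _ _ _ _ _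

theorem sec_phiSection (n : ℕ) (hn : 1 ≤ n) (k : ℕ) (hk : 1 ≤ k) (x : Coord d) :
    C.sec n (C.phiSection n hn k hk x) = C.sec n x := by
  have key : ∀ l : List (Equiv.Perm (Coord d)),
      (∀ P ∈ l, ∀ y, C.sec n (P y) = C.sec n y) → ∀ y, C.sec n (l.prod y) = C.sec n y := by
    intro l
    induction l with
    | nil => intro _ y; rfl
    | cons P l ih =>
      intro h y
      rw [List.prod_cons, Equiv.Perm.mul_apply, h P List.mem_cons_self,
        ih fun Q hQ => h Q (List.mem_cons_of_mem P hQ)]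
  refine key _ (fun P hP => ?_) x
  rw [List.mem_reverse, List.mem_ofFn] at hP
  obtain ⟨j, rfl⟩ := hP
  exact C.sec_phiFactor n hn k hk j

/-- The map `φ_n`. -/
def phi (n : ℕ) (hn : 1 ≤ n) : Equiv.Perm (Coord d) :=
  glue (fun s => C.phiSection n hn (s + 1) (Nat.succ_pos s)) (C.sec n)
    (fun s x => C.sec_phiSection n hn (s + 1) (Nat.succ_pos s) x)

/-- The conjugation maps `H_n = h_1 ∘ … ∘ h_n` with `h_n = g_n ∘ φ_n`. -/
def H : ℕ → Equiv.Perm (Coord d)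
  | 0 => 1
  | n + 1 => H n * (C.g (n + 1) (Nat.succ_pos n) * C.phi (n + 1) (Nat.succ_pos n))

/-- The map `f_n = H_n ∘ R_{α_{n+1}} ∘ H_n⁻¹`, on the universal cover. -/
def f (n : ℕ) : Equiv.Perm (Coord d) := C.H n * rot (C.α (n + 1)) * (C.H n)⁻¹

/-- The natural number `m_n`. -/
def mTime (n : ℕ) : ℕ :=
  sInf {t : ℕ | 1 ≤ t ∧ t ≤ C.q (n + 1) ∧
    ⨅ k : ℤ, |(t : ℝ) * C.α (n + 1) - 1 / ((n : ℝ) * C.q n) + (k : ℝ) / C.q n| ≤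
      260 * ((n : ℝ) + 1) ^ 4 / C.q (n + 1)}

end ConjData

end AbC

/-!
The theorem is proved by showing that continuous functions decorrelate along the times `m_n`.  All
computations take place on the cube `[0,1)^m`, a fundamental domain of the universal cover, with
maps that preserve volume, preserve the half-open strip and commute with the unit translation of
the angle (`Admissible`); integrals over the cube of functions of period one are invariant under
them.  Since coordinate functions are compared modulo integers, the test functions `X`, `Y` are
continuous functions on the torus `(ℝ/ℤ)^m`; the manifold is mapped to it injectively up to a null
set.

By the substitution `x = H_n z`, the correlation of `X ∘ f_n^{m_n}` and `Y` becomes that of `X' ∘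
h_n ∘ R` and `Y' ∘ h_n`, where `X' = X ∘ H_{n-1}`, `Y' = Y ∘ H_{n-1}` and `R` is the rotation by
`m_n α_{n+1}`.  Modulo `1 / q_n` this rotation is very nearly one by `1 / (n q_n)`, the length of
one section.  Divide the section `k < n` into cells whose length is the inverse of the frequency of
`g_n` there.

* On such a cell `φ_n` replaces the radial coordinates by the relative positions of the angle in
  sectors of frequencies that divide that of the cell (`phiTilde_apply_of_good`), so these are
  nearly constant on the cell, up to a small exceptional set.  Hence so is `Y' ∘ h_n`
  (`norm_g_phi_sub_le`).
* The rotation moves the cell to the section `k + 1`.  There all frequencies are multiples of that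
  of the cell, so that `h_n`, followed by the inverse of the shear of strength `b_n`, preserves the
  cell (`theta_mem_cell`).  The shear spreads the cell over the whole manifold, and the average of
  `X'` over its image is nearly the mean of `X'`, which is zero (`norm_setIntegral_shear_le`).

Together these bound the correlation (`norm_setIntegral_correlation_le`).  The hypothesis on the
derivative makes the oscillations of `X'` at scale `1 / b_n` and of `Y'` at scale `b_n / q_n` tend
to zero, because `log q_n` is negligible against every power of `q_n`
(`ConjData.tendsto_correlation_f`).  Closeness of `f^{m_n}` and `f_n^{m_n}` carries the decay over
to `f` (`CylDiffeo.tendsto_correlation`).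

Convergence of `f_n` to `f` shows that `f` preserves the image of the volume on the torus, hence
the volume (`CylDiffeo.measurePreserving_toEquiv`).  An eigenfunction of `f` may be assumed
bounded, of mean zero and with an eigenvalue of modulus one (`weaklyMixing_of_bounded`).  The
correlations of such a function with itself along the iterates have constant modulus, the square of
its norm in `L²`; by approximation they tend to zero along the `m_n`
(`ae_eq_zero_of_tendsto_correlation`).
-/

namespace AbC

variable {d : ℕ}

/-! ### Cells and admissible maps -/

/-- The points of `ℝ^m` whose radial coordinates lie in `[0,1)`. -/
def halfStrip (d : ℕ) : Set (Coord d) := {x | ∀ i : Fin (d + 1), x i.succ ∈ Ico (0 : ℝ) 1}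

/-- The slab `i / A ≤ θ < (i + 1) / A` of `halfStrip d`; in particular `cell 1 0` is `[0,1)^m`. -/
def cell (A : ℕ) (i : ℤ) : Set (Coord d) := {x | ⌊(A : ℝ) * x 0⌋ = i ∧ x ∈ halfStrip d}

theorem measurableSet_halfStrip : MeasurableSet (halfStrip d) := by
  unfold halfStrip
  simp only [ofPred_forall]
  exact MeasurableSet.iInter fun i => measurableSet_Ico.preimage (measurable_pi_apply _)

theorem measurableSet_cell (A : ℕ) (i : ℤ) : MeasurableSet (cell A i : Set (Coord d)) := by
  refine MeasurableSet.inter ?_ measurableSet_halfStrip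
  have h : Measurable fun x : Coord d => ⌊(A : ℝ) * x 0⌋ :=
    Int.measurable_floor.comp ((measurable_pi_apply 0).const_mul _)
  exact h (measurableSet_singleton i)

theorem mem_cell_one_zero {x : Coord d} : x ∈ cell 1 0 ↔ ∀ i, x i ∈ Ico (0 : ℝ) 1 := by
  simp only [cell, halfStrip, Nat.cast_one, one_mul, mem_ofPred_eq, Int.floor_eq_zero_iff]
  exact (Fin.forall_fin_succ (P := fun i => x i ∈ Ico (0 : ℝ) 1)).symm

theorem add_single_mem_halfStrip {x : Coord d} {v : ℝ} :
    x + Pi.single 0 v ∈ halfStrip d ↔ x ∈ halfStrip d := by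
  simp [halfStrip]

theorem add_single_mem_cell {A : ℕ} (hA : 0 < A) {i s : ℤ} {x : Coord d} :
    x + Pi.single 0 ((s : ℝ) / A) ∈ cell A (i + s) ↔ x ∈ cell A i := by
  have hA' : (A : ℝ) ≠ 0 := by positivity
  have : (A : ℝ) * (x + Pi.single 0 ((s : ℝ) / A) : Coord d) 0 = A * x 0 + s := by
    simp; field_simp
  simp only [cell, mem_ofPred_eq, this, Int.floor_add_intCast, add_single_mem_halfStrip]
  simp

theorem cell_eq_pi {A : ℕ} (hA : 0 < A) (i : ℤ) :
    (cell A i : Set (Coord d)) = Set.univ.pi fun l =>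
      Ico (if l = 0 then (i : ℝ) / A else 0) (if l = 0 then ((i : ℝ) + 1) / A else 1) := by
  have hA' : (0 : ℝ) < A := by exact_mod_cast hA
  ext x
  simp only [cell, halfStrip, mem_ofPred_eq, Set.mem_pi, mem_univ, true_imp_iff]
  rw [Fin.forall_fin_succ (P := fun l => x l ∈ Ico (if l = 0 then (i : ℝ) / A else 0)
    (if l = 0 then ((i : ℝ) + 1) / A else 1)), Int.floor_eq_iff]
  simp only [if_true, Fin.succ_ne_zero, if_false]
  refine and_congr ?_ Iff.rfl
  rw [mem_Ico, div_le_iff₀ hA', lt_div_iff₀ hA', mul_comm]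

theorem volume_cell {A : ℕ} (hA : 0 < A) (i : ℤ) :
    volume (cell A i : Set (Coord d)) = ENNReal.ofReal (1 / A) := by
  rw [cell_eq_pi hA, Real.volume_pi_Ico, Fin.prod_univ_succ]
  simp only [if_true, Fin.succ_ne_zero, if_false]
  simp [add_div]

theorem measureReal_cell {A : ℕ} (hA : 0 < A) (i : ℤ) :
    volume.real (cell A i : Set (Coord d)) = 1 / A := by
  rw [Measure.real, volume_cell hA, ENNReal.toReal_ofReal (by positivity)]

instance isFiniteMeasure_cell (i : ℤ) (A : ℕ) [NeZero A] :
    IsFiniteMeasure (volume.restrict (cell A i : Set (Coord d))) := by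
  constructor
  rw [Measure.restrict_apply_univ, volume_cell (Nat.pos_of_ne_zero (NeZero.ne A))]
  exact ENNReal.ofReal_lt_top

/-- A cell is the disjoint union of `N` cells of a frequency `N` times as high. -/
theorem setIntegral_cell_mul {E : Type*} [NormedAddCommGroup E] [NormedSpace ℝ E] {A N : ℕ}
    (hA : 0 < A) (hN : 0 < N) (i : ℤ) (F : Coord d → E)
    (hF : IntegrableOn F (cell A i)) :
    ∫ x in cell A i, F x = ∑ j ∈ Finset.range N, ∫ x in cell (A * N) (i * N + j), F x := by
  have hN' : (N : ℝ) ≠ 0 := by positivity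
  have key : ∀ x : Coord d, ⌊(A : ℝ) * x 0⌋ = ⌊((A * N : ℕ) : ℝ) * x 0⌋ / (N : ℤ) := by
    intro z
    rw [← Int.floor_div_natCast]
    congr 1
    push_cast
    field_simp
  have hU : (cell A i : Set (Coord d)) = ⋃ j ∈ Finset.range N, cell (A * N) (i * N + j) := by
    ext x
    have hN0 : (0 : ℤ) < N := by exact_mod_cast hN
    simp only [cell, mem_ofPred_eq, mem_iUnion, Finset.mem_range, exists_prop, key x]
    constructor
    · rintro ⟨h, hx⟩
      refine ⟨(⌊((A * N : ℕ) : ℝ) * x 0⌋ % (N : ℤ)).toNat, ?_, ?_, hx⟩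
      · have := Int.emod_lt_of_pos ⌊((A * N : ℕ) : ℝ) * x 0⌋ hN0
        have := Int.emod_nonneg ⌊((A * N : ℕ) : ℝ) * x 0⌋ hN0.ne'
        omega
      · rw [Int.toNat_of_nonneg (Int.emod_nonneg _ hN0.ne'), ← h, mul_comm (_ / _),
          Int.mul_ediv_add_emod]
    · rintro ⟨j, hj, h, hx⟩
      refine ⟨?_, hx⟩
      rw [h, add_comm, Int.add_mul_ediv_right _ _ hN0.ne',
        Int.ediv_eq_zero_of_lt (by omega) (by exact_mod_cast hj), zero_add]
  rw [hU, integral_biUnion_finset]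
  · intro j _
    exact measurableSet_cell _ _
  · intro j _ l _ hjl
    refine Set.disjoint_left.mpr fun x hx hx' => hjl ?_
    have := hx.1.symm.trans hx'.1
    omega
  · intro j hj
    refine hF.mono_set ?_
    rw [hU]
    exact subset_biUnion_of_mem (u := fun j : ℕ => cell (A * N) (i * N + j)) hj

/-- A volume-preserving bijection of the universal cover that preserves `halfStrip d` and commutes
with the deck transformation `θ ↦ θ + 1`. -/
structure Admissible (P : Equiv.Perm (Coord d)) : Prop where
  measurePreserving : MeasurePreserving P volume volume
  mem_iff : ∀ x, P x ∈ halfStrip d ↔ x ∈ halfStrip d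
  add_one : ∀ x, P (x + Pi.single 0 1) = P x + Pi.single 0 1

theorem Admissible.one : Admissible (1 : Equiv.Perm (Coord d)) :=
  ⟨MeasurePreserving.id _, fun _ => Iff.rfl, fun _ => rfl⟩

theorem Admissible.mul {P Q : Equiv.Perm (Coord d)} (hP : Admissible P) (hQ : Admissible Q) :
    Admissible (P * Q) where
  measurePreserving := hP.measurePreserving.comp hQ.measurePreserving
  mem_iff x := (hP.mem_iff _).trans (hQ.mem_iff x)
  add_one x := by
    simp only [Equiv.Perm.mul_apply, hQ.add_one, hP.add_one]

theorem measurableEmbedding_of_perm {P : Equiv.Perm (Coord d)} (hP : Measurable P) :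
    MeasurableEmbedding P :=
  hP.measurableEmbedding P.injective

theorem map_add_int {P : Coord d → Coord d} (h : ∀ x, P (x + Pi.single 0 1) = P x + Pi.single 0 1)
    (n : ℤ) (x : Coord d) : P (x + Pi.single 0 (n : ℝ)) = P x + Pi.single 0 (n : ℝ) := by
  induction n with
  | zero => simp
  | succ n ih =>
    push_cast at ih ⊢
    rw [Pi.single_add, ← add_assoc, h, ih, add_assoc]
  | pred n ih =>
    have := h (x + Pi.single 0 ((-(n : ℤ) - 1 : ℤ) : ℝ))
    rw [add_assoc, ← Pi.single_add] at this
    push_cast at this ih ⊢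
    rw [sub_add_cancel, ih] at this
    rw [eq_sub_of_add_eq this.symm, Pi.single_sub, add_sub_assoc]

theorem periodic_add_int {E : Type*} {F : Coord d → E} (h : ∀ x, F (x + Pi.single 0 1) = F x)
    (n : ℤ) (x : Coord d) : F (x + Pi.single 0 (n : ℝ)) = F x := by
  induction n with
  | zero => simp
  | succ n ih =>
    push_cast at ih ⊢
    rw [Pi.single_add, ← add_assoc, h, ih]
  | pred n ih =>
    have := h (x + Pi.single 0 ((-(n : ℤ) - 1 : ℤ) : ℝ))
    rw [add_assoc, ← Pi.single_add] at this
    push_cast at this ih ⊢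
    rw [sub_add_cancel, ih] at this
    exact this.symm

/-- Integrals over the fundamental domain `[0,1)^m` of functions of period one in the angle are
invariant under admissible maps. -/
theorem Admissible.setIntegral_comp {E : Type*} [NormedAddCommGroup E] [NormedSpace ℝ E]
    {P : Equiv.Perm (Coord d)} (hP : Admissible P) (F : Coord d → E)
    (hF : ∀ x, F (x + Pi.single 0 1) = F x) :
    ∫ x in cell 1 0, F (P x) = ∫ x in cell 1 0, F x := by
  let G := AddSubgroup.zmultiples (Pi.single 0 1 : Coord d)
  let s : Set (Coord d) := {x | ⌊x 0⌋ = 0}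
  have hs : MeasurableSet s :=
    (Int.measurable_floor.comp (measurable_pi_apply 0)) (measurableSet_singleton 0)
  have hG : ∀ g : G, ∃ n : ℤ, (g : Coord d) = Pi.single 0 (n : ℝ) := by
    rintro ⟨g, hg⟩
    obtain ⟨n, rfl⟩ := AddSubgroup.mem_zmultiples_iff.mp hg
    refine ⟨n, ?_⟩
    ext i
    by_cases hi : i = 0
    · subst hi; simp
    · simp [hi]
  have hdom : ∀ Q : Equiv.Perm (Coord d), Measurable Q →
      (∀ x, Q (x + Pi.single 0 1) = Q x + Pi.single 0 1) →
      IsAddFundamentalDomain G (Q ⁻¹' s) volume := by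
    intro Q hQ hQ1
    refine IsAddFundamentalDomain.mk' (hQ hs).nullMeasurableSet fun x => ?_
    have hmem : ∀ n : ℤ, ⌊(Q (x + Pi.single 0 (n : ℝ))) 0⌋ = ⌊Q x 0⌋ + n := fun n => by
      rw [map_add_int hQ1]; simp
    refine ⟨⟨Pi.single 0 ((-⌊Q x 0⌋ : ℤ) : ℝ), ?_⟩, ?_, ?_⟩
    · rw [AddSubgroup.mem_zmultiples_iff]
      refine ⟨-⌊Q x 0⌋, ?_⟩
      ext i
      by_cases hi : i = 0
      · subst hi; simp
      · simp [hi]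
    · change ⌊Q (Pi.single 0 ((-⌊Q x 0⌋ : ℤ) : ℝ) + x) 0⌋ = 0
      rw [add_comm, hmem]
      simp
    · rintro g hg
      obtain ⟨n, hn⟩ := hG g
      have hg' : ⌊Q ((g : Coord d) + x) 0⌋ = 0 := hg
      rw [hn, add_comm, hmem] at hg'
      apply Subtype.ext
      rw [hn]
      congr 2
      omega
  have h1 := hdom 1 measurable_id fun _ => rfl
  have h2 := hdom P hP.measurePreserving.measurable hP.add_one
  let F' := (halfStrip d).indicator F
  have hF' : ∀ x, F' (x + Pi.single 0 1) = F' x := fun x => by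
    by_cases hx : x ∈ halfStrip d
    · simp only [F']
      rw [indicator_of_mem hx, indicator_of_mem (add_single_mem_halfStrip.mpr hx), hF]
    · simp only [F']
      rw [indicator_of_notMem hx,
        indicator_of_notMem fun h => hx (add_single_mem_halfStrip.mp h)]
  have hcell : (cell 1 0 : Set (Coord d)) = s ∩ halfStrip d := by
    ext x; simp [cell, s]
  have hc : ∀ F₁ : Coord d → E, ∫ x in cell 1 0, F₁ x =
      ∫ x in s, (halfStrip d).indicator F₁ x := fun F₁ => by
    rw [setIntegral_indicator measurableSet_halfStrip, hcell]
  rw [hc, hc]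
  have e1 : ∀ x, (halfStrip d).indicator (fun x => F (P x)) x = F' (P x) := fun x => by
    by_cases hx : x ∈ halfStrip d
    · simp only [F']
      rw [indicator_of_mem hx, indicator_of_mem ((hP.mem_iff x).mpr hx)]
    · simp only [F']
      rw [indicator_of_notMem hx, indicator_of_notMem fun h => hx ((hP.mem_iff x).mp h)]
  simp only [e1]
  have hper : ∀ (g : G) (x : Coord d), F' (P (g +ᵥ x)) = F' (P x) := fun g x => by
    obtain ⟨n, hn⟩ := hG g
    have : g +ᵥ x = x + Pi.single 0 (n : ℝ) := by
      rw [← hn]; exact add_comm _ _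
    rw [this, map_add_int hP.add_one, periodic_add_int hF']
  have h3 := IsAddFundamentalDomain.setIntegral_eq h1 h2 (f := fun x => F' (P x)) hper
  have h4 : (⇑(1 : Equiv.Perm (Coord d)) ⁻¹' s) = s := rfl
  rw [h4] at h3
  rw [h3]
  exact hP.measurePreserving.setIntegral_preimage_emb
    (measurableEmbedding_of_perm hP.measurePreserving.measurable) F' s

/-- If an admissible map preserves membership in a cell, it preserves integrals over that cell. -/
theorem Admissible.setIntegral_cell_comp {E : Type*} [NormedAddCommGroup E] [NormedSpace ℝ E]
    {P : Equiv.Perm (Coord d)} (hP : Admissible P) (F : Coord d → E) {s : Set (Coord d)}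
    (h : ∀ x, P x ∈ s ↔ x ∈ s) : ∫ x in s, F (P x) = ∫ x in s, F x := by
  have h1 : P ⁻¹' s = s := by ext x; exact h x
  have := hP.measurePreserving.setIntegral_preimage_emb
    (measurableEmbedding_of_perm hP.measurePreserving.measurable) F s
  rwa [h1] at this

theorem setIntegral_cell_add {E : Type*} [NormedAddCommGroup E] [NormedSpace ℝ E] {A : ℕ}
    (hA : 0 < A) (i s : ℤ) (F : Coord d → E) :
    ∫ x in cell A i, F (x + Pi.single 0 ((s : ℝ) / A)) = ∫ x in cell A (i + s), F x := by
  have hmp : MeasurePreserving (fun x : Coord d => x + Pi.single 0 ((s : ℝ) / A)) volume volume :=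
    measurePreserving_add_right _ _
  have h1 : (fun x : Coord d => x + Pi.single 0 ((s : ℝ) / A)) ⁻¹' cell A (i + s) = cell A i := by
    ext x; exact add_single_mem_cell hA
  have := hmp.setIntegral_preimage_emb (measurableEmbedding_addRight _) F (cell A (i + s))
  rwa [h1] at this

/-! ### Volume preservation of maps defined piecewise -/

/-- A map that acts on countably many measurable pieces by measure-preserving maps, each of which
preserves its piece, is measure preserving. -/
theorem measurePreserving_of_pieces {X ι : Type*} [MeasurableSpace X] [Countable ι]
    {μ : Measure X} (Q : X → X) (k : X → ι) (hk : ∀ i, MeasurableSet (k ⁻¹' {i}))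
    (e : ι → X → X) (he : ∀ i, MeasurePreserving (e i) μ μ) (hQ : ∀ x, Q x = e (k x) x)
    (hke : ∀ i x, k (e i x) = i ↔ k x = i) : MeasurePreserving Q μ μ := by
  have hpre : ∀ A : Set X, Q ⁻¹' A = ⋃ i, e i ⁻¹' (A ∩ k ⁻¹' {i}) := by
    intro A
    ext x
    simp only [mem_preimage, mem_iUnion, mem_inter_iff, mem_singleton_iff, hke, hQ]
    constructor
    · intro h; exact ⟨k x, h, rfl⟩
    · rintro ⟨i, h, rfl⟩; exact h
  have hmeas : ∀ A, MeasurableSet A → ∀ i, MeasurableSet (e i ⁻¹' (A ∩ k ⁻¹' {i})) :=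
    fun A hA i => (he i).measurable (hA.inter (hk i))
  have hQm : Measurable Q := fun A hA => by
    rw [hpre]; exact MeasurableSet.iUnion (hmeas A hA)
  refine ⟨hQm, ?_⟩
  ext A hA
  rw [Measure.map_apply hQm hA, hpre, measure_iUnion ?_ (hmeas A hA)]
  · have h1 : A = ⋃ i, A ∩ k ⁻¹' {i} := by
      ext x; simp
    conv_rhs => rw [h1]
    rw [measure_iUnion ?_ fun i => hA.inter (hk i)]
    · refine tsum_congr fun i => ?_
      exact (he i).measure_preimage (hA.inter (hk i)).nullMeasurableSet
    · intro i j hij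
      refine Set.disjoint_left.mpr fun x hx hx' => hij ?_
      exact hx.2.symm.trans hx'.2
  · intro i j hij
    refine Set.disjoint_left.mpr fun x hx hx' => hij ?_
    exact ((hke i x).mp hx.2).symm.trans ((hke j x).mp hx'.2)

theorem measurePreserving_symm {P : Equiv.Perm (Coord d)} (hP : MeasurePreserving P volume volume) :
    MeasurePreserving P.symm volume volume := by
  have he := measurableEmbedding_of_perm hP.measurable
  have hm : Measurable P.symm := fun A hA => by
    have : P.symm ⁻¹' A = P '' A := (P.image_eq_preimage_symm A).symm
    rw [this]
    exact he.measurableSet_image.mpr hA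
  let e : Coord d ≃ᵐ Coord d := ⟨P, hP.measurable, hm⟩
  exact MeasurePreserving.symm e hP

/-- A change of scale does not affect volume preservation. -/
theorem measurePreserving_conj {C P : Equiv.Perm (Coord d)} {c : ℝ≥0∞} (hC : Measurable C)
    (hc : Measure.map C volume = c • volume)
    (hP : MeasurePreserving P volume volume) :
    MeasurePreserving (C.symm * P * C : Equiv.Perm (Coord d)) volume volume := by
  have he := measurableEmbedding_of_perm hC
  have hm : Measurable C.symm := fun A hA => by
    have : C.symm ⁻¹' A = C '' A := (C.image_eq_preimage_symm A).symm
    rw [this]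
    exact he.measurableSet_image.mpr hA
  refine ⟨(hm.comp hP.measurable).comp hC, ?_⟩
  have h1 : ⇑(C.symm * P * C : Equiv.Perm (Coord d)) = C.symm ∘ P ∘ C := rfl
  rw [h1, ← Measure.map_map hm (hP.measurable.comp hC), ← Measure.map_map hP.measurable hC, hc,
    Measure.map_smul, hP.map_eq, ← hc, Measure.map_map hm hC]
  simp

theorem measurable_scale (c : Coord d) (hc : ∀ i, c i ≠ 0) : Measurable (scale c hc) :=
  measurable_pi_lambda _ fun i => (measurable_pi_apply i).const_mul _

theorem map_scale (c : Coord d) (hc : ∀ i, c i ≠ 0) :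
    ∃ a : ℝ≥0∞, Measure.map (scale c hc) volume = a • volume := by
  have hdet : (Matrix.diagonal c).det ≠ 0 := by
    rw [Matrix.det_diagonal]
    exact Finset.prod_ne_zero_iff.mpr fun i _ => hc i
  have h := Real.smul_map_diagonal_volume_pi hdet
  have h1 : ⇑(Matrix.toLin' (Matrix.diagonal c)) = scale c hc := by
    ext x i
    simp [scale, Matrix.mulVec_diagonal]
  rw [h1] at h
  have h0 : ENNReal.ofReal |(Matrix.diagonal c).det| ≠ 0 := by
    simpa using hdet
  refine ⟨(ENNReal.ofReal |(Matrix.diagonal c).det|)⁻¹, ?_⟩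
  conv_rhs => rw [← h]
  rw [smul_smul, ENNReal.inv_mul_cancel h0 ENNReal.ofReal_ne_top, one_smul]

theorem measurePreserving_shear (b : ℝ) :
    MeasurePreserving (shear b : Equiv.Perm (Coord d)) volume volume := by
  have h := Real.volume_preserving_transvectionStruct
    (⟨0, 1, by simp, b⟩ : Matrix.TransvectionStruct (Fin (d + 2)) ℝ)
  have h1 : ⇑(Matrix.toLin' (⟨0, 1, by simp, b⟩ :
      Matrix.TransvectionStruct (Fin (d + 2)) ℝ).toMatrix) = (shear b : Equiv.Perm (Coord d)) := by
    ext x i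
    by_cases hi : i = 0
    · subst hi
      simp [shear, Matrix.TransvectionStruct.toMatrix, Matrix.transvection,
        Matrix.single_mulVec]
    · simp [shear, Matrix.TransvectionStruct.toMatrix, Matrix.transvection,
        hi, Matrix.single_mulVec]
  rwa [h1] at h

theorem measurePreserving_periodize (s : Finset (Fin (d + 2))) (P : Equiv.Perm (Coord d))
    (hP : ∀ x, x ∉ cellSet s → P x = x) (hmp : MeasurePreserving P volume volume) :
    MeasurePreserving (periodize s P hP) volume volume := by
  classical
  let k : Coord d → Fin (d + 2) → ℤ := fun x i => if i ∈ s then ⌊x i⌋ else 0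
  let r : (Fin (d + 2) → ℤ) → Coord d := fun v i => (v i : ℝ)
  have hbase : ∀ x, base s x = r (k x) := fun x => by
    ext i
    by_cases hi : i ∈ s <;> simp [base, r, k, hi]
  have hk : Measurable k := by
    refine measurable_pi_lambda _ fun i => ?_
    by_cases hi : i ∈ s
    · simp only [k, hi, if_true]
      exact Int.measurable_floor.comp (measurable_pi_apply i)
    · simp only [k, hi, if_false]
      exact measurable_const
  have hkv : ∀ v x, k x = v ↔ (∀ i, i ∉ s → v i = 0) ∧ x - r v ∈ cellSet s := by
    intro v x
    constructor
    · rintro rfl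
      refine ⟨fun i hi => by simp [k, hi], ?_⟩
      rw [← hbase]
      exact sub_base_mem s x
    · rintro ⟨h0, h1⟩
      ext i
      by_cases hi : i ∈ s
      · have := h1 i hi
        simp only [Pi.sub_apply, r, mem_Ico] at this
        simp only [k, hi, if_true]
        rw [Int.floor_eq_iff]
        constructor <;> linarith
      · simp [k, hi, h0 i hi]
  refine measurePreserving_of_pieces _ k (fun v => hk (measurableSet_singleton v))
    (fun v x => r v + P (x - r v)) (fun v => ?_) (fun x => ?_) (fun v x => ?_)
  · exact (measurePreserving_add_left volume (r v)).comp
      (hmp.comp (measurePreserving_sub_right volume (r v)))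
  · rw [← hbase]; rfl
  · rw [hkv, hkv, add_sub_cancel_left, perm_mem_iff hP]

theorem measurePreserving_onSet {S : Set (Coord d)} (hS : MeasurableSet S)
    {Q : Equiv.Perm (Coord d)} (hQ : ∀ x, Q x ∈ S ↔ x ∈ S)
    (hmp : MeasurePreserving Q volume volume) :
    MeasurePreserving (onSet S Q hQ) volume volume := by
  classical
  refine measurePreserving_of_pieces _ (fun x => decide (x ∈ S)) (fun i => ?_)
    (fun i x => if i then Q x else x) (fun i => ?_) (fun x => ?_) (fun i x => ?_)
  · cases i
    · have : (fun x => decide (x ∈ S)) ⁻¹' {false} = Sᶜ := by ext x; simp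
      rw [this]; exact hS.compl
    · have : (fun x => decide (x ∈ S)) ⁻¹' {true} = S := by ext x; simp
      rw [this]; exact hS
  · cases i
    · exact MeasurePreserving.id volume
    · simpa using hmp
  · by_cases hx : x ∈ S <;> simp [onSet, hx]
  · cases i
    · simp
    · simp [hQ]

theorem measurePreserving_glue {e : ℕ → Equiv.Perm (Coord d)} {k : Coord d → ℕ}
    (h : ∀ i x, k (e i x) = k x) (hk : Measurable k)
    (he : ∀ i, MeasurePreserving (e i) volume volume) :
    MeasurePreserving (glue e k h) volume volume :=
  measurePreserving_of_pieces _ k (fun i => hk (measurableSet_singleton i)) (fun i => e i) he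
    (fun _ => rfl) (fun i x => by rw [h])

/-! ### Admissibility of the building blocks -/

theorem Admissible.shear (b : ℝ) : Admissible (shear b : Equiv.Perm (Coord d)) where
  measurePreserving := measurePreserving_shear b
  mem_iff _ := add_single_mem_halfStrip
  add_one x := by
    have h1 : (x + Pi.single 0 1 : Coord d) 1 = x 1 := by simp
    change x + Pi.single 0 1 + Pi.single 0 (b * (x + Pi.single 0 1 : Coord d) 1) =
      x + Pi.single 0 (b * x 1) + Pi.single 0 1
    rw [h1]
    abel

theorem Admissible.rot (α : ℝ) : Admissible (rot α : Equiv.Perm (Coord d)) where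
  measurePreserving := measurePreserving_add_right _ _
  mem_iff _ := add_single_mem_halfStrip
  add_one _ := add_right_comm _ _ _

theorem Admissible.glue {e : ℕ → Equiv.Perm (Coord d)} {k : Coord d → ℕ}
    (h : ∀ i x, k (e i x) = k x) (hk : Measurable k) (hk1 : ∀ x, k (x + Pi.single 0 1) = k x)
    (he : ∀ i, Admissible (e i)) : Admissible (glue e k h) where
  measurePreserving := measurePreserving_glue h hk fun i => (he i).measurePreserving
  mem_iff x := (he (k x)).mem_iff x
  add_one x := by
    change e (k (x + Pi.single 0 1)) (x + Pi.single 0 1) = e (k x) x + Pi.single 0 1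
    rw [hk1, (he _).add_one]

theorem base_add_single {s : Finset (Fin (d + 2))} (hs : 0 ∈ s) (n : ℤ) (x : Coord d) :
    base s (x + Pi.single 0 (n : ℝ)) = base s x + Pi.single 0 (n : ℝ) := by
  ext i
  by_cases hi : i = 0
  · subst hi; simp [base, hs]
  · by_cases hi' : i ∈ s <;> simp [base, hi, hi']

theorem periodize_add_single {s : Finset (Fin (d + 2))} (hs : 0 ∈ s) (P : Equiv.Perm (Coord d))
    (hP : ∀ x, x ∉ cellSet s → P x = x) (n : ℤ) (x : Coord d) :
    periodize s P hP (x + Pi.single 0 (n : ℝ)) = periodize s P hP x + Pi.single 0 (n : ℝ) := by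
  change base s (x + Pi.single 0 (n : ℝ)) + P (x + Pi.single 0 (n : ℝ) -
    base s (x + Pi.single 0 (n : ℝ))) = base s x + P (x - base s x) + Pi.single 0 (n : ℝ)
  rw [base_add_single hs, add_sub_add_right_eq_sub]
  abel

theorem mem_halfStrip_iff_sub_base {x : Coord d} :
    x ∈ halfStrip d ↔ x - base {0} x ∈ cellSet Finset.univ := by
  simp only [halfStrip, cellSet, mem_ofPred_eq, Finset.mem_univ, true_imp_iff]
  rw [Fin.forall_fin_succ (P := fun i => (x - base {0} x) i ∈ Ico (0 : ℝ) 1)]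
  have h0 := sub_base_mem {0} x 0 (by simp)
  simp only [h0, true_and]
  simp [base]

theorem periodize_mem_halfStrip (P : Equiv.Perm (Coord d))
    (hP : ∀ x, x ∉ cellSet {0} → P x = x) (hP' : ∀ x, x ∉ cellSet Finset.univ → P x = x)
    (x : Coord d) : periodize {0} P hP x ∈ halfStrip d ↔ x ∈ halfStrip d := by
  rw [mem_halfStrip_iff_sub_base, mem_halfStrip_iff_sub_base]
  have h1 : periodize {0} P hP x = base {0} x + P (x - base {0} x) := rfl
  rw [h1, base_add _ _ _ ((perm_mem_iff hP _).mpr (sub_base_mem {0} x)), add_sub_cancel_left,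
    perm_mem_iff hP']

theorem measurable_affine (μ δ : ℝ) (hμ : μ ≠ 0) :
    Measurable (affine μ δ hμ : Equiv.Perm (Coord d)) :=
  (measurable_scale (fun _ => μ) (fun _ => hμ)).comp (measurable_id.sub_const _)

theorem map_affine (μ δ : ℝ) (hμ : μ ≠ 0) :
    ∃ a : ℝ≥0∞, Measure.map (affine μ δ hμ : Equiv.Perm (Coord d)) volume = a • volume := by
  obtain ⟨a, ha⟩ := map_scale (fun _ : Fin (d + 2) => μ) (fun _ => hμ)
  refine ⟨a, ?_⟩
  have hmp : MeasurePreserving (fun x : Coord d => x - fun _ => δ) volume volume :=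
    measurePreserving_sub_right volume _
  have h1 : ⇑(affine μ δ hμ : Equiv.Perm (Coord d)) =
      scale (fun _ => μ) (fun _ => hμ) ∘ fun x : Coord d => x - fun _ => δ := rfl
  rw [h1, ← Measure.map_map (measurable_scale _ _) hmp.measurable, hmp.map_eq, ha]

theorem measurableSet_Icc_all (δ : ℝ) : MeasurableSet {x : Coord d | ∀ i, x i ∈ Icc δ (1 - δ)} := by
  simp only [ofPred_forall]
  exact MeasurableSet.iInter fun i => measurableSet_Icc.preimage (measurable_pi_apply _)

theorem measurePreserving_psi {ε : ℝ} {j : Fin (d + 1)} (R : LocalRotation d ε j) (hε : 0 < ε)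
    (μ δ : ℝ) (hμ : 0 < μ) (hδ : ∃ t : ℤ, μ * (1 - 2 * δ) = t) :
    MeasurePreserving (psi R hε μ δ hμ hδ) volume volume := by
  refine measurePreserving_onSet (measurableSet_Icc_all δ) _ ?_
  obtain ⟨a, ha⟩ := map_affine (d := d) μ δ hμ.ne'
  exact measurePreserving_conj (measurable_affine _ _ _) ha
    (measurePreserving_periodize _ _ _ (measurePreserving_symm R.measurePreserving))

theorem Admissible.phiTilde {ε₁ ε₂ : ℝ} {j : Fin (d + 1)} (R₁ : LocalRotation d ε₁ j)
    (R₂ : LocalRotation d ε₂ j) (hε₁ : 0 < ε₁) (hε₂ : 0 < ε₂) (Λ μ δ : ℝ) (hΛ : 0 < Λ)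
    (hμ : 0 < μ) (hδ₀ : 0 < δ) (hδ : ∃ t : ℤ, μ * (1 - 2 * δ) = t) (hΛ' : ∃ N : ℤ, Λ = N) :
    Admissible (phiTilde R₁ R₂ hε₁ hε₂ Λ μ δ hΛ hμ hδ₀ hδ) := by
  obtain ⟨N, hN⟩ := hΛ'
  have hc : ∀ i : Fin (d + 2), (Function.update 1 0 Λ : Coord d) i ≠ 0 := fun i => by
    by_cases hi : i = 0
    · subst hi; simpa using hΛ.ne'
    · simp [hi]
  set C : Equiv.Perm (Coord d) := scale (Function.update 1 0 Λ) hc with hCdef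
  have hCh : ∀ x : Coord d, C x ∈ halfStrip d ↔ x ∈ halfStrip d := fun x => by
    simp [halfStrip, C, scale]
  have hoff : ∀ s : Finset (Fin (d + 2)), 0 ∈ s → ∀ x : Coord d, x ∉ cellSet s →
      (psi R₂ hε₂ μ δ hμ hδ * R₁.toPerm : Equiv.Perm (Coord d)) x = x := fun s _ x hx => by
    rw [Equiv.Perm.mul_apply, R₁.eq_self_off_cell hε₁ s x hx]
    refine if_neg fun h => hx fun i hi => ⟨?_, ?_⟩
    · linarith [(h i).1]
    · linarith [(h i).2]
  let Q := periodize {0} (psi R₂ hε₂ μ δ hμ hδ * R₁.toPerm) (hoff {0} (by simp))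
  have hphi : AbC.phiTilde R₁ R₂ hε₁ hε₂ Λ μ δ hΛ hμ hδ₀ hδ = C.symm * Q * C := rfl
  have hadd : ∀ x : Coord d, C (x + Pi.single 0 1) = C x + Pi.single 0 (N : ℝ) := fun x => by
    ext i
    by_cases hi : i = 0
    · subst hi; simp [C, scale, hN, mul_add]
    · simp [C, scale, hi]
  rw [hphi]
  constructor
  · obtain ⟨a, ha⟩ := map_scale _ hc
    exact measurePreserving_conj (measurable_scale _ _) ha
      (measurePreserving_periodize _ _ _
        ((measurePreserving_psi R₂ hε₂ μ δ hμ hδ).comp R₁.measurePreserving))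
  · intro x
    rw [Equiv.Perm.mul_apply, Equiv.Perm.mul_apply, ← hCh, Equiv.apply_symm_apply,
      periodize_mem_halfStrip _ _ (hoff _ (Finset.mem_univ 0)), hCh]
  · intro x
    rw [Equiv.Perm.mul_apply, Equiv.Perm.mul_apply, Equiv.symm_apply_eq, hadd, hadd,
      periodize_add_single (by simp)]
    simp [Equiv.Perm.mul_apply, Q]

theorem LocalShear.corr_apply_succ_succ {ε δ : ℝ} (G : LocalShear d ε δ) (x : Coord d)
    (i : Fin d) : ((AbC.shear ε).symm * G.toPerm : Equiv.Perm (Coord d)) x i.succ.succ =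
      x i.succ.succ := by
  have : ((AbC.shear ε).symm * G.toPerm : Equiv.Perm (Coord d)) x i.succ.succ =
      G.toPerm x i.succ.succ := by
    simp [AbC.shear, Equiv.Perm.mul_apply]
  rw [this, G.fibred]

section Block

variable {ε δ : ℝ} (G : LocalShear d ε δ) (hε : 0 < ε) (a b : ℝ) (ha : 0 < a) (hb : 0 < b)

theorem blockCorr_apply_succ_succ (x : Coord d) (i : Fin d) :
    blockCorr G hε a b ha hb x i.succ.succ = x i.succ.succ := by
  have h1 : ∀ y : Coord d, (blockScale a b ε ha hb hε).symm y i.succ.succ = y i.succ.succ := by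
    intro y
    have h2 : (i.succ.succ : Fin (d + 2)) ≠ 1 := by
      rw [← Fin.succ_zero_eq_one]
      exact fun h => Fin.succ_ne_zero i (Fin.succ_injective _ h)
    simp [blockScale, scale, h2]
  have h2 : ∀ y : Coord d, blockScale a b ε ha hb hε y i.succ.succ = y i.succ.succ := by
    intro y
    rw [← h1 (blockScale a b ε ha hb hε y), Equiv.symm_apply_apply]
  have h3 : (i.succ.succ : Fin (d + 2)) ∉ ({0, 1} : Finset (Fin (d + 2))) := by
    have : (i.succ.succ : Fin (d + 2)) ≠ 1 := by
      rw [← Fin.succ_zero_eq_one]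
      exact fun h => Fin.succ_ne_zero i (Fin.succ_injective _ h)
    simp [this]
  rw [blockCorr, Equiv.Perm.mul_apply, Equiv.Perm.mul_apply, h1, ← h2 x]
  generalize blockScale a b ε ha hb hε x = y
  change base {0, 1} y i.succ.succ + ((AbC.shear ε).symm * G.toPerm : Equiv.Perm (Coord d))
    (y - base {0, 1} y) i.succ.succ = _
  rw [G.corr_apply_succ_succ]
  simp

variable (h₁ : ∃ t : ℤ, b * a / ε * δ = t) (h₂ : ∃ t : ℤ, b * a / ε = t)

theorem gBlockCorr_of_mem {x : Coord d} (hx : x 1 ∈ Icc δ (1 - δ)) :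
    gBlockCorr G hε a b ha hb h₁ h₂ x = blockCorr G hε a b ha hb x := if_pos hx

theorem gBlockCorr_of_notMem {x : Coord d} (hx : x 1 ∉ Icc δ (1 - δ)) :
    gBlockCorr G hε a b ha hb h₁ h₂ x = x := if_neg hx

theorem gBlockCorr_apply_succ_succ (x : Coord d) (i : Fin d) :
    gBlockCorr G hε a b ha hb h₁ h₂ x i.succ.succ = x i.succ.succ := by
  by_cases hx : x 1 ∈ Icc δ (1 - δ)
  · rw [gBlockCorr_of_mem _ _ _ _ _ _ _ _ hx, blockCorr_apply_succ_succ]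
  · rw [gBlockCorr_of_notMem _ _ _ _ _ _ _ _ hx]

theorem floor_gBlockCorr_one (x : Coord d) :
    ⌊b * a / ε * gBlockCorr G hε a b ha hb h₁ h₂ x 1⌋ = ⌊b * a / ε * x 1⌋ := by
  by_cases hx : x 1 ∈ Icc δ (1 - δ)
  · have hs : ∀ y : Coord d, b * a / ε * y 1 = blockScale a b ε ha hb hε y 1 := fun y => by
      simp [blockScale, scale]
    rw [gBlockCorr_of_mem _ _ _ _ _ _ _ _ hx, hs, hs, blockCorr, Equiv.Perm.mul_apply,
      Equiv.Perm.mul_apply, Equiv.apply_symm_apply]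
    exact floor_periodize _ _ _ _ _ (by simp)
  · rw [gBlockCorr_of_notMem _ _ _ _ _ _ _ _ hx]

theorem floor_eq_of_floor_mul {A N : ℝ} (hN : ∃ n : ℕ, 0 < n ∧ N = n) {s t : ℝ}
    (h : ⌊A * N * s⌋ = ⌊A * N * t⌋) : ⌊A * s⌋ = ⌊A * t⌋ := by
  obtain ⟨n, hn, rfl⟩ := hN
  have hn' : (n : ℝ) ≠ 0 := by positivity
  have key : ∀ z : ℝ, ⌊A * z⌋ = ⌊A * n * z⌋ / (n : ℤ) := by
    intro z
    rw [← Int.floor_div_natCast]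
    congr 1
    field_simp
  rw [key s, key t, h]

theorem abs_sub_le_of_floor_eq {A s t : ℝ} (hA : 0 < A) (h : ⌊A * s⌋ = ⌊A * t⌋) :
    |s - t| ≤ 1 / A := by
  have h1 := Int.abs_sub_lt_one_of_floor_eq_floor h
  rw [← mul_sub, abs_mul, abs_of_pos hA] at h1
  rw [le_div_iff₀ hA, mul_comm]
  exact h1.le

theorem mem_Ico_iff_of_floor_mul_eq {N s t : ℝ} (hN : ∃ n : ℤ, N = n) (hN0 : 0 < N)
    (h : ⌊N * s⌋ = ⌊N * t⌋) : s ∈ Ico (0 : ℝ) 1 ↔ t ∈ Ico (0 : ℝ) 1 := by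
  obtain ⟨n, rfl⟩ := hN
  have hn : 0 < n := by exact_mod_cast hN0
  obtain ⟨m, rfl⟩ := Int.eq_ofNat_of_zero_le hn.le
  have h1 : ⌊(1 : ℝ) * s⌋ = ⌊(1 : ℝ) * t⌋ :=
    floor_eq_of_floor_mul ⟨m, by exact_mod_cast hn, rfl⟩ (by simpa using h)
  rw [← Int.floor_eq_zero_iff, ← Int.floor_eq_zero_iff]
  simp only [one_mul] at h1
  rw [h1]

theorem measurePreserving_gBlockCorr :
    MeasurePreserving (gBlockCorr G hε a b ha hb h₁ h₂) volume volume := by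
  refine measurePreserving_onSet (measurableSet_Icc.preimage (measurable_pi_apply 1)) _ ?_
  obtain ⟨c, hc⟩ := map_scale (d := d) (fun i => if i = 0 then a else if i = 1 then b * a / ε else 1)
    (fun i => by
      split_ifs
      · exact ha.ne'
      · exact (div_pos (mul_pos hb ha) hε).ne'
      · exact one_ne_zero)
  exact measurePreserving_conj (measurable_scale _ _) hc
    (measurePreserving_periodize _ _ _
      ((measurePreserving_symm (measurePreserving_shear ε)).comp G.measurePreserving))

theorem Admissible.gBlockCorr (hN : ∃ N : ℤ, a = N) :
    Admissible (gBlockCorr G hε a b ha hb h₁ h₂) where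
  measurePreserving := measurePreserving_gBlockCorr G hε a b ha hb h₁ h₂
  mem_iff x := by
    have hpos : 0 < b * a / ε := div_pos (mul_pos hb ha) hε
    have h1 := mem_Ico_iff_of_floor_mul_eq h₂ hpos (floor_gBlockCorr_one G hε a b ha hb h₁ h₂ x)
    simp only [halfStrip, mem_ofPred_eq]
    rw [Fin.forall_fin_succ, Fin.forall_fin_succ]
    simp only [gBlockCorr_apply_succ_succ, Fin.succ_zero_eq_one, h1]
  add_one x := by
    obtain ⟨N, hN⟩ := hN
    have h1 : (x + Pi.single 0 1 : Coord d) 1 = x 1 := by simp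
    have hadd : ∀ x : Coord d, blockScale a b ε ha hb hε (x + Pi.single 0 1) =
        blockScale a b ε ha hb hε x + Pi.single 0 (N : ℝ) := fun x => by
      ext i
      by_cases hi : i = 0
      · subst hi; simp [blockScale, scale, hN, mul_add]
      · simp [blockScale, scale, hi]
    by_cases hx : x 1 ∈ Icc δ (1 - δ)
    · rw [gBlockCorr_of_mem _ _ _ _ _ _ _ _ hx, gBlockCorr_of_mem _ _ _ _ _ _ _ _ (by rwa [h1])]
      rw [blockCorr, Equiv.Perm.mul_apply, Equiv.Perm.mul_apply, Equiv.symm_apply_eq, hadd, hadd,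
        periodize_add_single (by simp)]
      simp [Equiv.Perm.mul_apply]
    · rw [gBlockCorr_of_notMem _ _ _ _ _ _ _ _ hx,
        gBlockCorr_of_notMem _ _ _ _ _ _ _ _ (by rwa [h1])]

end Block

/-! ### Admissibility of the conjugation maps -/

namespace ConjData

variable (C : ConjData d)

theorem measurable_sec (n : ℕ) : Measurable (C.sec n) := by
  have h : Measurable fun x : Coord d => ⌊((n * C.q n : ℕ) : ℝ) * x 0⌋ :=
    Int.measurable_floor.comp ((measurable_pi_apply 0).const_mul _)
  exact (measurable_from_top (f := fun z : ℤ => (z % (n : ℤ)).toNat)).comp h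

theorem sec_add_one (n : ℕ) (x : Coord d) : C.sec n (x + Pi.single 0 1) = C.sec n x := by
  have h : ((n * C.q n : ℕ) : ℝ) * (x + Pi.single 0 1 : Coord d) 0 =
      ((n * C.q n : ℕ) : ℝ) * x 0 + ((n * C.q n : ℕ) : ℤ) := by
    simp [mul_add]
  unfold sec
  rw [h, Int.floor_add_intCast]
  push_cast
  rw [Int.add_mul_emod_self_left]

/-- The map `g_n` followed by the inverse shear; it moves points only within small cells. -/
def corr (n : ℕ) (hn : 1 ≤ n) : Equiv.Perm (Coord d) :=
  AbC.glue (fun s => (AbC.shear (C.b n)).symm * C.gSection n hn (s + 1)) (C.sec n)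
    (fun s x => C.sec_gSection n hn (s + 1) x)

/-- The restriction of `corr` to a section. -/
def corrSection (n : ℕ) (hn : 1 ≤ n) (k : ℕ) : Equiv.Perm (Coord d) :=
  AbC.gBlockCorr (C.localShear n hn) (by have := pow_pos' n hn; positivity) (C.aFreq n k) (C.b n)
    (C.aFreq_pos n k hn) (C.b_pos n hn) (C.block_int' n k hn) (C.block_int n k hn)

theorem symm_mul_gSection (n : ℕ) (hn : 1 ≤ n) (k : ℕ) :
    (AbC.shear (C.b n)).symm * C.gSection n hn k = C.corrSection n hn k := by
  ext x : 1
  exact (AbC.shear (C.b n)).symm_apply_apply _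

theorem corr_apply (n : ℕ) (hn : 1 ≤ n) (x : Coord d) :
    C.corr n hn x = C.corrSection n hn (C.sec n x + 1) x := by
  rw [← symm_mul_gSection]; rfl

theorem phi_apply (n : ℕ) (hn : 1 ≤ n) (x : Coord d) :
    C.phi n hn x = C.phiSection n hn (C.sec n x + 1) (Nat.succ_pos _) x := rfl

theorem admissible_corr (n : ℕ) (hn : 1 ≤ n) : Admissible (C.corr n hn) := by
  refine Admissible.glue _ (C.measurable_sec n) (C.sec_add_one n) fun s => ?_
  rw [symm_mul_gSection]
  exact Admissible.gBlockCorr _ _ _ _ _ _ _ _ ⟨C.aFreq n (s + 1), by simp⟩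

theorem admissible_phiFactor (n : ℕ) (hn : 1 ≤ n) (k : ℕ) (hk : 1 ≤ k) (j : Fin (d + 1)) :
    Admissible (C.phiFactor n hn k hk j) :=
  Admissible.phiTilde _ _ _ _ _ _ _ _ _ _ _ ⟨C.phiFreq n k j, by simp⟩

theorem admissible_list_prod (l : List (Equiv.Perm (Coord d))) (h : ∀ P ∈ l, Admissible P) :
    Admissible l.prod := by
  induction l with
  | nil => exact Admissible.one
  | cons P l ih =>
    rw [List.prod_cons]
    exact (h P List.mem_cons_self).mul (ih fun Q hQ => h Q (List.mem_cons_of_mem P hQ))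

theorem admissible_phiSection (n : ℕ) (hn : 1 ≤ n) (k : ℕ) (hk : 1 ≤ k) :
    Admissible (C.phiSection n hn k hk) := by
  refine admissible_list_prod _ fun P hP => ?_
  rw [List.mem_reverse, List.mem_ofFn] at hP
  obtain ⟨j, rfl⟩ := hP
  exact C.admissible_phiFactor n hn k hk j

theorem admissible_phi (n : ℕ) (hn : 1 ≤ n) : Admissible (C.phi n hn) :=
  Admissible.glue _ (C.measurable_sec n) (C.sec_add_one n)
    fun s => C.admissible_phiSection n hn (s + 1) (Nat.succ_pos s)

theorem admissible_g (n : ℕ) (hn : 1 ≤ n) : Admissible (C.g n hn) :=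
  (Admissible.shear _).mul (C.admissible_corr n hn)

theorem admissible_H (n : ℕ) : Admissible (C.H n) := by
  induction n with
  | zero => exact Admissible.one
  | succ n ih => exact ih.mul ((C.admissible_g _ _).mul (C.admissible_phi _ _))

end ConjData

/-! ### Differentiability of the conjugation maps -/

theorem fract_notMem_Icc_of_near {ε t : ℝ} {z : ℤ} (h : |t - z| < ε) :
    t - (⌊t⌋ : ℝ) ∉ Icc ε (1 - ε) := by
  rintro ⟨h1, h2⟩
  rw [abs_lt] at h
  rcases le_or_gt z ⌊t⌋ with hz | hz
  · have : (z : ℝ) ≤ ⌊t⌋ := by exact_mod_cast hz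
    linarith
  · have : (⌊t⌋ : ℝ) + 1 ≤ z := by exact_mod_cast hz
    linarith

theorem eventually_abs_apply_sub_lt (x : Coord d) (i : Fin (d + 2)) {ε : ℝ} (hε : 0 < ε) :
    ∀ᶠ y in 𝓝 x, |y i - x i| < ε :=
  (continuous_apply i).continuousAt.eventually (Metric.ball_mem_nhds (x i) hε)

theorem periodize_eventuallyEq_id {s : Finset (Fin (d + 2))} {P : Equiv.Perm (Coord d)}
    (hP : ∀ x, x ∉ cellSet s → P x = x) {ε : ℝ} (hε : 0 < ε)
    (hid : ∀ x : Coord d, ∀ i ∈ s, x i ∉ Icc ε (1 - ε) → P x = x) {x : Coord d}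
    {i : Fin (d + 2)} (hi : i ∈ s) {z : ℤ} (hz : x i = z) :
    (periodize s P hP : Coord d → Coord d) =ᶠ[𝓝 x] id := by
  filter_upwards [eventually_abs_apply_sub_lt x i hε] with y hy
  have h1 : P (y - base s y) = y - base s y := by
    refine hid _ i hi ?_
    simp only [Pi.sub_apply, base, hi, if_true]
    rw [hz] at hy
    exact fract_notMem_Icc_of_near hy
  change base s y + P (y - base s y) = y
  rw [h1]
  abel

theorem eventually_floor_eq {t : ℝ} (h : ∀ z : ℤ, t ≠ z) : ∀ᶠ u in 𝓝 t, ⌊u⌋ = ⌊t⌋ := by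
  have h1 : (⌊t⌋ : ℝ) < t := lt_of_le_of_ne (Int.floor_le t) (h _).symm
  filter_upwards [Ioo_mem_nhds h1 (Int.lt_floor_add_one t)] with u hu
  exact Int.floor_eq_iff.mpr ⟨hu.1.le, hu.2⟩

/-- If `P` is the identity near the faces of the unit cell, its translates fit together differentiably. -/
theorem differentiable_periodize {s : Finset (Fin (d + 2))} {P : Equiv.Perm (Coord d)}
    (hP : ∀ x, x ∉ cellSet s → P x = x) {ε : ℝ} (hε : 0 < ε)
    (hid : ∀ x : Coord d, ∀ i ∈ s, x i ∉ Icc ε (1 - ε) → P x = x)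
    (hd : Differentiable ℝ P) : Differentiable ℝ (periodize s P hP) := by
  intro x
  by_cases hx : ∃ i ∈ s, ∃ z : ℤ, x i = z
  · obtain ⟨i, hi, z, hz⟩ := hx
    exact differentiableAt_id.congr_of_eventuallyEq (periodize_eventuallyEq_id hP hε hid hi hz)
  · push Not at hx
    have h1 : ∀ᶠ y in 𝓝 x, ∀ i ∈ s, ⌊y i⌋ = ⌊x i⌋ := by
      rw [Filter.eventually_all_finset]
      intro i hi
      exact (continuous_apply i).continuousAt.eventually (eventually_floor_eq (hx i hi))
    have h2 : (periodize s P hP : Coord d → Coord d) =ᶠ[𝓝 x]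
        fun y => base s x + P (y - base s x) := by
      filter_upwards [h1] with y hy
      have : base s y = base s x := by
        ext i
        by_cases hi : i ∈ s
        · simp [base, hi, hy i hi]
        · simp [base, hi]
      change base s y + P (y - base s y) = _
      rw [this]
    refine DifferentiableAt.congr_of_eventuallyEq ?_ h2
    exact ((hd _).comp x (differentiableAt_id.sub_const _)).const_add _

theorem differentiable_scale (c : Coord d) (hc : ∀ i, c i ≠ 0) : Differentiable ℝ (scale c hc) := by
  rw [differentiable_pi]
  exact fun i => (differentiable_apply i).const_mul _

theorem differentiable_scale_symm (c : Coord d) (hc : ∀ i, c i ≠ 0) :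
    Differentiable ℝ (scale c hc).symm := by
  rw [differentiable_pi]
  exact fun i => (differentiable_apply i).const_mul _

theorem differentiable_mul {P Q : Equiv.Perm (Coord d)} (hP : Differentiable ℝ P)
    (hQ : Differentiable ℝ Q) : Differentiable ℝ (P * Q : Equiv.Perm (Coord d)) :=
  hP.comp hQ

theorem conj_eventuallyEq_id {C P : Equiv.Perm (Coord d)} {x : Coord d} (hC : Continuous C)
    (h : (P : Coord d → Coord d) =ᶠ[𝓝 (C x)] id) :
    ((C.symm * P * C : Equiv.Perm (Coord d)) : Coord d → Coord d) =ᶠ[𝓝 x] id := by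
  filter_upwards [hC.continuousAt.eventually h] with y hy
  rw [Equiv.Perm.mul_apply, Equiv.Perm.mul_apply, hy]
  simp

theorem mul_eventuallyEq_id {P Q : Equiv.Perm (Coord d)} {x : Coord d}
    (hP : (P : Coord d → Coord d) =ᶠ[𝓝 x] id) (hQ : (Q : Coord d → Coord d) =ᶠ[𝓝 x] id) :
    ((P * Q : Equiv.Perm (Coord d)) : Coord d → Coord d) =ᶠ[𝓝 x] id := by
  filter_upwards [hP, hQ] with y h1 h2
  rw [Equiv.Perm.mul_apply, h2]
  exact h1

theorem onSet_eventuallyEq_id {S : Set (Coord d)} {Q : Equiv.Perm (Coord d)}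
    (hQ : ∀ x, Q x ∈ S ↔ x ∈ S) {x : Coord d} (h : (Q : Coord d → Coord d) =ᶠ[𝓝 x] id) :
    (onSet S Q hQ : Coord d → Coord d) =ᶠ[𝓝 x] id := by
  classical
  filter_upwards [h] with y hy
  by_cases hyS : y ∈ S
  · exact (if_pos hyS).trans hy
  · exact if_neg hyS

theorem differentiable_onSet {S : Set (Coord d)} (hS : IsClosed S) {Q : Equiv.Perm (Coord d)}
    (hQ : ∀ x, Q x ∈ S ↔ x ∈ S) (hd : Differentiable ℝ Q)
    (h : ∀ x ∈ S, x ∉ interior S → (Q : Coord d → Coord d) =ᶠ[𝓝 x] id) :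
    Differentiable ℝ (onSet S Q hQ) := by
  classical
  intro x
  by_cases hx : x ∈ S
  · by_cases hxi : x ∈ interior S
    · refine (hd x).congr_of_eventuallyEq ?_
      filter_upwards [mem_interior_iff_mem_nhds.mp hxi] with y hy
      exact if_pos hy
    · exact differentiableAt_id.congr_of_eventuallyEq (onSet_eventuallyEq_id hQ (h x hx hxi))
  · refine differentiableAt_id.congr_of_eventuallyEq ?_
    filter_upwards [hS.isOpen_compl.mem_nhds hx] with y hy
    exact if_neg hy

theorem differentiable_psi {ε : ℝ} {j : Fin (d + 1)} (R : LocalRotation d ε j) (hε : 0 < ε)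
    (μ δ : ℝ) (hμ : 0 < μ) (hδ : ∃ t : ℤ, μ * (1 - 2 * δ) = t) :
    Differentiable ℝ (psi R hε μ δ hμ hδ) := by
  have hid : ∀ x : Coord d, ∀ i ∈ (Finset.univ : Finset (Fin (d + 2))),
      x i ∉ Icc ε (1 - ε) → R.toPerm.symm x = x :=
    fun x i _ hx => R.symm_eq_self x fun h => hx (h i)
  have haff : Differentiable ℝ (affine μ δ hμ.ne' : Equiv.Perm (Coord d)) :=
    (differentiable_scale (fun _ => μ) fun _ => hμ.ne').comp (differentiable_id.sub_const _)
  have haff' : Differentiable ℝ (affine μ δ hμ.ne' : Equiv.Perm (Coord d)).symm := by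
    have := (differentiable_scale_symm (d := d) (fun _ => μ) fun _ => hμ.ne').add_const
      (fun _ => δ)
    exact this
  refine differentiable_onSet ?_ _ ?_ ?_
  · simp only [ofPred_forall]
    exact isClosed_iInter fun i => isClosed_Icc.preimage (continuous_apply i)
  · exact differentiable_mul (differentiable_mul haff' (differentiable_periodize _ hε hid
      (R.contDiff_symm.differentiable (by simp)))) haff
  · intro x hx hxi
    have hb : ∃ i, x i = δ ∨ x i = 1 - δ := by
      by_contra hcon
      push Not at hcon
      refine hxi (mem_interior_iff_mem_nhds.mpr ?_)
      have : ∀ᶠ y in 𝓝 x, ∀ i, y i ∈ Icc δ (1 - δ) := by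
        rw [eventually_all]
        intro i
        refine (continuous_apply i).continuousAt.eventually ?_
        exact Icc_mem_nhds (lt_of_le_of_ne (hx i).1 (hcon i).1.symm)
          (lt_of_le_of_ne (hx i).2 (hcon i).2)
      exact this
    obtain ⟨i, hi⟩ := hb
    obtain ⟨t, ht⟩ := hδ
    have hz : ∃ z : ℤ, affine μ δ hμ.ne' x i = z := by
      have h : affine μ δ hμ.ne' x i = μ * (x i - δ) := rfl
      rcases hi with hi | hi
      · exact ⟨0, by rw [h, hi]; simp⟩
      · exact ⟨t, by rw [h, hi, ← ht]; ring⟩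
    obtain ⟨z, hz⟩ := hz
    exact conj_eventuallyEq_id haff.continuous
      (periodize_eventuallyEq_id _ hε hid (Finset.mem_univ i) hz)

section PhiTilde

variable {ε₁ ε₂ : ℝ} {j : Fin (d + 1)} (R₁ : LocalRotation d ε₁ j)
    (R₂ : LocalRotation d ε₂ j) (hε₁ : 0 < ε₁) (hε₂ : 0 < ε₂) (Λ μ δ : ℝ) (hΛ : 0 < Λ)
    (hμ : 0 < μ) (hδ₀ : 0 < δ) (hδ : ∃ t : ℤ, μ * (1 - 2 * δ) = t)

theorem psi_mul_eq_self (x : Coord d) (hx : x 0 ∉ Icc (min ε₁ δ) (1 - min ε₁ δ)) :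
    (psi R₂ hε₂ μ δ hμ hδ * R₁.toPerm : Equiv.Perm (Coord d)) x = x := by
  have h1 : R₁.toPerm x = x := R₁.eq_self x fun h => hx
    ⟨(min_le_left _ _).trans (h 0).1, (h 0).2.trans (by linarith [min_le_left ε₁ δ])⟩
  rw [Equiv.Perm.mul_apply, h1]
  exact if_neg fun h => hx
    ⟨(min_le_right _ _).trans (h 0).1, (h 0).2.trans (by linarith [min_le_right ε₁ δ])⟩

theorem differentiable_phiTilde :
    Differentiable ℝ (phiTilde R₁ R₂ hε₁ hε₂ Λ μ δ hΛ hμ hδ₀ hδ) := by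
  refine differentiable_mul (differentiable_mul (differentiable_scale_symm _ _)
    (differentiable_periodize _ (lt_min hε₁ hδ₀) ?_ ?_)) (differentiable_scale _ _)
  · intro x i hi hx
    rw [Finset.mem_singleton] at hi
    subst hi
    exact psi_mul_eq_self R₁ R₂ hε₂ μ δ hμ hδ x hx
  · exact differentiable_mul (differentiable_psi R₂ hε₂ μ δ hμ hδ)
      (R₁.contDiff_toPerm.differentiable (by simp))

theorem phiTilde_eventuallyEq_id {x : Coord d} {z : ℤ} (hx : Λ * x 0 = z) :
    (phiTilde R₁ R₂ hε₁ hε₂ Λ μ δ hΛ hμ hδ₀ hδ : Coord d → Coord d) =ᶠ[𝓝 x] id := by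
  refine conj_eventuallyEq_id (differentiable_scale _ _).continuous
    (periodize_eventuallyEq_id _ (lt_min hε₁ hδ₀) ?_ (i := 0) (by simp) (z := z) ?_)
  · intro x i hi hx
    rw [Finset.mem_singleton] at hi
    subst hi
    exact psi_mul_eq_self R₁ R₂ hε₂ μ δ hμ hδ x hx
  · rw [← hx]
    simp [scale]

end PhiTilde

section Block

variable {ε δ : ℝ} (G : LocalShear d ε δ) (hε : 0 < ε) (a b : ℝ) (ha : 0 < a) (hb : 0 < b)

theorem corr_eq_self_of_notMem (x : Coord d) (i : Fin (d + 2)) (hi : i ∈ ({0, 1} : Finset _))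
    (hx : x i ∉ Icc ε (1 - ε)) :
    ((shear ε).symm * G.toPerm : Equiv.Perm (Coord d)) x = x := by
  refine G.corr_eq_self x fun h => hx ?_
  rcases Finset.mem_insert.mp hi with h0 | h1
  · subst h0; exact h.1
  · rw [Finset.mem_singleton] at h1
    subst h1; exact h.2

theorem differentiable_shear (c : ℝ) : Differentiable ℝ (shear c : Equiv.Perm (Coord d)) := by
  have : Differentiable ℝ fun x : Coord d => x + Pi.single 0 (c * x 1) := by
    rw [differentiable_pi]
    intro i
    by_cases hi : i = 0
    · subst hi
      simp only [Pi.add_apply, Pi.single_eq_same]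
      fun_prop
    · simp only [Pi.add_apply, Pi.single_eq_of_ne hi]
      fun_prop
  exact this

theorem differentiable_shear_symm (c : ℝ) :
    Differentiable ℝ (shear c : Equiv.Perm (Coord d)).symm := by
  have : Differentiable ℝ fun x : Coord d => x - Pi.single 0 (c * x 1) := by
    rw [differentiable_pi]
    intro i
    by_cases hi : i = 0
    · subst hi
      simp only [Pi.sub_apply, Pi.single_eq_same]
      fun_prop
    · simp only [Pi.sub_apply, Pi.single_eq_of_ne hi]
      fun_prop
  exact this

theorem differentiable_blockCorr : Differentiable ℝ (blockCorr G hε a b ha hb) :=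
  differentiable_mul (differentiable_mul (differentiable_scale_symm _ _)
    (differentiable_periodize _ hε (corr_eq_self_of_notMem G)
      (differentiable_mul (differentiable_shear_symm ε)
        (G.contDiff_toPerm.differentiable (by simp))))) (differentiable_scale _ _)

theorem blockCorr_eventuallyEq_id {x : Coord d} {z : ℤ}
    (hx : a * x 0 = z ∨ b * a / ε * x 1 = z) :
    (blockCorr G hε a b ha hb : Coord d → Coord d) =ᶠ[𝓝 x] id := by
  rcases hx with hx | hx
  · refine conj_eventuallyEq_id (differentiable_scale _ _).continuous
      (periodize_eventuallyEq_id _ hε (corr_eq_self_of_notMem G) (i := 0) (by simp) (z := z) ?_)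
    rw [← hx]
    simp [blockScale, scale]
  · refine conj_eventuallyEq_id (differentiable_scale _ _).continuous
      (periodize_eventuallyEq_id _ hε (corr_eq_self_of_notMem G) (i := 1) (by simp) (z := z) ?_)
    rw [← hx]
    simp [blockScale, scale]

variable (h₁ : ∃ t : ℤ, b * a / ε * δ = t) (h₂ : ∃ t : ℤ, b * a / ε = t)

theorem differentiable_gBlockCorr : Differentiable ℝ (gBlockCorr G hε a b ha hb h₁ h₂) := by
  refine differentiable_onSet (isClosed_Icc.preimage (continuous_apply 1)) _
    (differentiable_blockCorr G hε a b ha hb) ?_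
  intro x hx hxi
  have hb' : x 1 = δ ∨ x 1 = 1 - δ := by
    by_contra hcon
    push Not at hcon
    refine hxi (mem_interior_iff_mem_nhds.mpr ?_)
    exact (continuous_apply 1).continuousAt.preimage_mem_nhds
      (Icc_mem_nhds (lt_of_le_of_ne hx.1 hcon.1.symm) (lt_of_le_of_ne hx.2 hcon.2))
  obtain ⟨t, ht⟩ := h₁
  obtain ⟨t', ht'⟩ := h₂
  rcases hb' with h | h
  · exact blockCorr_eventuallyEq_id G hε a b ha hb (z := t) (Or.inr (by rw [h, ht]))
  · refine blockCorr_eventuallyEq_id G hε a b ha hb (z := t' - t) (Or.inr ?_)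
    rw [h, mul_sub, ht, mul_one, ht']
    push_cast
    ring

theorem gBlockCorr_eventuallyEq_id {x : Coord d} {z : ℤ} (hx : a * x 0 = z) :
    (gBlockCorr G hε a b ha hb h₁ h₂ : Coord d → Coord d) =ᶠ[𝓝 x] id :=
  onSet_eventuallyEq_id _ (blockCorr_eventuallyEq_id G hε a b ha hb (Or.inl hx))

end Block

namespace ConjData

variable (C : ConjData d)

/-- Maps glued along the sections are differentiable if they are the identity near the boundaries
of the sections. -/
theorem differentiable_glue (n : ℕ) (hn : 1 ≤ n) (e : ℕ → Equiv.Perm (Coord d))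
    (h : ∀ i x, C.sec n (e i x) = C.sec n x) (hd : ∀ i, Differentiable ℝ (e i))
    (hid : ∀ i x, ∀ z : ℤ, ((n * C.q n : ℕ) : ℝ) * x 0 = z →
      (e i : Coord d → Coord d) =ᶠ[𝓝 x] id) :
    Differentiable ℝ (AbC.glue e (C.sec n) h) := by
  intro x
  by_cases hx : ∃ z : ℤ, ((n * C.q n : ℕ) : ℝ) * x 0 = z
  · obtain ⟨z, hz⟩ := hx
    refine differentiableAt_id.congr_of_eventuallyEq ?_
    have h1 : ∀ᶠ y in 𝓝 x, ∀ i ∈ Finset.range n, e i y = y := by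
      rw [Filter.eventually_all_finset]
      intro i _
      exact hid i x z hz
    filter_upwards [h1] with y hy
    refine hy (C.sec n y) (Finset.mem_range.mpr ?_)
    unfold sec
    have hn0 : (0 : ℤ) < n := by exact_mod_cast hn
    have := Int.emod_lt_of_pos ⌊((n * C.q n : ℕ) : ℝ) * y 0⌋ hn0
    omega
  · push Not at hx
    have hc : Continuous fun y : Coord d => ((n * C.q n : ℕ) : ℝ) * y 0 :=
      (continuous_apply 0).const_mul _
    refine (hd (C.sec n x) x).congr_of_eventuallyEq ?_
    filter_upwards [hc.continuousAt.eventually (eventually_floor_eq hx)] with y hy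
    have : C.sec n y = C.sec n x := by unfold sec; rw [hy]
    change e (C.sec n y) y = e (C.sec n x) y
    rw [this]

theorem aFreq_eq (n k : ℕ) :
    C.aFreq n k = n * C.q n * C.q n ^ ((d + 1) * (k * (k + 1) / 2)) := by
  unfold aFreq
  ring

theorem phiFreq_eq (n k : ℕ) (j : Fin (d + 1)) :
    C.phiFreq n k j = n * C.q n * C.q n ^ ((d + 1) * (k * (k - 1) / 2) + (j : ℕ) * k) := by
  unfold phiFreq
  ring

theorem differentiable_corr (n : ℕ) (hn : 1 ≤ n) : Differentiable ℝ (C.corr n hn) := by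
  refine C.differentiable_glue n hn _ _ (fun i => ?_) (fun i x z hz => ?_)
  · rw [symm_mul_gSection]
    exact differentiable_gBlockCorr _ _ _ _ _ _ _ _
  · rw [symm_mul_gSection]
    refine gBlockCorr_eventuallyEq_id _ _ _ _ _ _ _ _
      (z := (C.q n : ℤ) ^ ((d + 1) * ((i + 1) * (i + 1 + 1) / 2)) * z) ?_
    rw [aFreq_eq]
    push_cast at hz ⊢
    rw [← hz]
    ring

theorem differentiable_list_prod (l : List (Equiv.Perm (Coord d)))
    (h : ∀ P ∈ l, Differentiable ℝ P) : Differentiable ℝ l.prod := by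
  induction l with
  | nil => exact differentiable_id
  | cons P l ih =>
    rw [List.prod_cons]
    exact differentiable_mul (h P List.mem_cons_self) (ih fun Q hQ => h Q (List.mem_cons_of_mem P hQ))

theorem list_prod_eventuallyEq_id {x : Coord d} (l : List (Equiv.Perm (Coord d)))
    (h : ∀ P ∈ l, (P : Coord d → Coord d) =ᶠ[𝓝 x] id) :
    (l.prod : Coord d → Coord d) =ᶠ[𝓝 x] id := by
  induction l with
  | nil => exact EventuallyEq.rfl
  | cons P l ih =>
    rw [List.prod_cons]
    exact mul_eventuallyEq_id (h P List.mem_cons_self) (ih fun Q hQ => h Q (List.mem_cons_of_mem P hQ))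

theorem differentiable_phi (n : ℕ) (hn : 1 ≤ n) : Differentiable ℝ (C.phi n hn) := by
  refine C.differentiable_glue n hn _ _ (fun i => ?_) (fun i x z hz => ?_)
  · refine differentiable_list_prod _ fun P hP => ?_
    rw [List.mem_reverse, List.mem_ofFn] at hP
    obtain ⟨j, rfl⟩ := hP
    exact differentiable_phiTilde _ _ _ _ _ _ _ _ _ _ _
  · refine list_prod_eventuallyEq_id _ fun P hP => ?_
    rw [List.mem_reverse, List.mem_ofFn] at hP
    obtain ⟨j, rfl⟩ := hP
    refine phiTilde_eventuallyEq_id _ _ _ _ _ _ _ _ _ _ _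
      (z := (C.q n : ℤ) ^ ((d + 1) * ((i + 1) * (i + 1 - 1) / 2) + (j : ℕ) * (i + 1)) * z) ?_
    rw [phiFreq_eq]
    push_cast at hz ⊢
    rw [← hz]
    ring

theorem differentiable_H (n : ℕ) : Differentiable ℝ (C.H n) := by
  induction n with
  | zero => exact differentiable_id
  | succ n ih =>
    exact differentiable_mul ih (differentiable_mul (differentiable_mul (differentiable_shear _)
      (C.differentiable_corr _ _)) (C.differentiable_phi _ _))

/-! ### The Lipschitz estimate for the conjugation maps -/

/-- The norm on `Coord d` is the sup norm, whence the factor `d + 2`, the number of partial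
derivatives. -/
theorem norm_fderiv_apply_le {F : Coord d → Coord d} {K : ℝ} (hK0 : 0 ≤ K)
    (hK : supNormD F ≤ ENNReal.ofReal K) {z : Coord d} (hz : z ∈ openCube d) (i : Fin (d + 2)) :
    ‖fderiv ℝ (fun x => F x i) z‖ ≤ (d + 2) * K := by
  have hj : ∀ j, |fderiv ℝ (fun x => F x i) z (Pi.single j 1)| ≤ K := by
    intro j
    have h1 : ENNReal.ofReal |fderiv ℝ (fun x => F x i) z (Pi.single j 1)| ≤ ENNReal.ofReal K := by
      refine le_trans ?_ hK
      unfold supNormD supNorm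
      refine le_trans ?_ (le_iSup₂ (f := fun i j => ⨆ z ∈ openCube d,
        ENNReal.ofReal |fderiv ℝ (fun x => F x i) z (Pi.single j 1)|) i j)
      exact le_iSup₂ (f := fun z (_ : z ∈ openCube d) =>
        ENNReal.ofReal |fderiv ℝ (fun x => F x i) z (Pi.single j 1)|) z hz
    rwa [ENNReal.ofReal_le_ofReal_iff hK0] at h1
  refine ContinuousLinearMap.opNorm_le_bound _ (by positivity) fun v => ?_
  have hv : v = ∑ j, v j • (Pi.single j 1 : Coord d) := by
    ext l; simp [Finset.sum_apply, Pi.single_apply]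
  conv_lhs => rw [hv]
  rw [map_sum]
  refine (norm_sum_le _ _).trans ?_
  calc ∑ j, ‖fderiv ℝ (fun x => F x i) z (v j • (Pi.single j 1 : Coord d))‖
      ≤ ∑ _j : Fin (d + 2), ‖v‖ * K := by
        refine Finset.sum_le_sum fun j _ => ?_
        rw [map_smul, norm_smul]
        exact mul_le_mul (norm_le_pi_norm v j) (hj j) (norm_nonneg _) (norm_nonneg _)
    _ = (d + 2) * K * ‖v‖ := by
        simp; ring

theorem closure_openCube : closure (openCube d) = Set.univ.pi fun _ => Icc (0 : ℝ) 1 := by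
  have : openCube d = Set.univ.pi fun _ => Ioo (0 : ℝ) 1 := by
    ext x; simp [openCube]
  rw [this, closure_pi_set]
  simp [closure_Ioo]

theorem norm_sub_le_of_cube {F : Coord d → Coord d} (hF : Differentiable ℝ F) {K : ℝ}
    (hK0 : 0 ≤ K) (hK : supNormD F ≤ ENNReal.ofReal K) {x y : Coord d}
    (hx : ∀ i, x i ∈ Icc (0 : ℝ) 1) (hy : ∀ i, y i ∈ Icc (0 : ℝ) 1) :
    ‖F x - F y‖ ≤ (d + 2) * K * ‖x - y‖ := by
  have hconv : Convex ℝ (openCube d) := by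
    have : openCube d = Set.univ.pi fun _ => Ioo (0 : ℝ) 1 := by
      ext x; simp [openCube]
    rw [this]
    exact convex_pi fun _ _ => convex_Ioo 0 1
  have hL : LipschitzOnWith (((d : ℝ) + 2) * K).toNNReal F (openCube d) := by
    refine LipschitzOnWith.of_dist_le_mul fun u hu v hv => ?_
    rw [Real.coe_toNNReal _ (by positivity), dist_eq_norm, dist_eq_norm,
      pi_norm_le_iff_of_nonneg (by positivity)]
    intro i
    have := Convex.norm_image_sub_le_of_norm_fderiv_le (𝕜 := ℝ) (f := fun x => F x i)
      (fun z _ => (differentiable_pi.mp hF i) z)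
      (fun z hz => norm_fderiv_apply_le hK0 hK hz i) hconv hv hu
    exact this
  have hL' := hL.closure hF.continuous.continuousOn
  rw [closure_openCube] at hL'
  have := hL'.dist_le_mul x (fun i _ => hx i) y (fun i _ => hy i)
  rwa [Real.coe_toNNReal _ (by positivity), dist_eq_norm, dist_eq_norm] at this

/-- The Lipschitz estimate on the strip; the factor two comes from the segment crossing a
face of the fundamental domain at most once. -/
theorem norm_sub_le_of_strip {F : Coord d → Coord d} (hF : Differentiable ℝ F)
    (hper : ∀ x, F (x + Pi.single 0 1) = F x + Pi.single 0 1) {K : ℝ}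
    (hK0 : 0 ≤ K) (hK : supNormD F ≤ ENNReal.ofReal K) {x y : Coord d}
    (hx : x ∈ halfStrip d) (hy : y ∈ halfStrip d) (hxy : |x 0 - y 0| ≤ 1) :
    ‖F x - F y‖ ≤ 2 * ((d + 2) * K) * ‖x - y‖ := by
  have hcell : ∀ (n : ℤ) (u v : Coord d), u ∈ halfStrip d → v ∈ halfStrip d →
      u 0 ∈ Icc (n : ℝ) (n + 1) → v 0 ∈ Icc (n : ℝ) (n + 1) →
      ‖F u - F v‖ ≤ (d + 2) * K * ‖u - v‖ := by
    intro n u v hu hv hu0 hv0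
    have hmem : ∀ w : Coord d, w ∈ halfStrip d → w 0 ∈ Icc (n : ℝ) (n + 1) →
        ∀ i, (w + Pi.single 0 ((-n : ℤ) : ℝ) : Coord d) i ∈ Icc (0 : ℝ) 1 := by
      intro w hw hw0
      rw [Fin.forall_fin_succ]
      refine ⟨?_, fun i => ?_⟩
      · simp only [Pi.add_apply, Pi.single_eq_same]
        push_cast
        exact ⟨by linarith [hw0.1], by linarith [hw0.2]⟩
      · simpa using Ico_subset_Icc_self (hw i)
    have := norm_sub_le_of_cube hF hK0 hK (hmem u hu hu0) (hmem v hv hv0)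
    rwa [map_add_int hper, map_add_int hper, add_sub_add_right_eq_sub,
      add_sub_add_right_eq_sub] at this
  wlog hle : x 0 ≤ y 0 generalizing x y
  · rw [norm_sub_rev, norm_sub_rev x y]
    exact this hy hx (by rwa [abs_sub_comm]) (le_of_not_ge hle)
  rw [abs_sub_comm, abs_of_nonneg (by linarith)] at hxy
  have hKK : 0 ≤ ((d : ℝ) + 2) * K * ‖x - y‖ := by positivity
  have hx1 := Int.floor_le (x 0)
  have hx2 := Int.lt_floor_add_one (x 0)
  rcases le_or_gt (y 0) (⌊x 0⌋ + 1) with h | h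
  · have := hcell ⌊x 0⌋ x y hx hy ⟨hx1, hx2.le⟩ ⟨by linarith, h⟩
    linarith
  · let w : Coord d := Function.update x 0 ((⌊x 0⌋ : ℝ) + 1)
    have hw : w ∈ halfStrip d := fun i => by simpa [w] using hx i
    have hw0 : w 0 = ⌊x 0⌋ + 1 := by simp [w]
    have e1 := hcell ⌊x 0⌋ x w hx hw ⟨hx1, hx2.le⟩ ⟨by linarith, by linarith⟩
    have e2 := hcell (⌊x 0⌋ + 1) w y hw hy ⟨by push_cast; linarith, by push_cast; linarith⟩
      ⟨by push_cast; linarith, by push_cast; linarith⟩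
    have n1 : ‖x - w‖ ≤ ‖x - y‖ := by
      refine (pi_norm_le_iff_of_nonneg (norm_nonneg _)).mpr fun i => ?_
      by_cases hi : i = 0
      · subst hi
        refine le_trans ?_ (norm_le_pi_norm (x - y) 0)
        rw [Pi.sub_apply, Pi.sub_apply, hw0, Real.norm_eq_abs, Real.norm_eq_abs, abs_sub_comm,
          abs_sub_comm (x 0), abs_of_nonneg (by linarith), abs_of_nonneg (by linarith)]
        linarith
      · simp [w, hi]
    have n2 : ‖w - y‖ ≤ ‖x - y‖ := by
      refine (pi_norm_le_iff_of_nonneg (norm_nonneg _)).mpr fun i => ?_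
      refine le_trans ?_ (norm_le_pi_norm (x - y) i)
      by_cases hi : i = 0
      · subst hi
        rw [Pi.sub_apply, Pi.sub_apply, hw0, Real.norm_eq_abs, Real.norm_eq_abs, abs_sub_comm,
          abs_sub_comm (x 0), abs_of_nonneg (by linarith), abs_of_nonneg (by linarith)]
        linarith
      · simp [w, hi]
    have hdK : 0 ≤ ((d : ℝ) + 2) * K := by positivity
    calc ‖F x - F y‖ ≤ ‖F x - F w‖ + ‖F w - F y‖ := norm_sub_le_norm_sub_add_norm_sub _ _ _
      _ ≤ (d + 2) * K * ‖x - w‖ + (d + 2) * K * ‖w - y‖ := add_le_add e1 e2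
      _ ≤ (d + 2) * K * ‖x - y‖ + (d + 2) * K * ‖x - y‖ := by gcongr
      _ = _ := by ring

end ConjData

/-! ### The action of the factors of `φ_n` on most points -/

theorem volume_fract_notMem_real_le {N : ℕ} (hN : 0 < N) {β : ℝ} (hβ : 0 ≤ β) :
    volume {t : ℝ | t ∈ Ico (0 : ℝ) 1 ∧ Int.fract (N * t) ∉ Icc β (1 - β)} ≤
      ENNReal.ofReal (2 * β) := by
  have hN' : (0 : ℝ) < N := by exact_mod_cast hN
  have hsub : {t : ℝ | t ∈ Ico (0 : ℝ) 1 ∧ Int.fract (N * t) ∉ Icc β (1 - β)} ⊆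
      ⋃ l ∈ Finset.range N, (Icc ((l : ℝ) / N) ((l + β) / N) ∪
        Icc ((l + 1 - β) / N) ((l + 1) / N)) := by
    rintro t ⟨⟨ht0, ht1⟩, ht⟩
    have h0 : 0 ≤ (N : ℝ) * t := by positivity
    have hl : ⌊(N : ℝ) * t⌋₊ < N := by
      rw [Nat.floor_lt h0]
      nlinarith
    have hf : Int.fract ((N : ℝ) * t) = N * t - ⌊(N : ℝ) * t⌋₊ := by
      rw [Int.fract, natCast_floor_eq_intCast_floor h0]
    have hf0 := Int.fract_nonneg ((N : ℝ) * t)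
    have hf1 := Int.fract_lt_one ((N : ℝ) * t)
    rw [hf] at hf0 hf1 ht
    simp only [mem_iUnion]
    refine ⟨⌊(N : ℝ) * t⌋₊, Finset.mem_range.mpr hl, ?_⟩
    rw [mem_Icc, not_and_or, not_le, not_le] at ht
    rcases ht with h | h
    · left
      constructor
      · rw [div_le_iff₀ hN']; linarith
      · rw [le_div_iff₀ hN']; linarith
    · right
      constructor
      · rw [div_le_iff₀ hN']; linarith
      · rw [le_div_iff₀ hN']; linarith
  refine (measure_mono hsub).trans ((measure_biUnion_finset_le _ _).trans ?_)
  have hl : ∀ l ∈ Finset.range N, volume (Icc ((l : ℝ) / N) ((l + β) / N) ∪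
        Icc ((l + 1 - β) / N) ((l + 1) / N)) ≤ ENNReal.ofReal (2 * β / N) := by
    intro l _
    refine (measure_union_le _ _).trans ?_
    rw [Real.volume_Icc, Real.volume_Icc, ← sub_div, ← sub_div, add_sub_cancel_left,
      sub_sub_cancel, ← ENNReal.ofReal_add (by positivity) (by positivity)]
    refine le_of_eq ?_
    congr 1
    ring
  refine (Finset.sum_le_sum hl).trans ?_
  rw [Finset.sum_const, Finset.card_range, nsmul_eq_mul, ← ENNReal.ofReal_natCast,
    ← ENNReal.ofReal_mul (by positivity)]
  refine le_of_eq ?_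
  congr 1
  field_simp

theorem volume_fract_notMem_le {N : ℕ} (hN : 0 < N) {β : ℝ} (hβ : 0 ≤ β) (i : Fin (d + 2)) :
    volume {x : Coord d | x ∈ cell 1 0 ∧ Int.fract (N * x i) ∉ Icc β (1 - β)} ≤
      ENNReal.ofReal (2 * β) := by
  let B := {t : ℝ | t ∈ Ico (0 : ℝ) 1 ∧ Int.fract (N * t) ∉ Icc β (1 - β)}
  have hsub : {x : Coord d | x ∈ cell 1 0 ∧ Int.fract (N * x i) ∉ Icc β (1 - β)} ⊆
      Set.univ.pi fun l => if l = i then B else Ico 0 1 := by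
    rintro x ⟨hx, hxi⟩ l _
    rw [mem_cell_one_zero] at hx
    by_cases hl : l = i
    · subst hl
      simp only [if_true]
      exact ⟨hx l, hxi⟩
    · simp only [hl, if_false]
      exact hx l
  refine (measure_mono hsub).trans ?_
  rw [volume_pi_pi, Finset.prod_eq_single i]
  · simp only [if_true]
    exact volume_fract_notMem_real_le hN hβ
  · intro l _ hl
    simp [hl]
  · simp

section Good

variable {ε₁ ε₂ : ℝ} {j : Fin (d + 1)} (R₁ : LocalRotation d ε₁ j)
    (R₂ : LocalRotation d ε₂ j) (hε₁ : 0 < ε₁) (hε₂ : 0 < ε₂) (Λ μ δ : ℝ) (hΛ : 0 < Λ)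
    (hμ : 0 < μ) (hδ₀ : 0 < δ) (hδ : ∃ t : ℤ, μ * (1 - 2 * δ) = t)

theorem quarterTurn_apply_zero (x : Coord d) : quarterTurn j x 0 = 1 - x j.succ := by
  simp [quarterTurn, Function.update_of_ne (Fin.succ_ne_zero j).symm]

theorem quarterTurn_apply_succ (x : Coord d) (i : Fin (d + 1)) :
    quarterTurn j x i.succ = if i = j then x 0 else x i.succ := by
  by_cases hi : i = j
  · subst hi; simp [quarterTurn]
  · simp [quarterTurn, hi]

theorem LocalRotation.symm_apply_succ {ε : ℝ} (R : LocalRotation d ε j) {v : Coord d}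
    (hv : ∀ i, v i ∈ Icc (2 * ε) (1 - 2 * ε)) (i : Fin (d + 1)) :
    R.toPerm.symm v i.succ = (if i = j then 1 - v 0 else v i.succ) ∧
    R.toPerm.symm v 0 = v j.succ := by
  let u : Coord d := Function.update (Function.update v 0 (v j.succ)) j.succ (1 - v 0)
  have hu0 : u 0 = v j.succ := by
    simp [u, Function.update_of_ne (Fin.succ_ne_zero j).symm]
  have hus : ∀ i : Fin (d + 1), u i.succ = if i = j then 1 - v 0 else v i.succ := fun i => by
    by_cases hi : i = j
    · subst hi; simp [u]
    · simp [u, hi]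
  have hu : R.toPerm u = v := by
    rw [R.eq_quarterTurn u]
    · ext l
      refine Fin.cases ?_ (fun l => ?_) l
      · rw [quarterTurn_apply_zero, hus]; simp
      · rw [quarterTurn_apply_succ, hu0, hus]
        by_cases hl : l = j
        · subst hl; simp
        · simp [hl]
    · intro l
      refine Fin.cases ?_ (fun l => ?_) l
      · rw [hu0]; exact hv _
      · rw [hus]
        by_cases hl : l = j
        · subst hl
          simp only [if_true]
          exact ⟨by linarith [(hv 0).2], by linarith [(hv 0).1]⟩
        · simp only [hl, if_false]
          exact hv _
  have : R.toPerm.symm v = u := by rw [Equiv.symm_apply_eq, hu]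
  rw [this]
  exact ⟨hus i, hu0⟩

/-- Off the layers where the local rotations interpolate, the two opposite quarter turns combine to
a translation: the new coordinate `j` is, up to the side `1/μ` of the small cubes, the relative
position of the angle in its sector, and the angle changes by a multiple of `1/(Λ μ)`. -/
theorem phiTilde_apply_of_good (h21 : 2 * ε₁ ≤ δ) (hμδ : ∃ s : ℤ, μ * δ = s)
    (hμN : ∃ N : ℤ, μ = N) (x : Coord d) (h0 : Int.fract (Λ * x 0) ∈ Icc δ (1 - δ))
    (hs : ∀ i : Fin (d + 1), x i.succ ∈ Icc δ (1 - δ))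
    (f0 : Int.fract (μ * (Λ * x 0)) ∈ Icc (2 * ε₂) (1 - 2 * ε₂))
    (fs : ∀ i : Fin (d + 1), Int.fract (μ * x i.succ) ∈ Icc (2 * ε₂) (1 - 2 * ε₂)) :
    (∀ i, i ≠ j → phiTilde R₁ R₂ hε₁ hε₂ Λ μ δ hΛ hμ hδ₀ hδ x i.succ = x i.succ) ∧
    |phiTilde R₁ R₂ hε₁ hε₂ Λ μ δ hΛ hμ hδ₀ hδ x j.succ - Int.fract (Λ * x 0)| ≤ 1 / μ ∧
    ∃ z : ℤ, Λ * μ * (phiTilde R₁ R₂ hε₁ hε₂ Λ μ δ hΛ hμ hδ₀ hδ x 0 - x 0) = z := by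
  obtain ⟨s, hsδ⟩ := hμδ
  obtain ⟨N, hN⟩ := hμN
  let c : Coord d := Function.update 1 0 Λ
  have hc : ∀ i, c i ≠ 0 := fun i => by
    by_cases hi : i = 0
    · subst hi; simpa [c] using hΛ.ne'
    · simp [c, hi]
  let Cx := scale c hc x
  have hCx0 : Cx 0 = Λ * x 0 := by simp [Cx, scale, c]
  have hCxs : ∀ i : Fin (d + 1), Cx i.succ = x i.succ := fun i => by simp [Cx, scale, c]
  -- `y` is the relative position of the scaled point in its sector
  let y := Cx - base {0} Cx
  have hy0 : y 0 = Int.fract (Λ * x 0) := by simp [y, base, hCx0]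
  have hys : ∀ i : Fin (d + 1), y i.succ = x i.succ := fun i => by simp [y, base, hCxs]
  have hy : ∀ i, y i ∈ Icc δ (1 - δ) := fun i => by
    refine Fin.cases ?_ (fun i => ?_) i
    · rwa [hy0]
    · rw [hys]; exact hs i
  -- `w` is its image under the outer quarter turn
  let w := quarterTurn j y
  have hw0 : w 0 = 1 - y j.succ := quarterTurn_apply_zero y
  have hws : ∀ i : Fin (d + 1), w i.succ = if i = j then y 0 else y i.succ :=
    quarterTurn_apply_succ y
  have hR₁ : R₁.toPerm y = w := R₁.eq_quarterTurn y fun i =>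
    ⟨h21.trans (hy i).1, (hy i).2.trans (by linarith)⟩
  have hw : ∀ i, w i ∈ Icc δ (1 - δ) := fun i => by
    refine Fin.cases ?_ (fun i => ?_) i
    · rw [hw0]
      exact ⟨by linarith [(hy j.succ).2], by linarith [(hy j.succ).1]⟩
    · rw [hws]
      split_ifs
      · exact hy 0
      · exact hy _
  let A := affine μ δ hμ.ne' w
  have hA : ∀ i, A i = μ * w i - s := fun i => by
    have : A i = μ * (w i - δ) := rfl
    rw [this, mul_sub, hsδ]
  -- `v` is the relative position of `w` in its small cube; by `hv` the inverse turn acts on it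
  -- as an honest rotation
  let v := A - base Finset.univ A
  have hvA : ∀ i, v i = Int.fract (A i) := fun i => by simp [v, base]
  have hvw : ∀ i, v i = Int.fract (μ * w i) := fun i => by
    rw [hvA, hA, Int.fract_sub_intCast]
  have hfy0 : Int.fract (μ * y 0) = Int.fract (μ * (Λ * x 0)) := by
    rw [hy0, ← Int.self_sub_floor (Λ * x 0), mul_sub, hN, ← Int.cast_mul, Int.fract_sub_intCast]
  have hv : ∀ i, v i ∈ Icc (2 * ε₂) (1 - 2 * ε₂) := fun i => by
    refine Fin.cases ?_ (fun i => ?_) i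
    · have h1 := fs j
      have hne : Int.fract (μ * x j.succ) ≠ 0 := by
        intro h; rw [h] at h1; linarith [h1.1]
      have h2 : Int.fract (μ * w 0) = 1 - Int.fract (μ * x j.succ) := by
        rw [hw0, hys, mul_sub, mul_one, ← Int.fract_neg hne]
        nth_rw 1 [hN]
        rw [sub_eq_add_neg, Int.fract_intCast_add]
      rw [hvw, h2]
      exact ⟨by linarith [h1.2], by linarith [h1.1]⟩
    · rw [hvw, hws]
      split_ifs
      · rw [hfy0]; exact f0
      · rw [hys]; exact fs i
  have hpsi : ∀ i, psi R₂ hε₂ μ δ hμ hδ w i =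
      μ⁻¹ * ((⌊A i⌋ : ℝ) + R₂.toPerm.symm v i) + δ := by
    intro i
    have h1 : psi R₂ hε₂ μ δ hμ hδ w = ((affine μ δ hμ.ne').symm * latticeTurn R₂ hε₂ *
        affine μ δ hμ.ne' : Equiv.Perm (Coord d)) w := if_pos hw
    rw [h1]
    change μ⁻¹ * (base Finset.univ A i + R₂.toPerm.symm v i) + δ = _
    simp [base]
  have hphi : phiTilde R₁ R₂ hε₁ hε₂ Λ μ δ hΛ hμ hδ₀ hδ x =
      (scale c hc).symm (base {0} Cx + psi R₂ hε₂ μ δ hμ hδ w) := by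
    rw [← hR₁]; rfl
  have hphis : ∀ i : Fin (d + 1), phiTilde R₁ R₂ hε₁ hε₂ Λ μ δ hΛ hμ hδ₀ hδ x i.succ =
      psi R₂ hε₂ μ δ hμ hδ w i.succ := fun i => by
    rw [hphi]; simp [scale, c, base]
  have hphi0 : phiTilde R₁ R₂ hε₁ hε₂ Λ μ δ hΛ hμ hδ₀ hδ x 0 =
      Λ⁻¹ * (⌊Λ * x 0⌋ + psi R₂ hε₂ μ δ hμ hδ w 0) := by
    rw [hphi]; simp [scale, c, base, hCx0]
  have hfl : ∀ i, (⌊A i⌋ : ℝ) = A i - v i := fun i => by rw [hvA, Int.fract]; ring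
  refine ⟨fun i hi => ?_, ?_, ?_⟩
  · rw [hphis, hpsi, (R₂.symm_apply_succ hv i).1, if_neg hi, hfl, sub_add_cancel, hA, hws,
      if_neg hi, ← hsδ, ← mul_sub, inv_mul_cancel_left₀ hμ.ne', sub_add_cancel, hys]
  · rw [hphis, hpsi, (R₂.symm_apply_succ hv j).1, if_pos rfl, hfl, hA, hws, if_pos rfl, ← hsδ,
      ← hy0]
    have h1 : μ⁻¹ * (μ * y 0 - μ * δ - v j.succ + (1 - v 0)) + δ - y 0 =
        (1 - v 0 - v j.succ) / μ := by
      field_simp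
      ring
    rw [h1, abs_div, abs_of_pos hμ]
    refine div_le_div_of_nonneg_right ?_ hμ.le
    have a1 := hv 0
    have a2 := hv j.succ
    rw [abs_le]
    exact ⟨by linarith [a1.2, a2.2], by linarith [a1.1, a2.1]⟩
  · refine ⟨⌊A 0⌋ - ⌊A j.succ⌋ + s - s + 0, ?_⟩
    rw [hphi0, hpsi, (R₂.symm_apply_succ hv j).2]
    have h1 : v j.succ = A j.succ - ⌊A j.succ⌋ := by rw [hvA, Int.fract]
    rw [h1, hA j.succ, hws, if_pos rfl, hy0, Int.fract, ← hsδ]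
    push_cast
    field_simp
    ring

end Good

namespace ConjData

variable (C : ConjData d)

/-- The points to which the description in `phiTilde_apply_of_good` applies. -/
def goodSet (n k : ℕ) (j : Fin (d + 1)) : Set (Coord d) :=
  {x | ∀ i : Fin (d + 2),
    Int.fract (((if i = 0 then C.phiFreq n k j else 1 : ℕ) : ℝ) * x i) ∈
      Icc (1 / (10 * (n : ℝ) ^ 4)) (1 - 1 / (10 * (n : ℝ) ^ 4)) ∧
    Int.fract (((if i = 0 then C.q n ^ k * C.phiFreq n k j else C.q n ^ k : ℕ) : ℝ) * x i) ∈
      Icc (2 * (1 / (22 * (n : ℝ) ^ 4))) (1 - 2 * (1 / (22 * (n : ℝ) ^ 4)))}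

theorem measurableSet_goodSet (n k : ℕ) (j : Fin (d + 1)) : MeasurableSet (C.goodSet n k j) := by
  simp only [goodSet, ofPred_forall]
  refine MeasurableSet.iInter fun i => MeasurableSet.inter ?_ ?_
  · exact measurableSet_Icc.preimage (measurable_fract.comp ((measurable_pi_apply i).const_mul _))
  · exact measurableSet_Icc.preimage (measurable_fract.comp ((measurable_pi_apply i).const_mul _))

theorem volume_notMem_goodSet_le (n k : ℕ) (hn : 1 ≤ n) (j : Fin (d + 1)) :
    volume (cell 1 0 \ C.goodSet n k j) ≤ ENNReal.ofReal ((d + 2) * (1 / (n : ℝ) ^ 4)) := by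
  have hq := C.q_pos n hn
  have hn4 := pow_pos' n hn
  have hΛ : 0 < C.phiFreq n k j := by exact_mod_cast C.phiFreq_pos n k j hn
  let N1 : Fin (d + 2) → ℕ := fun i => if i = 0 then C.phiFreq n k j else 1
  let N2 : Fin (d + 2) → ℕ := fun i => if i = 0 then C.q n ^ k * C.phiFreq n k j else C.q n ^ k
  have hN1 : ∀ i, 0 < N1 i := fun i => by
    simp only [N1]; split_ifs
    · exact hΛ
    · exact one_pos
  have hN2 : ∀ i, 0 < N2 i := fun i => by
    simp only [N2]; split_ifs <;> positivity
  have hsub : (cell 1 0 \ C.goodSet n k j) ⊆ ⋃ i : Fin (d + 2),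
      ({x : Coord d | x ∈ cell 1 0 ∧ Int.fract (N1 i * x i) ∉
        Icc (1 / (10 * (n : ℝ) ^ 4)) (1 - 1 / (10 * (n : ℝ) ^ 4))} ∪
      {x : Coord d | x ∈ cell 1 0 ∧ Int.fract (N2 i * x i) ∉
        Icc (2 * (1 / (22 * (n : ℝ) ^ 4))) (1 - 2 * (1 / (22 * (n : ℝ) ^ 4)))}) := by
    rintro x ⟨hx, hxg⟩
    simp only [goodSet, mem_ofPred_eq, not_forall, not_and_or] at hxg
    obtain ⟨i, hi⟩ := hxg
    refine mem_iUnion.mpr ⟨i, ?_⟩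
    rcases hi with hi | hi
    · exact Or.inl ⟨hx, hi⟩
    · exact Or.inr ⟨hx, hi⟩
  refine (measure_mono hsub).trans ((measure_iUnion_fintype_le _ _).trans ?_)
  have hi : ∀ i ∈ (Finset.univ : Finset (Fin (d + 2))), volume
      ({x : Coord d | x ∈ cell 1 0 ∧ Int.fract (N1 i * x i) ∉
        Icc (1 / (10 * (n : ℝ) ^ 4)) (1 - 1 / (10 * (n : ℝ) ^ 4))} ∪
      {x : Coord d | x ∈ cell 1 0 ∧ Int.fract (N2 i * x i) ∉
        Icc (2 * (1 / (22 * (n : ℝ) ^ 4))) (1 - 2 * (1 / (22 * (n : ℝ) ^ 4)))}) ≤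
      ENNReal.ofReal (1 / (n : ℝ) ^ 4) := by
    intro i _
    refine (measure_union_le _ _).trans ((add_le_add (volume_fract_notMem_le (hN1 i)
      (by positivity) i) (volume_fract_notMem_le (hN2 i) (by positivity) i)).trans ?_)
    rw [← ENNReal.ofReal_add (by positivity) (by positivity)]
    refine ENNReal.ofReal_le_ofReal ?_
    rw [show 2 * (1 / (10 * (n : ℝ) ^ 4)) + 2 * (2 * (1 / (22 * (n : ℝ) ^ 4))) =
      (1 / 5 + 2 / 11) * (1 / (n : ℝ) ^ 4) by field_simp; ring]
    have : 0 < 1 / (n : ℝ) ^ 4 := by positivity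
    nlinarith
  refine (Finset.sum_le_sum hi).trans ?_
  rw [Finset.sum_const, Finset.card_univ, Fintype.card_fin, nsmul_eq_mul,
    ← ENNReal.ofReal_natCast, ← ENNReal.ofReal_mul (by positivity)]
  refine le_of_eq ?_
  push_cast
  rfl

theorem phiFactor_apply_of_good (n : ℕ) (hn : 1 ≤ n) (k : ℕ) (hk : 1 ≤ k) (j : Fin (d + 1))
    (x : Coord d) (hx : x ∈ cell 1 0) (hg : x ∈ C.goodSet n k j) :
    (∀ i, i ≠ j → C.phiFactor n hn k hk j x i.succ = x i.succ) ∧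
    |C.phiFactor n hn k hk j x j.succ - Int.fract (C.phiFreq n k j * x 0)| ≤
      1 / (C.q n : ℝ) ^ k ∧
    ∃ z : ℤ, (C.phiFreq n k j : ℝ) * (C.q n : ℝ) ^ k * (C.phiFactor n hn k hk j x 0 - x 0) = z := by
  have hn4 := pow_pos' n hn
  rw [mem_cell_one_zero] at hx
  refine phiTilde_apply_of_good _ _ _ _ _ _ _ _ _ _ _ ?_ ?_ ⟨C.q n ^ k, by simp⟩ x ?_ ?_ ?_ ?_
  · rw [show 2 * (1 / (60 * (n : ℝ) ^ 4)) = (1 / 30) * (1 / (n : ℝ) ^ 4) by field_simp; norm_num,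
      show 1 / (10 * (n : ℝ) ^ 4) = (1 / 10) * (1 / (n : ℝ) ^ 4) by field_simp]
    have : 0 < 1 / (n : ℝ) ^ 4 := by positivity
    nlinarith
  · have h : 10 * n ^ 4 ∣ C.q n ^ k :=
      ((mul_dvd_mul_right (by norm_num) _).trans (C.dvd_q n hn)).trans
        (dvd_pow_self _ (by omega))
    obtain ⟨c, hc⟩ := h
    have hc' : (C.q n : ℝ) ^ k = 10 * (n : ℝ) ^ 4 * c := by exact_mod_cast hc
    refine ⟨c, ?_⟩
    rw [hc']
    push_cast
    field_simp
  · simpa using (hg 0).1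
  · intro i
    have := (hg i.succ).1
    simp only [Fin.succ_ne_zero, if_false, Nat.cast_one, one_mul] at this
    rwa [Int.fract_eq_self.mpr (hx i.succ)] at this
  · have := (hg 0).2
    simp only [if_true] at this
    push_cast at this
    rwa [mul_assoc] at this
  · intro i
    have := (hg i.succ).2
    simp only [Fin.succ_ne_zero, if_false] at this
    push_cast at this
    exact this

theorem phiFactor_mem_cell (n : ℕ) (hn : 1 ≤ n) (k : ℕ) (hk : 1 ≤ k) (j : Fin (d + 1))
    (x : Coord d) : C.phiFactor n hn k hk j x ∈ cell 1 0 ↔ x ∈ cell 1 0 := by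
  have h1 : ⌊(1 : ℝ) * C.phiFactor n hn k hk j x 0⌋ = ⌊(1 : ℝ) * x 0⌋ := by
    refine floor_eq_of_floor_mul ⟨C.phiFreq n k j, ?_, rfl⟩ ?_
    · exact_mod_cast C.phiFreq_pos n k j hn
    · rw [one_mul]
      exact floor_phiTilde _ _ _ _ _ _ _ _ _ _ _ _
  simp only [cell, mem_ofPred_eq, Nat.cast_one, h1, (C.admissible_phiFactor n hn k hk j).mem_iff]

/-- The composition of the first `r` factors of `φ_n` on the section `k`. -/
def phiPartial (n : ℕ) (hn : 1 ≤ n) (k : ℕ) (hk : 1 ≤ k) (r : ℕ) : Equiv.Perm (Coord d) :=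
  ((List.ofFn (C.phiFactor n hn k hk)).take r).reverse.prod

theorem phiPartial_succ (n : ℕ) (hn : 1 ≤ n) (k : ℕ) (hk : 1 ≤ k) (r : ℕ) (hr : r < d + 1) :
    C.phiPartial n hn k hk (r + 1) =
      C.phiFactor n hn k hk ⟨r, hr⟩ * C.phiPartial n hn k hk r := by
  unfold phiPartial
  rw [List.take_succ_eq_append_getElem (by simpa using hr), List.reverse_append, List.prod_append,
    List.getElem_ofFn]
  simp

theorem phiPartial_last (n : ℕ) (hn : 1 ≤ n) (k : ℕ) (hk : 1 ≤ k) :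
    C.phiPartial n hn k hk (d + 1) = C.phiSection n hn k hk := by
  unfold phiPartial phiSection
  rw [List.take_of_length_le (by simp)]

theorem phiFreq_succ (n k r : ℕ) (hr : r < d + 1) (hr' : r + 1 < d + 1) :
    (C.phiFreq n k ⟨r + 1, hr'⟩ : ℝ) = C.phiFreq n k ⟨r, hr⟩ * (C.q n : ℝ) ^ k := by
  simp only [phiFreq]
  push_cast
  ring

theorem phiPartial_mem_cell (n : ℕ) (hn : 1 ≤ n) (k : ℕ) (hk : 1 ≤ k) (r : ℕ) (hr : r ≤ d + 1)
    (x : Coord d) : C.phiPartial n hn k hk r x ∈ cell 1 0 ↔ x ∈ cell 1 0 := by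
  induction r with
  | zero => rfl
  | succ r ih =>
    rw [phiPartial_succ _ _ _ _ _ _ (by omega), Equiv.Perm.mul_apply, phiFactor_mem_cell,
      ih (by omega)]

/-- Off a small set, the first `r` factors of `φ_n` replace the radial coordinates `i < r` by the
relative position of the angle in the sectors of frequency `phiFreq n k i`. -/
theorem exists_phiPartial_bad (n : ℕ) (hn : 1 ≤ n) (k : ℕ) (hk : 1 ≤ k) (r : ℕ) (hr : r ≤ d + 1) :
    ∃ B : Set (Coord d), MeasurableSet B ∧
      volume B ≤ ENNReal.ofReal (r * ((d + 2) * (1 / (n : ℝ) ^ 4))) ∧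
      ∀ x ∈ cell 1 0, x ∉ B →
        (∀ i : Fin (d + 1), (i : ℕ) < r →
          |C.phiPartial n hn k hk r x i.succ - Int.fract (C.phiFreq n k i * x 0)| ≤
            1 / (C.q n : ℝ) ^ k) ∧
        ∀ hr' : r < d + 1, ∃ z : ℤ,
          (C.phiFreq n k ⟨r, hr'⟩ : ℝ) * (C.phiPartial n hn k hk r x 0 - x 0) = z := by
  induction r with
  | zero =>
    refine ⟨∅, MeasurableSet.empty, by simp, fun x _ _ => ⟨fun i hi => by omega, fun _ => ⟨0, ?_⟩⟩⟩
    have : C.phiPartial n hn k hk 0 = 1 := by simp [phiPartial]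
    rw [this]
    simp
  | succ r ih =>
    obtain ⟨B, hB, hvol, h⟩ := ih (by omega)
    have hr0 : r < d + 1 := by omega
    have hadm : MeasurePreserving (C.phiPartial n hn k hk r) volume volume := by
      refine (admissible_list_prod _ fun P hP => ?_).measurePreserving
      rw [List.mem_reverse] at hP
      obtain ⟨j, rfl⟩ := List.mem_ofFn.mp (List.mem_of_mem_take hP)
      exact C.admissible_phiFactor n hn k hk j
    have hm : MeasurableSet (cell 1 0 \ C.goodSet n k ⟨r, hr0⟩) :=
      (measurableSet_cell 1 0).diff (C.measurableSet_goodSet n k ⟨r, hr0⟩)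
    -- new exceptional points: those that the first `r` factors move out of the good set of the
    -- next factor
    refine ⟨B ∪ C.phiPartial n hn k hk r ⁻¹' (cell 1 0 \ C.goodSet n k ⟨r, hr0⟩),
      hB.union (hadm.measurable hm), ?_, ?_⟩
    · refine (measure_union_le _ _).trans ?_
      rw [hadm.measure_preimage hm.nullMeasurableSet]
      refine (add_le_add hvol (C.volume_notMem_goodSet_le n k hn _)).trans ?_
      rw [← ENNReal.ofReal_add (by positivity) (by positivity)]
      refine ENNReal.ofReal_le_ofReal (le_of_eq ?_)
      push_cast
      ring
    · intro x hx hxB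
      rw [mem_union, not_or] at hxB
      obtain ⟨h1, h2⟩ := h x hx hxB.1
      have hyc := (C.phiPartial_mem_cell n hn k hk r (by omega) x).mpr hx
      have hyg : C.phiPartial n hn k hk r x ∈ C.goodSet n k ⟨r, hr0⟩ := by
        by_contra hcon
        exact hxB.2 ⟨hyc, hcon⟩
      obtain ⟨z, hz⟩ := h2 hr0
      obtain ⟨g1, g2, z', hz'⟩ := C.phiFactor_apply_of_good n hn k hk ⟨r, hr0⟩ _ hyc hyg
      rw [phiPartial_succ _ _ _ _ _ _ hr0, Equiv.Perm.mul_apply]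
      set y := C.phiPartial n hn k hk r x
      refine ⟨fun i hi => ?_, fun hr' => ?_⟩
      · rcases Nat.lt_succ_iff_lt_or_eq.mp hi with hi | hi
        · rw [g1 i (by rintro rfl; simp at hi)]
          exact h1 i hi
        · obtain rfl : i = ⟨r, hr0⟩ := Fin.ext hi
          -- the angle has changed by a multiple of the length of a sector of the factor `r`
          have : Int.fract ((C.phiFreq n k ⟨r, hr0⟩ : ℝ) * y 0) =
              Int.fract ((C.phiFreq n k ⟨r, hr0⟩ : ℝ) * x 0) := by
            rw [show (C.phiFreq n k ⟨r, hr0⟩ : ℝ) * y 0 = C.phiFreq n k ⟨r, hr0⟩ * x 0 + z by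
              rw [← hz]; ring, Int.fract_add_intCast]
          rwa [this] at g2
      · refine ⟨z' + z * C.q n ^ k, ?_⟩
        rw [C.phiFreq_succ n k r hr0]
        push_cast
        rw [← hz', ← hz]
        ring

end ConjData

/-! ### Integrals over cells -/

theorem integrableOn_cell {E : Type*} [NormedAddCommGroup E] {A : ℕ} (hA : 0 < A) (i : ℤ)
    {F : Coord d → E} (hF : AEStronglyMeasurable F volume) {M : ℝ} (hM : ∀ x, ‖F x‖ ≤ M) :
    IntegrableOn F (cell A i) := by
  have : NeZero A := ⟨hA.ne'⟩
  exact Integrable.of_bound hF.restrict M (Eventually.of_forall hM)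

/-- A bound for integrals over small cells extends to the cells they form. -/
theorem norm_setIntegral_cell_le_of_mul {E : Type*} [NormedAddCommGroup E] [NormedSpace ℝ E]
    {A N : ℕ} (hA : 0 < A) (hN : 0 < N) (i : ℤ) {F : Coord d → E} {G : Coord d → ℝ}
    (hF : IntegrableOn F (cell A i)) (hG : IntegrableOn G (cell A i))
    (h : ∀ j < N, ‖∫ x in cell (A * N) (i * N + j), F x‖ ≤ ∫ x in cell (A * N) (i * N + j), G x) :
    ‖∫ x in cell A i, F x‖ ≤ ∫ x in cell A i, G x := by
  rw [setIntegral_cell_mul hA hN i F hF, setIntegral_cell_mul hA hN i G hG]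
  exact (norm_sum_le _ _).trans (Finset.sum_le_sum fun j hj => h j (Finset.mem_range.mp hj))

theorem volume_pi_Ico_add_notMem_le (lo hi : Coord d) (l : Fin (d + 2)) (w : ℝ) :
    volume {x : Coord d | x ∈ Set.univ.pi (fun i => Ico (lo i) (hi i)) ∧
      x + Pi.single l w ∉ Set.univ.pi (fun i => Ico (lo i) (hi i))} ≤
      ∏ i, ENNReal.ofReal (if i = l then |w| else hi i - lo i) := by
  let lo' : Coord d := Function.update lo l (if 0 ≤ w then hi l - w else lo l)
  let hi' : Coord d := Function.update hi l (if 0 ≤ w then hi l else lo l - w)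
  have hsub : {x : Coord d | x ∈ Set.univ.pi (fun i => Ico (lo i) (hi i)) ∧
      x + Pi.single l w ∉ Set.univ.pi (fun i => Ico (lo i) (hi i))} ⊆
      Set.univ.pi fun i => Ico (lo' i) (hi' i) := by
    rintro x ⟨hx, hxw⟩ i _
    have hxi := hx i trivial
    by_cases hil : i = l
    · subst hil
      have hnot : x i + w ∉ Ico (lo i) (hi i) := by
        intro hcon
        refine hxw fun j _ => ?_
        by_cases hj : j = i
        · subst hj; simpa using hcon
        · simpa [hj] using hx j trivial
      simp only [lo', hi', Function.update_self]
      rw [mem_Ico, not_and_or, not_le, not_lt] at hnot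
      split_ifs with hw
      · rcases hnot with h | h
        · linarith [hxi.1]
        · exact ⟨by linarith, hxi.2⟩
      · rcases hnot with h | h
        · exact ⟨hxi.1, by linarith⟩
        · linarith [hxi.2, not_le.mp hw]
    · simpa [lo', hi', hil] using hxi
  refine (measure_mono hsub).trans ?_
  rw [Real.volume_pi_Ico]
  refine Finset.prod_le_prod' fun i _ => ENNReal.ofReal_le_ofReal ?_
  by_cases hil : i = l
  · subst hil
    simp only [lo', hi', Function.update_self, if_true]
    split_ifs with hw
    · rw [sub_sub_cancel]; exact le_abs_self w
    · rw [sub_sub_cancel_left]; exact neg_le_abs w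
  · simp [lo', hi', hil]

theorem volume_cell_add_notMem_le {A : ℕ} (hA : 0 < A) (i : ℤ) (w : ℝ) :
    volume {x : Coord d | x ∈ cell A i ∧ x + Pi.single 0 w ∉ cell A i} ≤ ENNReal.ofReal |w| ∧
    volume {x : Coord d | x ∈ cell A i ∧ x + Pi.single 1 w ∉ cell A i} ≤
      ENNReal.ofReal (|w| * (1 / A)) := by
  rw [cell_eq_pi hA]
  constructor
  · refine (volume_pi_Ico_add_notMem_le _ _ 0 w).trans (le_of_eq ?_)
    rw [Fin.prod_univ_succ]
    simp
  · refine (volume_pi_Ico_add_notMem_le _ _ 1 w).trans (le_of_eq ?_)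
    rw [Fin.prod_univ_succ, Fin.prod_univ_succ]
    have h2 : ∀ j : Fin d, (j.succ.succ : Fin (d + 2)) ≠ 1 := fun j => by
      rw [← Fin.succ_zero_eq_one]
      exact fun h => Fin.succ_ne_zero j (Fin.succ_injective _ h)
    simp [h2, add_div]
    rw [mul_comm]

/-- The effect of a small translation on the integral of a bounded function. -/
theorem norm_setIntegral_add_sub_le {E : Type*} [NormedAddCommGroup E] [NormedSpace ℝ E]
    {A : ℕ} (hA : 0 < A) (i : ℤ) {G : Coord d → E} (hG : AEStronglyMeasurable G volume) {M : ℝ}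
    (hM : ∀ x, ‖G x‖ ≤ M) (v : Coord d) {K : ℝ} (hK0 : 0 ≤ K)
    (hK : volume {x : Coord d | x ∈ cell A i ∧ x + v ∉ cell A i} ≤ ENNReal.ofReal K)
    (hK' : volume {x : Coord d | x ∈ cell A i ∧ x + -v ∉ cell A i} ≤ ENNReal.ofReal K) :
    ‖(∫ x in cell A i, G (x + v)) - ∫ x in cell A i, G x‖ ≤ 2 * M * K := by
  have hmp : MeasurePreserving (fun x : Coord d => x + v) volume volume :=
    measurePreserving_add_right _ _
  have hmp' : MeasurePreserving (fun x : Coord d => x + -v) volume volume :=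
    measurePreserving_add_right _ _
  set S : Set (Coord d) := cell A i with hS
  have hSm : MeasurableSet S := measurableSet_cell A i
  set S' : Set (Coord d) := (fun x : Coord d => x + -v) ⁻¹' S with hS'
  have hS'm : MeasurableSet S' := hmp'.measurable hSm
  have hpre : (fun x : Coord d => x + v) ⁻¹' S' = S := by
    ext x; simp [S']
  have e1 : ∫ x in S, G (x + v) = ∫ x in S', G x := by
    have := hmp.setIntegral_preimage_emb (measurableEmbedding_addRight _) G S'
    rwa [hpre] at this
  have hvS : volume S < ⊤ := by
    rw [hS, volume_cell hA]; exact ENNReal.ofReal_lt_top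
  have hvS' : volume S' < ⊤ := by
    rw [hmp'.measure_preimage hSm.nullMeasurableSet]; exact hvS
  have hint : ∀ U : Set (Coord d), volume U < ⊤ → IntegrableOn G U := fun U hU => by
    have : IsFiniteMeasure (volume.restrict U) := ⟨by rwa [Measure.restrict_apply_univ]⟩
    exact Integrable.of_bound hG.restrict M (Eventually.of_forall hM)
  rw [e1, ← integral_inter_add_sdiff hSm (hint S' hvS'),
    ← integral_inter_add_sdiff hS'm (hint S hvS), inter_comm S S', add_sub_add_left_eq_sub]
  have hd1 : volume (S' \ S) ≤ ENNReal.ofReal K := by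
    refine le_trans (le_of_eq ?_) hK
    have : S' \ S = (fun x : Coord d => x + -v) ⁻¹' {x | x ∈ S ∧ x + v ∉ S} := by
      ext x; simp [S']
    rw [this, hmp'.measure_preimage]
    exact (hSm.inter (hmp.measurable hSm.compl)).nullMeasurableSet
  have hd2 : volume (S \ S') ≤ ENNReal.ofReal K := hK'
  have hM0 : 0 ≤ M := (norm_nonneg _).trans (hM 0)
  have hb : ∀ U : Set (Coord d), volume U ≤ ENNReal.ofReal K → ‖∫ x in U, G x‖ ≤ M * K := by
    intro U hU
    refine (norm_setIntegral_le_of_norm_le_const (hU.trans_lt ENNReal.ofReal_lt_top)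
      fun x _ => hM x).trans ?_
    refine mul_le_mul_of_nonneg_left ?_ hM0
    exact ENNReal.toReal_le_of_le_ofReal hK0 hU
  calc _ ≤ ‖∫ x in S' \ S, G x‖ + ‖∫ x in S \ S', G x‖ := norm_sub_le _ _
    _ ≤ M * K + M * K := add_le_add (hb _ hd1) (hb _ hd2)
    _ = _ := by ring

/-- A translation of the angle by `v` before the shear has nearly the same effect as a translation
of the first radial coordinate by `v / b`, which moves the image little. -/
theorem norm_comp_shear_sub_le {X : Coord d → ℂ} {b η : ℝ} (hb : 0 < b)
    (hη : ∀ x ∈ halfStrip d, ∀ y ∈ halfStrip d, |x 0 - y 0| ≤ 1 → ‖x - y‖ ≤ 1 / b →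
      ‖X x - X y‖ ≤ η) {v : ℝ} (hv : |v| ≤ 1) {x : Coord d} (hx : x ∈ halfStrip d)
    (hxv : x + Pi.single 1 (v / b) ∈ halfStrip d) :
    ‖X (shear b (x + Pi.single 0 v)) - X (shear b (x + Pi.single 1 (v / b)))‖ ≤ η := by
  have hdiff : shear b (x + Pi.single 0 v) - shear b (x + Pi.single 1 (v / b)) =
      -Pi.single 1 (v / b) := by
    have hs0 : shear b (x + Pi.single 0 v) =
        x + Pi.single 0 v + Pi.single 0 (b * (x + Pi.single 0 v : Coord d) 1) := rfl
    have hs1 : shear b (x + Pi.single 1 (v / b)) = x + Pi.single 1 (v / b) +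
        Pi.single 0 (b * (x + Pi.single 1 (v / b) : Coord d) 1) := rfl
    have e0 : (x + Pi.single 0 v : Coord d) 1 = x 1 := by simp
    have e1 : (x + Pi.single 1 (v / b) : Coord d) 1 = x 1 + v / b := by simp
    rw [hs0, hs1, e0, e1, mul_add, mul_div_cancel₀ _ hb.ne', Pi.single_add]
    abel
  refine hη _ ?_ _ ?_ ?_ ?_
  · exact ((Admissible.shear b).mem_iff _).mpr (add_single_mem_halfStrip.mpr hx)
  · exact ((Admissible.shear b).mem_iff _).mpr hxv
  · rw [← Pi.sub_apply, hdiff]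
    simp
  · rw [hdiff, norm_neg, Pi.norm_single, Real.norm_eq_abs, abs_div, abs_of_pos hb]
    exact div_le_div_of_nonneg_right hv hb.le

/-- A pointwise bound off an exceptional set gives a bound for the difference of integrals. -/
theorem norm_setIntegral_sub_le_of_exceptional {A : ℕ} (hA : 0 < A) (i : ℤ)
    {F G : Coord d → ℂ} (hF : Measurable F) (hG : Measurable G) {M η K : ℝ}
    (hFM : ∀ x, ‖F x‖ ≤ M) (hGM : ∀ x, ‖G x‖ ≤ M) (hη0 : 0 ≤ η) (hK0 : 0 ≤ K)
    {Z : Set (Coord d)} (hZ : MeasurableSet Z) (hZK : volume (cell A i ∩ Z) ≤ ENNReal.ofReal K)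
    (h : ∀ x ∈ cell A i, x ∉ Z → ‖F x - G x‖ ≤ η) :
    ‖(∫ x in cell A i, F x) - ∫ x in cell A i, G x‖ ≤ η * (1 / A) + 2 * M * K := by
  have : NeZero A := ⟨hA.ne'⟩
  have hM0 : 0 ≤ M := (norm_nonneg _).trans (hFM 0)
  have hFi := integrableOn_cell hA i hF.aestronglyMeasurable hFM
  have hGi := integrableOn_cell hA i hG.aestronglyMeasurable hGM
  rw [← integral_sub hFi hGi, ← integral_inter_add_sdiff (f := fun x => F x - G x) hZ (hFi.sub hGi)]
  have h1 : ‖∫ x in cell A i ∩ Z, (F x - G x)‖ ≤ 2 * M * K := by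
    refine (norm_setIntegral_le_of_norm_le_const (C := 2 * M)
      (hZK.trans_lt ENNReal.ofReal_lt_top) fun x _ => ?_).trans ?_
    · refine (norm_sub_le _ _).trans ?_
      linarith [hFM x, hGM x]
    · exact mul_le_mul_of_nonneg_left (ENNReal.toReal_le_of_le_ofReal hK0 hZK) (by positivity)
  have hvol : volume (cell A i \ Z : Set (Coord d)) ≤ ENNReal.ofReal (1 / A) := by
    rw [← volume_cell (d := d) hA i]
    exact measure_mono sdiff_subset
  have h2 : ‖∫ x in cell A i \ Z, (F x - G x)‖ ≤ η * (1 / A) := by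
    refine (norm_setIntegral_le_of_norm_le_const (C := η)
      (hvol.trans_lt ENNReal.ofReal_lt_top) fun x hx => h x hx.1 hx.2).trans ?_
    exact mul_le_mul_of_nonneg_left (ENNReal.toReal_le_of_le_ofReal (by positivity) hvol) hη0
  rw [add_comm (η * _)]
  exact (norm_add_le _ _).trans (add_le_add h1 h2)

/-- After the shear, a translation of the angle hardly changes the integral over a cell, as it may be
replaced by a translation of the first radial coordinate, which hardly changes the cell. -/
theorem norm_setIntegral_shear_add_sub_le {X : Coord d → ℂ} (hXm : Measurable X) {M : ℝ}
    (hM : ∀ x, ‖X x‖ ≤ M) {b η : ℝ} (hb : 0 < b)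
    (hη : ∀ x ∈ halfStrip d, ∀ y ∈ halfStrip d, |x 0 - y 0| ≤ 1 → ‖x - y‖ ≤ 1 / b →
      ‖X x - X y‖ ≤ η) {A : ℕ} (hA : 0 < A) (i : ℤ) {v : ℝ} (hv : |v| ≤ 1) :
    ‖(∫ x in cell A i, X (shear b (x + Pi.single 0 v))) - ∫ x in cell A i, X (shear b x)‖ ≤
      (η + 4 * M / b) * (1 / A) := by
  have hM0 : 0 ≤ M := (norm_nonneg _).trans (hM 0)
  have hη0 : 0 ≤ η := by
    have h0 : (0 : Coord d) ∈ halfStrip d := fun i => by simp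
    exact (norm_nonneg _).trans (hη 0 h0 0 h0 (by simp) (by simp [hb.le]))
  have hvb : |v / b| ≤ 1 / b := by
    rw [abs_div, abs_of_pos hb]
    exact div_le_div_of_nonneg_right hv hb.le
  have hKnn : 0 ≤ 1 / b * (1 / (A : ℝ)) := by positivity
  have hK : ∀ w : ℝ, |w| ≤ 1 / b → volume {x : Coord d | x ∈ cell A i ∧
      x + Pi.single 1 w ∉ cell A i} ≤ ENNReal.ofReal (1 / b * (1 / A)) := fun w hw =>
    (volume_cell_add_notMem_le hA i w).2.trans (ENNReal.ofReal_le_ofReal (by gcongr))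
  obtain ⟨S, hS⟩ : ∃ S : Coord d → ℂ, S = fun x => X (shear b x) := ⟨_, rfl⟩
  have hSm : Measurable S := by
    rw [hS]
    exact hXm.comp (measurePreserving_shear b).measurable
  have hSM : ∀ x, ‖S x‖ ≤ M := fun x => by
    rw [hS]
    exact hM _
  have hclose : ∀ x : Coord d, x ∈ halfStrip d → x + Pi.single 1 (v / b) ∈ halfStrip d →
      ‖S (x + Pi.single 0 v) - S (x + Pi.single 1 (v / b))‖ ≤ η := fun x h1 h2 => by
    rw [hS]
    exact norm_comp_shear_sub_le hb hη hv h1 h2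
  have hSe : ∀ x, X (shear b x) = S x := fun x => by rw [hS]
  simp only [hSe]
  have hneg := hK (-(v / b)) (by rwa [abs_neg])
  rw [Pi.single_neg] at hneg
  have h1 := norm_setIntegral_add_sub_le hA i (G := S) hSm.aestronglyMeasurable hSM
    (Pi.single 1 (v / b)) hKnn (hK _ hvb) hneg
  have hZ : MeasurableSet {x : Coord d | x + Pi.single 1 (v / b) ∉ cell A i} :=
    (measurable_id.add_const (Pi.single 1 (v / b) : Coord d)) (measurableSet_cell A i).compl
  have hshift : ∀ w : Coord d, Measurable fun x : Coord d => S (x + w) := fun w =>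
    hSm.comp (measurable_id.add_const w)
  have hZK : volume (cell A i ∩ {x : Coord d | x + Pi.single 1 (v / b) ∉ cell A i}) ≤
      ENNReal.ofReal (1 / b * (1 / A)) := by
    refine le_trans (le_of_eq ?_) (hK _ hvb)
    rw [ofPred_and]
    rfl
  have h2 : ‖(∫ x in cell A i, S (x + Pi.single 0 v)) -
      ∫ x in cell A i, S (x + Pi.single 1 (v / b))‖ ≤
      η * (1 / A) + 2 * M * (1 / b * (1 / A)) := by
    refine norm_setIntegral_sub_le_of_exceptional hA i (hshift _) (hshift _) (fun x => hSM _)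
      (fun x => hSM _) hη0 hKnn hZ hZK ?_
    intro x hx hxZ
    rw [mem_ofPred_eq, not_not] at hxZ
    exact hclose x hx.2 hxZ.2
  have h3 := norm_sub_le_norm_sub_add_norm_sub (∫ x in cell A i, S (x + Pi.single 0 v))
    (∫ x in cell A i, S (x + Pi.single 1 (v / b))) (∫ x in cell A i, S x)
  have h4 : η * (1 / (A : ℝ)) + 2 * M * (1 / b * (1 / A)) + 2 * M * (1 / b * (1 / A)) =
      (η + 4 * M / b) * (1 / A) := by ring
  rw [← h4]
  exact h3.trans (add_le_add h2 h1)

/-- The shear spreads a cell, however thin, over the whole manifold: a function of mean zero has a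
small average over the image of the cell. -/
theorem norm_setIntegral_shear_le {X : Coord d → ℂ} (hXm : Measurable X) {M : ℝ}
    (hM : ∀ x, ‖X x‖ ≤ M) (hper : ∀ x, X (x + Pi.single 0 1) = X x) {b η : ℝ} (hb : 0 < b)
    (hη : ∀ x ∈ halfStrip d, ∀ y ∈ halfStrip d, |x 0 - y 0| ≤ 1 → ‖x - y‖ ≤ 1 / b →
      ‖X x - X y‖ ≤ η) (h0 : ∫ x in cell 1 0, X x = 0) {A : ℕ} (hA : 0 < A) (i : ℤ) :
    ‖∫ x in cell A i, X (shear b x)‖ ≤ (η + 4 * M / b) * (1 / A) := by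
  have hSm : Measurable fun x => X (shear b x) := hXm.comp (measurePreserving_shear b).measurable
  have hA' : (0 : ℝ) < A := by exact_mod_cast hA
  have hAz : (0 : ℤ) < A := by exact_mod_cast hA
  have hSper : ∀ x, X (shear b (x + Pi.single 0 1)) = X (shear b x) := fun x => by
    rw [(Admissible.shear b).add_one, hper]
  -- the integrals over all `A` cells add up to zero and are nearly equal to each other
  have htot : ∑ j ∈ Finset.range A, ∫ x in cell A (j : ℤ), X (shear b x) = 0 := by
    have h := setIntegral_cell_mul one_pos hA 0 (fun x : Coord d => X (shear b x))
      (integrableOn_cell one_pos 0 hSm.aestronglyMeasurable fun x => hM _)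
    rw [(Admissible.shear b).setIntegral_comp X hper, h0] at h
    simp only [one_mul, zero_mul, zero_add] at h
    exact h.symm
  set J := ∫ x in cell A i, X (shear b x) with hJ
  have hmod : J = ∫ x in cell A (i % A), X (shear b x) := by
    have h := setIntegral_cell_add hA (i % A) (A * (i / A)) fun x : Coord d => X (shear b x)
    rw [Int.emod_add_mul_ediv] at h
    rw [hJ, ← h]
    refine setIntegral_congr_fun (measurableSet_cell _ _) fun x _ => ?_
    have : (((A : ℤ) * (i / A) : ℤ) : ℝ) / A = ((i / A : ℤ) : ℝ) := by
      push_cast; field_simp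
    simp only [this]
    exact periodic_add_int (F := fun x => X (shear b x)) hSper _ x
  have hdiff : ∀ j ∈ Finset.range A, ‖(∫ x in cell A (j : ℤ), X (shear b x)) - J‖ ≤
      (η + 4 * M / b) * (1 / A) := by
    intro j hj
    have hjA : (j : ℤ) < A := by exact_mod_cast Finset.mem_range.mp hj
    have h := setIntegral_cell_add hA (i % A) (j - i % A) fun x : Coord d => X (shear b x)
    rw [add_sub_cancel] at h
    rw [hmod, ← h]
    refine norm_setIntegral_shear_add_sub_le hXm hM hb hη hA _ ?_
    have e1 := Int.emod_nonneg i hAz.ne'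
    have e2 := Int.emod_lt_of_pos i hAz
    rw [abs_div, abs_of_pos hA', div_le_one hA', ← Int.cast_abs]
    have : |(j : ℤ) - i % A| ≤ A := by rw [abs_le]; constructor <;> omega
    exact_mod_cast this
  have hsum : ‖∑ j ∈ Finset.range A, ((∫ x in cell A (j : ℤ), X (shear b x)) - J)‖ ≤
      ∑ _j ∈ Finset.range A, (η + 4 * M / b) * (1 / A) :=
    (norm_sum_le _ _).trans (Finset.sum_le_sum hdiff)
  rw [Finset.sum_sub_distrib, htot, zero_sub, norm_neg, Finset.sum_const, Finset.sum_const,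
    Finset.card_range, nsmul_eq_mul, nsmul_eq_mul, norm_mul] at hsum
  rw [show ‖(A : ℂ)‖ = (A : ℝ) by simp] at hsum
  exact le_of_mul_le_mul_left hsum hA'

namespace ConjData

variable (C : ConjData d)

/-! ### The conjugation map `h_n` on the cells -/

/-- The map `h_n = g_n ∘ φ_n` followed by the inverse shear. -/
def theta (n : ℕ) (hn : 1 ≤ n) : Equiv.Perm (Coord d) := C.corr n hn * C.phi n hn

theorem g_phi_apply (n : ℕ) (hn : 1 ≤ n) (x : Coord d) :
    C.g n hn (C.phi n hn x) = AbC.shear (C.b n) (C.theta n hn x) := rfl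

theorem admissible_theta (n : ℕ) (hn : 1 ≤ n) : Admissible (C.theta n hn) :=
  (C.admissible_corr n hn).mul (C.admissible_phi n hn)

theorem sec_phi (n : ℕ) (hn : 1 ≤ n) (x : Coord d) : C.sec n (C.phi n hn x) = C.sec n x := by
  rw [phi_apply, sec_phiSection]

theorem sec_corr (n : ℕ) (hn : 1 ≤ n) (x : Coord d) : C.sec n (C.corr n hn x) = C.sec n x := by
  rw [corr_apply, ← symm_mul_gSection, sec_gSection]

theorem sec_theta (n : ℕ) (hn : 1 ≤ n) (x : Coord d) : C.sec n (C.theta n hn x) = C.sec n x := by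
  rw [theta, Equiv.Perm.mul_apply, sec_corr, sec_phi]

theorem theta_apply (n : ℕ) (hn : 1 ≤ n) (x : Coord d) :
    C.theta n hn x = C.corrSection n hn (C.sec n x + 1)
      (C.phiSection n hn (C.sec n x + 1) (Nat.succ_pos _) x) := by
  have h : C.theta n hn x = C.corr n hn (C.phi n hn x) := rfl
  rw [h, corr_apply, sec_phi, phi_apply]

/-- The frequency of the first factor of `φ_n` on the section `k + 1` is that of the cells that the
section `k` is divided into; this is what makes the map after a rotation by one section act within
these cells. -/
theorem phiFreq_succ_zero (n k : ℕ) : C.phiFreq n (k + 1) 0 = C.aFreq n k := by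
  simp only [phiFreq, aFreq, Nat.add_sub_cancel]
  rw [mul_comm (k + 1) k]
  simp

theorem aFreq_eq_phiFreq_mul (n k : ℕ) (hk : 1 ≤ k) (j : Fin (d + 1)) :
    ∃ N : ℕ, N = C.q n ^ ((d - j) * k) ∧ C.aFreq n k = C.phiFreq n k j * C.q n ^ k * N := by
  refine ⟨_, rfl, ?_⟩
  have hj : (j : ℕ) ≤ d := by omega
  obtain ⟨e, he⟩ := Nat.exists_eq_add_of_le hj
  have h1 : k * (k + 1) / 2 = k * (k - 1) / 2 + k := by
    obtain ⟨k, rfl⟩ := Nat.exists_eq_add_of_le' hk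
    rw [show (k + 1) * (k + 1 + 1) = (k + 1) * (k + 1 - 1) + (k + 1) * 2 by
      simp only [Nat.add_sub_cancel]; ring, Nat.add_mul_div_right _ _ two_pos]
  have h2 : d - (j : ℕ) = e := by omega
  simp only [phiFreq, aFreq]
  rw [h1, h2, mul_assoc, mul_assoc, ← pow_add, ← pow_add]
  congr 2
  have h3 : (d + 1) * k = ((j : ℕ) + e + 1) * k := congrArg (fun t => (t + 1) * k) he
  rw [mul_add (d + 1), h3]
  ring

theorem phiFreq_eq_zero_mul (n k : ℕ) (j : Fin (d + 1)) :
    C.phiFreq n k j = C.phiFreq n k 0 * C.q n ^ ((j : ℕ) * k) := by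
  simp only [phiFreq]
  rw [mul_assoc, ← pow_add]
  simp [add_assoc]

theorem floor_phiSection (n : ℕ) (hn : 1 ≤ n) (k : ℕ) (hk : 1 ≤ k) (x : Coord d) :
    ⌊(C.phiFreq n k 0 : ℝ) * C.phiSection n hn k hk x 0⌋ = ⌊(C.phiFreq n k 0 : ℝ) * x 0⌋ := by
  have key : ∀ l : List (Equiv.Perm (Coord d)),
      (∀ P ∈ l, ∀ y, ⌊(C.phiFreq n k 0 : ℝ) * P y 0⌋ = ⌊(C.phiFreq n k 0 : ℝ) * y 0⌋) →
        ∀ y, ⌊(C.phiFreq n k 0 : ℝ) * l.prod y 0⌋ = ⌊(C.phiFreq n k 0 : ℝ) * y 0⌋ := by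
    intro l
    induction l with
    | nil => intro _ y; rfl
    | cons P l ih =>
      intro h y
      rw [List.prod_cons, Equiv.Perm.mul_apply, h P List.mem_cons_self,
        ih fun Q hQ => h Q (List.mem_cons_of_mem P hQ)]
  refine key _ (fun P hP y => ?_) x
  rw [List.mem_reverse, List.mem_ofFn] at hP
  obtain ⟨j, rfl⟩ := hP
  refine floor_eq_of_floor_mul (N := ((C.q n ^ ((j : ℕ) * k) : ℕ) : ℝ))
    ⟨_, pow_pos (C.q_pos n hn) _, rfl⟩ ?_
  rw [← Nat.cast_mul, ← phiFreq_eq_zero_mul]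
  exact floor_phiTilde _ _ _ _ _ _ _ _ _ _ _ _

theorem floor_corrSection (n : ℕ) (hn : 1 ≤ n) (k : ℕ) (x : Coord d) :
    ⌊(C.aFreq n k : ℝ) * C.corrSection n hn k x 0⌋ = ⌊(C.aFreq n k : ℝ) * x 0⌋ :=
  floor_gBlockCorr _ _ _ _ _ _ _ _ _

theorem floor_phiFreq_corrSection (n : ℕ) (hn : 1 ≤ n) (k : ℕ) (hk : 1 ≤ k) (x : Coord d) :
    ⌊(C.phiFreq n k 0 : ℝ) * C.corrSection n hn k x 0⌋ = ⌊(C.phiFreq n k 0 : ℝ) * x 0⌋ := by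
  obtain ⟨N, hN, h⟩ := C.aFreq_eq_phiFreq_mul n k hk 0
  have hq := C.q_pos n hn
  refine floor_eq_of_floor_mul (N := ((C.q n ^ k * N : ℕ) : ℝ))
    ⟨_, by rw [hN]; positivity, rfl⟩ ?_
  rw [← Nat.cast_mul, ← mul_assoc, ← h]
  exact C.floor_corrSection n hn k x

theorem floor_theta (n : ℕ) (hn : 1 ≤ n) (k : ℕ) (hk : 1 ≤ k) (x : Coord d)
    (hx : C.sec n x + 1 = k) :
    ⌊(C.phiFreq n k 0 : ℝ) * C.theta n hn x 0⌋ = ⌊(C.phiFreq n k 0 : ℝ) * x 0⌋ := by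
  subst hx
  rw [theta_apply, floor_phiFreq_corrSection _ _ _ _ hk, floor_phiSection]

/-- On the section `k + 1` the map `theta` preserves the cells of frequency `aFreq n k`. -/
theorem theta_mem_cell (n : ℕ) (hn : 1 ≤ n) (k : ℕ) (i : ℤ)
    (hi : ∀ x ∈ (cell (C.aFreq n k) i : Set (Coord d)), C.sec n x = k) (x : Coord d) :
    C.theta n hn x ∈ cell (C.aFreq n k) i ↔ x ∈ cell (C.aFreq n k) i := by
  have h : C.sec n x = k → (C.theta n hn x ∈ cell (C.aFreq n k) i ↔ x ∈ cell (C.aFreq n k) i) := by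
    intro hs
    have := C.floor_theta n hn (k + 1) (Nat.succ_pos k) x (by rw [hs])
    rw [phiFreq_succ_zero] at this
    simp only [cell, mem_ofPred_eq, this, (C.admissible_theta n hn).mem_iff]
  constructor
  · intro hx
    refine (h ?_).mp hx
    rw [← C.sec_theta n hn x]
    exact hi _ hx
  · intro hx
    exact (h (hi x hx)).mpr hx

/-! ### The oscillation of `h_n` on the cells -/

/-- The exceptional set for `φ_n` on the section `k`. -/
def badSection (n : ℕ) (hn : 1 ≤ n) (k : ℕ) (hk : 1 ≤ k) : Set (Coord d) :=
  (C.exists_phiPartial_bad n hn k hk (d + 1) le_rfl).choose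

theorem badSection_spec (n : ℕ) (hn : 1 ≤ n) (k : ℕ) (hk : 1 ≤ k) :
    MeasurableSet (C.badSection n hn k hk) ∧
    volume (C.badSection n hn k hk) ≤
      ENNReal.ofReal ((d + 1 : ℕ) * ((d + 2) * (1 / (n : ℝ) ^ 4))) ∧
    ∀ x ∈ cell 1 0, x ∉ C.badSection n hn k hk → ∀ i : Fin (d + 1),
      |C.phiSection n hn k hk x i.succ - Int.fract (C.phiFreq n k i * x 0)| ≤
        1 / (C.q n : ℝ) ^ k := by
  obtain ⟨h1, h2, h3⟩ := (C.exists_phiPartial_bad n hn k hk (d + 1) le_rfl).choose_spec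
  refine ⟨h1, h2, fun x hx hxB i => ?_⟩
  rw [← phiPartial_last]
  exact (h3 x hx hxB).1 i i.isLt

theorem one_le_b (n : ℕ) (hn : 1 ≤ n) : 1 ≤ C.b n := by
  have h := C.b_pos n hn
  unfold b at h ⊢
  exact_mod_cast h

theorem q_le_aFreq (n k : ℕ) (hn : 1 ≤ n) : (C.q n : ℝ) ≤ C.aFreq n k := by
  have hq := C.q_pos n hn
  rw [aFreq_eq]
  have h : C.q n * (1 * 1) ≤ C.q n * (n * C.q n ^ ((d + 1) * (k * (k + 1) / 2))) :=
    Nat.mul_le_mul_left _ (Nat.mul_le_mul hn (Nat.one_le_pow _ _ hq))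
  exact_mod_cast (by linarith [h] : C.q n ≤ n * C.q n * C.q n ^ ((d + 1) * (k * (k + 1) / 2)))

theorem q_le_phiFreq (n k : ℕ) (hn : 1 ≤ n) (j : Fin (d + 1)) : (C.q n : ℝ) ≤ C.phiFreq n k j := by
  have hq := C.q_pos n hn
  rw [phiFreq_eq]
  have h : C.q n * (1 * 1) ≤
      C.q n * (n * C.q n ^ ((d + 1) * (k * (k - 1) / 2) + (j : ℕ) * k)) :=
    Nat.mul_le_mul_left _ (Nat.mul_le_mul hn (Nat.one_le_pow _ _ hq))
  exact_mod_cast (by linarith [h] :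
    C.q n ≤ n * C.q n * C.q n ^ ((d + 1) * (k * (k - 1) / 2) + (j : ℕ) * k))

theorem abs_corrSection_sub_le (n : ℕ) (hn : 1 ≤ n) (k : ℕ) (x : Coord d) (i : Fin (d + 1)) :
    |C.corrSection n hn k x i.succ - x i.succ| ≤ 1 / C.q n := by
  have hq : (0 : ℝ) < C.q n := by exact_mod_cast C.q_pos n hn
  refine Fin.cases ?_ (fun i => ?_) i
  · have hn4 := pow_pos' n hn
    have ha := C.aFreq_pos n k hn
    have hb := C.b_pos n hn
    have h := abs_sub_le_of_floor_eq (A := C.b n * C.aFreq n k / (1 / (8 * (n : ℝ) ^ 4)))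
      (by positivity) (floor_gBlockCorr_one (C.localShear n hn) (by positivity) _ _ ha hb
        (C.block_int' n k hn) (C.block_int n k hn) x)
    refine h.trans ?_
    refine one_div_le_one_div_of_le hq ?_
    have h1 := C.one_le_b n hn
    have h2 := C.q_le_aFreq n k hn
    have h3 : (1 : ℝ) ≤ (n : ℝ) ^ 4 := one_le_pow₀ (by exact_mod_cast hn)
    rw [div_div_eq_mul_div, div_one]
    calc (C.q n : ℝ) = 1 * C.q n * 1 := by ring
      _ ≤ C.b n * C.aFreq n k * (8 * (n : ℝ) ^ 4) := by gcongr; linarith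
  · have : C.corrSection n hn k x i.succ.succ = x i.succ.succ :=
      gBlockCorr_apply_succ_succ _ _ _ _ _ _ _ _ _ _
    rw [this]
    simp

/-- Off the exceptional set, the images under `h_n` of two points of a cell of the section `k` are
close to each other: the radial coordinates of `φ_n` depend only on the cell. -/
theorem norm_g_phi_sub_le (n : ℕ) (hn : 1 ≤ n) (k : ℕ) (hk : 1 ≤ k) (i : ℤ) {x y : Coord d}
    (hx1 : x ∈ cell 1 0) (hy1 : y ∈ cell 1 0)
    (hx : x ∈ cell (C.aFreq n k) i) (hy : y ∈ cell (C.aFreq n k) i)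
    (hxs : C.sec n x + 1 = k) (hys : C.sec n y + 1 = k)
    (hxB : x ∉ C.badSection n hn k hk) (hyB : y ∉ C.badSection n hn k hk) :
    ‖C.g n hn (C.phi n hn x) - C.g n hn (C.phi n hn y)‖ ≤ 8 * C.b n / C.q n := by
  have hq : (0 : ℝ) < C.q n := by exact_mod_cast C.q_pos n hn
  have hq1 : (1 : ℝ) ≤ C.q n := by exact_mod_cast C.q_pos n hn
  have hqk : 1 / (C.q n : ℝ) ^ k ≤ 1 / C.q n :=
    one_div_le_one_div_of_le hq (le_self_pow₀ hq1 (by omega))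
  have hb := C.one_le_b n hn
  have hfl : ⌊(C.aFreq n k : ℝ) * x 0⌋ = ⌊(C.aFreq n k : ℝ) * y 0⌋ := hx.1.trans hy.1.symm
  have hxy0 : |x 0 - y 0| ≤ 1 / C.aFreq n k := abs_sub_le_of_floor_eq (C.aFreq_pos n k hn) hfl
  -- the relative positions of the two angles differ by at most `1 / q_n ^ k`
  have hfract : ∀ j : Fin (d + 1), |Int.fract ((C.phiFreq n k j : ℝ) * x 0) -
      Int.fract ((C.phiFreq n k j : ℝ) * y 0)| ≤ 1 / C.q n := by
    intro j
    obtain ⟨N, hN, hNa⟩ := C.aFreq_eq_phiFreq_mul n k hk j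
    have hqn := C.q_pos n hn
    have hN0 : 0 < N := by rw [hN]; positivity
    have hN1 : (1 : ℝ) ≤ N := by exact_mod_cast hN0
    have hΛ := C.phiFreq_pos n k j hn
    have hfl' : ⌊(C.phiFreq n k j : ℝ) * x 0⌋ = ⌊(C.phiFreq n k j : ℝ) * y 0⌋ := by
      refine floor_eq_of_floor_mul (N := ((C.q n ^ k * N : ℕ) : ℝ)) ⟨_, by positivity, rfl⟩ ?_
      rw [← Nat.cast_mul, ← mul_assoc, ← hNa]
      exact hfl
    rw [← Int.self_sub_floor, ← Int.self_sub_floor, hfl', sub_sub_sub_cancel_right, ← mul_sub,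
      abs_mul, abs_of_pos hΛ]
    calc (C.phiFreq n k j : ℝ) * |x 0 - y 0| ≤ C.phiFreq n k j * (1 / C.aFreq n k) := by gcongr
      _ = 1 / (C.q n : ℝ) ^ k * (1 / N) := by
        rw [hNa]
        push_cast
        field_simp
      _ ≤ 1 / (C.q n : ℝ) ^ k * 1 := by
        gcongr
        rw [div_le_one (by positivity)]
        exact hN1
      _ ≤ 1 / C.q n := by rw [mul_one]; exact hqk
  have hθs : ∀ j : Fin (d + 1), |C.theta n hn x j.succ - C.theta n hn y j.succ| ≤ 5 / C.q n := by
    intro j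
    subst hxs
    have b1 := C.abs_corrSection_sub_le n hn (C.sec n x + 1)
      (C.phiSection n hn (C.sec n x + 1) hk x) j
    have b2 := C.abs_corrSection_sub_le n hn (C.sec n x + 1)
      (C.phiSection n hn (C.sec n x + 1) hk y) j
    have c1 := ((C.badSection_spec n hn _ hk).2.2 x hx1 hxB j).trans hqk
    have c2 := ((C.badSection_spec n hn _ hk).2.2 y hy1 hyB j).trans hqk
    have c3 := hfract j
    have ex := C.theta_apply n hn x
    have ey : C.theta n hn y = C.corrSection n hn (C.sec n x + 1)
        (C.phiSection n hn (C.sec n x + 1) hk y) := by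
      have : C.sec n y = C.sec n x := by omega
      rw [theta_apply]
      simp only [this]
    rw [ex, ey]
    rw [abs_le] at *
    rw [show 5 / (C.q n : ℝ) = 5 * (1 / C.q n) by ring]
    constructor <;> linarith [b1.1, b1.2, b2.1, b2.2, c1.1, c1.2, c2.1, c2.2, c3.1, c3.2]
  have hθ0 : |C.theta n hn x 0 - C.theta n hn y 0| ≤ 3 / C.q n := by
    have hΛ := C.phiFreq_pos n k 0 hn
    have hle : 1 / (C.phiFreq n k 0 : ℝ) ≤ 1 / C.q n :=
      one_div_le_one_div_of_le hq (C.q_le_phiFreq n k hn 0)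
    have a1 := (abs_sub_le_of_floor_eq hΛ (C.floor_theta n hn k hk x hxs)).trans hle
    have a2 := (abs_sub_le_of_floor_eq hΛ (C.floor_theta n hn k hk y hys)).trans hle
    have a3 := hxy0.trans (one_div_le_one_div_of_le hq (C.q_le_aFreq n k hn))
    rw [abs_le] at *
    rw [show 3 / (C.q n : ℝ) = 3 * (1 / C.q n) by ring]
    constructor <;> linarith [a1.1, a1.2, a2.1, a2.2, a3.1, a3.2]
  rw [g_phi_apply, g_phi_apply]
  have h8 : 0 ≤ 8 * C.b n / C.q n := by positivity
  rw [pi_norm_le_iff_of_nonneg h8]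
  refine Fin.cases ?_ (fun j => ?_)
  · have e : ∀ z : Coord d, AbC.shear (C.b n) z 0 = z 0 + C.b n * z 1 := fun z => by
      simp [AbC.shear]
    have h1 := hθs 0
    rw [Fin.succ_zero_eq_one] at h1
    rw [Pi.sub_apply, e, e, Real.norm_eq_abs]
    have : C.theta n hn x 0 + C.b n * C.theta n hn x 1 -
        (C.theta n hn y 0 + C.b n * C.theta n hn y 1) =
        (C.theta n hn x 0 - C.theta n hn y 0) +
          C.b n * (C.theta n hn x 1 - C.theta n hn y 1) := by ring
    rw [this]
    refine (abs_add_le _ _).trans ?_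
    rw [abs_mul, abs_of_pos (C.b_pos n hn)]
    calc _ ≤ 3 / (C.q n : ℝ) + C.b n * (5 / C.q n) := by gcongr
      _ ≤ C.b n * (3 / (C.q n : ℝ)) + C.b n * (5 / C.q n) := by
        gcongr
        exact le_mul_of_one_le_left (by positivity) hb
      _ = _ := by ring
  · have e : ∀ z : Coord d, AbC.shear (C.b n) z j.succ = z j.succ := fun z => by
      simp [AbC.shear]
    rw [Pi.sub_apply, e, e, Real.norm_eq_abs]
    refine (hθs j).trans ?_
    gcongr
    linarith

end ConjData

theorem floor_eq_of_mem_cell_mul {d A N : ℕ} (hN : 0 < N) {l : ℤ} {j : ℕ} (hj : j < N)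
    {x : Coord d} (hx : x ∈ cell (A * N) (l * N + j)) : ⌊(A : ℝ) * x 0⌋ = l := by
  have hN' : (N : ℝ) ≠ 0 := by positivity
  have hN0 : (0 : ℤ) < N := by exact_mod_cast hN
  have key : ⌊(A : ℝ) * x 0⌋ = ⌊((A * N : ℕ) : ℝ) * x 0⌋ / (N : ℤ) := by
    rw [← Int.floor_div_natCast]
    congr 1
    push_cast
    field_simp
  rw [key, hx.1, add_comm, Int.add_mul_ediv_right _ _ hN0.ne',
    Int.ediv_eq_zero_of_lt (by omega) (by exact_mod_cast hj), zero_add]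

namespace ConjData

variable (C : ConjData d)

/-! ### The correlation estimate -/

/-- The number of cells of frequency `aFreq n k` in a section. -/
def cellCount (n k : ℕ) : ℕ := C.q n ^ ((d + 1) * (k * (k + 1) / 2))

theorem measurable_g_phi (n : ℕ) (hn : 1 ≤ n) :
    Measurable fun x => C.g n hn (C.phi n hn x) :=
  (C.admissible_g n hn).measurePreserving.measurable.comp
    (C.admissible_phi n hn).measurePreserving.measurable

/-- The rotation moves a cell of the section `k` into the section `k + 1`, where `φ_{n}` preserves
the cells and the shear spreads them: a function of mean zero has small average there. -/
theorem norm_setIntegral_g_phi_rot_le (n : ℕ) (hn : 1 ≤ n) {X : Coord d → ℂ} (hXm : Measurable X)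
    {M : ℝ} (hM : ∀ x, ‖X x‖ ≤ M) (hper : ∀ x, X (x + Pi.single 0 1) = X x) {η : ℝ}
    (hη : ∀ x ∈ halfStrip d, ∀ y ∈ halfStrip d, |x 0 - y 0| ≤ 1 → ‖x - y‖ ≤ 1 / C.b n →
      ‖X x - X y‖ ≤ η) (h0 : ∫ x in cell 1 0, X x = 0) {k : ℕ} (hkn : k < n)
    {l : ℤ} (hl : l % (n : ℤ) + 1 = k) {j : ℕ} (hj : j < C.cellCount n k) {t e : ℝ} {k' : ℤ}
    (ht : |t - 1 / ((n : ℝ) * C.q n) + (k' : ℝ) / C.q n| ≤ e) :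
    ‖∫ x in cell (n * C.q n * C.cellCount n k) (l * C.cellCount n k + j),
      X (C.g n hn (C.phi n hn (x + Pi.single 0 t)))‖ ≤
      (η + 4 * M / C.b n) * (1 / (n * C.q n * C.cellCount n k : ℕ)) + 2 * M * e := by
  have hq := C.q_pos n hn
  set N := C.cellCount n k with hN
  have hN0 : 0 < N := pow_pos hq _
  have haF : C.aFreq n k = n * C.q n * N := C.aFreq_eq n k
  set a := n * C.q n * N with ha
  have ha0 : 0 < a := by positivity
  have hM0 : 0 ≤ M := (norm_nonneg _).trans (hM 0)
  have he0 : 0 ≤ e := (abs_nonneg _).trans ht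
  -- up to an error `e'`, the rotation moves each point by `s` cells, to the following section
  let s : ℤ := N * (1 - k' * n)
  have hs : (s : ℝ) / a = 1 / ((n : ℝ) * C.q n) - (k' : ℝ) / C.q n := by
    have h1 : (n : ℝ) ≠ 0 := by positivity
    have h2 : (C.q n : ℝ) ≠ 0 := by positivity
    have h3 : (N : ℝ) ≠ 0 := by positivity
    simp only [s, ha]
    push_cast
    field_simp
  have he' : |t - (s : ℝ) / a| ≤ e := by
    rw [hs, ← sub_add]
    exact ht
  set e' := t - (s : ℝ) / a
  have hidx : l * (N : ℤ) + j + s = (l + 1 - k' * n) * N + j := by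
    simp only [s]; ring
  have e1 : ∫ x in cell a (l * N + j), X (C.g n hn (C.phi n hn (x + Pi.single 0 t))) =
      ∫ x in cell a ((l + 1 - k' * n) * N + j),
        X (C.g n hn (C.phi n hn (x + Pi.single 0 e'))) := by
    rw [← hidx, ← setIntegral_cell_add ha0 (l * N + j) s
      (fun x : Coord d => X (C.g n hn (C.phi n hn (x + (Pi.single 0 e' : Coord d)))))]
    refine setIntegral_congr_fun (measurableSet_cell _ _) fun x _ => ?_
    have : x + Pi.single 0 ((s : ℝ) / a) + Pi.single 0 e' = x + Pi.single 0 t := by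
      rw [add_assoc, ← Pi.single_add, add_sub_cancel]
    simp only [this]
  have hGm : Measurable fun x => X (C.g n hn (C.phi n hn x)) := hXm.comp (C.measurable_g_phi n hn)
  have hKe : ∀ i : ℤ, ∀ w : ℝ, |w| ≤ e → volume {x : Coord d | x ∈ cell a i ∧
      x + Pi.single 0 w ∉ cell a i} ≤ ENNReal.ofReal e := fun i w hw =>
    (volume_cell_add_notMem_le ha0 i w).1.trans (ENNReal.ofReal_le_ofReal hw)
  have hneg := hKe ((l + 1 - k' * n) * N + j) (-e') (by rwa [abs_neg])
  rw [Pi.single_neg] at hneg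
  -- the remaining small rotation has little effect on the integral
  have e2 := norm_setIntegral_add_sub_le ha0 ((l + 1 - k' * n) * N + j)
    (G := fun x => X (C.g n hn (C.phi n hn x))) hGm.aestronglyMeasurable (fun x => hM _)
    (Pi.single 0 e') he0 (hKe _ e' he') hneg
  have hsec : ∀ x ∈ (cell a ((l + 1 - k' * n) * N + j) : Set (Coord d)), C.sec n x = k := by
    intro x hx
    have h1 := floor_eq_of_mem_cell_mul hN0 hj hx
    have h2 : (l + 1) % (n : ℤ) = k := by
      rw [Int.add_emod, ← Int.emod_eq_of_lt (a := (k : ℤ)) (b := n) (by omega) (by omega), ← hl,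
        Int.add_emod (l % n)]
      simp
    unfold sec
    rw [h1, Int.sub_mul_emod_self_right, h2]
    simp
  have e3 : ∫ x in cell a ((l + 1 - k' * n) * N + j), X (C.g n hn (C.phi n hn x)) =
      ∫ x in cell a ((l + 1 - k' * n) * N + j), X (AbC.shear (C.b n) x) := by
    simp only [g_phi_apply]
    refine (C.admissible_theta n hn).setIntegral_cell_comp
      (fun x => X (AbC.shear (C.b n) x)) fun x => ?_
    rw [← haF] at hsec ⊢
    exact C.theta_mem_cell n hn k _ hsec x
  have e4 := norm_setIntegral_shear_le hXm hM hper (C.b_pos n hn) hη h0 ha0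
    ((l + 1 - k' * n) * N + j)
  rw [e3] at e2
  rw [e1]
  set I := ∫ x in cell a ((l + 1 - k' * n) * N + j), X (AbC.shear (C.b n) x)
  have e5 := norm_add_le ((∫ x in cell a ((l + 1 - k' * n) * N + j),
        X (C.g n hn (C.phi n hn (x + Pi.single 0 e')))) - I) I
  rw [sub_add_cancel] at e5
  linarith

/-- The exceptional sets of all sections, and the points with an angle close to a multiple of
`1 / q_n`, which include the last section of every sector: the rotation moves it to the first section
of the next sector, about which the frequencies give no information. -/
def badSet (n : ℕ) (hn : 1 ≤ n) : Set (Coord d) :=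
  {x | x ∈ cell 1 0 ∧ Int.fract ((C.q n : ℝ) * x 0) ∉ Icc (2 / (n : ℝ)) (1 - 2 / n)} ∪
    ⋃ k ∈ Finset.range n, C.badSection n hn (k + 1) (Nat.succ_pos k)

theorem measurableSet_badSet (n : ℕ) (hn : 1 ≤ n) : MeasurableSet (C.badSet n hn) := by
  refine MeasurableSet.union ((measurableSet_cell 1 0).inter ?_)
    (Finset.measurableSet_biUnion _ fun k _ => (C.badSection_spec n hn _ _).1)
  have h : Measurable fun x : Coord d => (C.q n : ℝ) * x 0 := (measurable_pi_apply 0).const_mul _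
  exact (measurable_fract.comp h) measurableSet_Icc.compl

/-- The measure of the exceptional set is at most this number. -/
def badBound (d n : ℕ) : ℝ := 4 / n + n * ((d + 1) * ((d + 2) * (1 / (n : ℝ) ^ 4)))

theorem volume_badSet_le (n : ℕ) (hn : 1 ≤ n) :
    volume (C.badSet n hn) ≤ ENNReal.ofReal (badBound d n) := by
  unfold badBound
  rw [ENNReal.ofReal_add (by positivity) (by positivity)]
  refine (measure_union_le _ _).trans (add_le_add ?_ ?_)
  · refine (volume_fract_notMem_le (C.q_pos n hn) (by positivity) 0).trans (le_of_eq ?_)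
    congr 1
    ring
  · refine (measure_biUnion_finset_le _ _).trans
      ((Finset.sum_le_sum fun k _ => (C.badSection_spec n hn (k + 1) (Nat.succ_pos k)).2.1).trans ?_)
    rw [Finset.sum_const, Finset.card_range, nsmul_eq_mul, ← ENNReal.ofReal_natCast,
      ← ENNReal.ofReal_mul (by positivity)]
    refine le_of_eq ?_
    push_cast
    rfl

/-- A bound of the correlation over a set by an integral over the same set. -/
def corrBound (n : ℕ) (hn : 1 ≤ n) (M η κ : ℝ) (x : Coord d) : ℝ :=
  (M * (η + 4 * M / C.b n + 2 * M * κ) + M * η) +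
    2 * M ^ 2 * (C.badSet n hn).indicator (fun _ => (1 : ℝ)) x

theorem integrableOn_corrBound (n : ℕ) (hn : 1 ≤ n) (M η κ : ℝ) {A : ℕ} (hA : 0 < A) (i : ℤ) :
    IntegrableOn (C.corrBound n hn M η κ) (cell A i) := by
  have : NeZero A := ⟨hA.ne'⟩
  refine Integrable.add (integrable_const _) (Integrable.const_mul ?_ _)
  exact (integrable_const (1 : ℝ)).indicator (C.measurableSet_badSet n hn)

theorem nonneg_of_osc {X : Coord d → ℂ} {r η : ℝ} (hr : 0 ≤ r)
    (h : ∀ x ∈ halfStrip d, ∀ y ∈ halfStrip d, |x 0 - y 0| ≤ 1 → ‖x - y‖ ≤ r →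
      ‖X x - X y‖ ≤ η) : 0 ≤ η := by
  have h0 : (0 : Coord d) ∈ halfStrip d := fun i => by simp
  exact (norm_nonneg _).trans (h 0 h0 0 h0 (by simp) (by simpa using hr))

theorem norm_setIntegral_corr_small_le (n : ℕ) (hn : 1 ≤ n) {X Y : Coord d → ℂ}
    (hXm : Measurable X) (hYm : Measurable Y) {M : ℝ} (hXM : ∀ x, ‖X x‖ ≤ M)
    (hYM : ∀ x, ‖Y x‖ ≤ M) (hper : ∀ x, X (x + Pi.single 0 1) = X x) {η : ℝ}
    (hXη : ∀ x ∈ halfStrip d, ∀ y ∈ halfStrip d, |x 0 - y 0| ≤ 1 → ‖x - y‖ ≤ 1 / C.b n →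
      ‖X x - X y‖ ≤ η)
    (hYη : ∀ x ∈ halfStrip d, ∀ y ∈ halfStrip d, |x 0 - y 0| ≤ 1 →
      ‖x - y‖ ≤ 8 * C.b n / C.q n → ‖Y x - Y y‖ ≤ η)
    (h8 : 8 * C.b n / C.q n ≤ 1) (h0 : ∫ x in cell 1 0, X x = 0)
    {t e κ : ℝ} {k' : ℤ} (ht : |t - 1 / ((n : ℝ) * C.q n) + (k' : ℝ) / C.q n| ≤ e)
    {k : ℕ} (hk : 1 ≤ k) (hkn : k < n) (hκ : e * C.aFreq n k ≤ κ) {l : ℤ}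
    (hl : l % (n : ℤ) + 1 = k) {j : ℕ} (hj : j < C.cellCount n k)
    (hsub : (cell (n * C.q n * C.cellCount n k) (l * C.cellCount n k + j) : Set (Coord d)) ⊆
      cell 1 0) :
    ‖∫ x in cell (n * C.q n * C.cellCount n k) (l * C.cellCount n k + j),
      X (C.g n hn (C.phi n hn (x + Pi.single 0 t))) * Y (C.g n hn (C.phi n hn x))‖ ≤
    ∫ x in cell (n * C.q n * C.cellCount n k) (l * C.cellCount n k + j),
      C.corrBound n hn M η κ x := by
  have hq := C.q_pos n hn
  have hM0 : 0 ≤ M := (norm_nonneg _).trans (hXM 0)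
  have hη0 : 0 ≤ η := nonneg_of_osc (one_div_nonneg.mpr (C.b_pos n hn).le) hXη
  have e1 := C.norm_setIntegral_g_phi_rot_le n hn hXm hXM hper hXη h0 hkn hl hj ht
  have hN0 : 0 < C.cellCount n k := pow_pos hq _
  have haF : C.aFreq n k = n * C.q n * C.cellCount n k := C.aFreq_eq n k
  have hfl : ∀ x ∈ (cell (n * C.q n * C.cellCount n k) (l * C.cellCount n k + j) : Set (Coord d)),
      C.sec n x + 1 = k := fun x hx => by
    have := floor_eq_of_mem_cell_mul hN0 hj hx
    unfold sec
    rw [this]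
    omega
  generalize hi : l * (C.cellCount n k : ℤ) + j = i at *
  have ha0 : 0 < C.aFreq n k := by rw [haF]; positivity
  rw [← haF] at e1 hsub hfl ⊢
  set a := C.aFreq n k with ha
  have haR : (0 : ℝ) < a := by exact_mod_cast ha0
  have : NeZero a := ⟨ha0.ne'⟩
  set U : Coord d → ℂ := fun x => X (C.g n hn (C.phi n hn (x + Pi.single 0 t))) with hU
  set V : Coord d → ℂ := fun x => Y (C.g n hn (C.phi n hn x)) with hV
  have hUm : Measurable U :=
    (hXm.comp (C.measurable_g_phi n hn)).comp (measurable_id.add_const (Pi.single 0 t : Coord d))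
  have hVm : Measurable V := hYm.comp (C.measurable_g_phi n hn)
  have hUM : ∀ x, ‖U x‖ ≤ M := fun x => hXM _
  have hVM : ∀ x, ‖V x‖ ≤ M := fun x => hYM _
  -- up to the exceptional set, `V` is nearly constant on the cell, with value `v`
  obtain ⟨v, hvM, hv⟩ : ∃ v : ℂ, ‖v‖ ≤ M ∧ ∀ x ∈ (cell a i : Set (Coord d)),
      ‖V x - v‖ ≤ η + 2 * M * (C.badSet n hn).indicator (fun _ => (1 : ℝ)) x := by
    have hbad : ∀ v : ℂ, ‖v‖ ≤ M → ∀ x ∈ C.badSet n hn,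
        ‖V x - v‖ ≤ η + 2 * M * (C.badSet n hn).indicator (fun _ => (1 : ℝ)) x := by
      intro v hv x hx
      rw [indicator_of_mem hx, mul_one]
      refine (norm_sub_le _ _).trans ?_
      linarith [hVM x]
    by_cases hex : ∃ y ∈ (cell a i : Set (Coord d)), y ∉ C.badSet n hn
    · obtain ⟨y, hy, hyB⟩ := hex
      refine ⟨V y, hVM y, fun x hx => ?_⟩
      by_cases hxB : x ∈ C.badSet n hn
      · exact hbad _ (hVM y) x hxB
      · rw [indicator_of_notMem hxB, mul_zero, add_zero]
        have hsecB : ∀ z, z ∉ C.badSet n hn → z ∉ C.badSection n hn k hk := by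
          intro z hz hzB
          refine hz (Or.inr ?_)
          obtain ⟨k, rfl⟩ := Nat.exists_eq_add_of_le' hk
          exact mem_biUnion (Finset.mem_range.mpr (by omega : k < n)) hzB
        have hnorm := C.norm_g_phi_sub_le n hn k hk i (hsub hx) (hsub hy) hx hy (hfl x hx)
          (hfl y hy) (hsecB x hxB) (hsecB y hyB)
        have hmem : ∀ z ∈ (cell a i : Set (Coord d)),
            C.g n hn (C.phi n hn z) ∈ halfStrip d := fun z hz =>
          ((C.admissible_g n hn).mem_iff _).mpr (((C.admissible_phi n hn).mem_iff z).mpr hz.2)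
        exact hYη _ (hmem x hx) _ (hmem y hy) (((norm_le_pi_norm _ 0).trans hnorm).trans h8) hnorm
    · push Not at hex
      exact ⟨0, by simpa using hM0, fun x hx => hbad 0 (by simpa using hM0) x (hex x hx)⟩
  have hUi := integrableOn_cell ha0 i hUm.aestronglyMeasurable hUM
  have hDm : Measurable fun x => U x * (V x - v) := hUm.mul (hVm.sub_const v)
  have hDi : IntegrableOn (fun x => U x * (V x - v)) (cell a i) := by
    refine integrableOn_cell ha0 i hDm.aestronglyMeasurable (M := M * (M + M)) fun x => ?_
    rw [norm_mul]
    exact mul_le_mul (hUM x) ((norm_sub_le _ _).trans (add_le_add (hVM x) hvM)) (norm_nonneg _) hM0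
  have hsplit : ∫ x in cell a i, U x * V x =
      (∫ x in cell a i, U x) * v + ∫ x in cell a i, U x * (V x - v) := by
    rw [← integral_mul_const, ← integral_add (hUi.mul_const v) hDi]
    refine integral_congr_ae (Eventually.of_forall fun x => ?_)
    ring
  have hindi : IntegrableOn ((C.badSet n hn).indicator fun _ => (1 : ℝ)) (cell a i) :=
    (integrable_const (1 : ℝ)).indicator (C.measurableSet_badSet n hn)
  have hindi' : IntegrableOn (fun x => M * η +
      2 * M ^ 2 * (C.badSet n hn).indicator (fun _ => (1 : ℝ)) x) (cell a i) :=
    (integrable_const _).add (hindi.const_mul _)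
  have h2 : ‖∫ x in cell a i, U x * (V x - v)‖ ≤
      ∫ x in cell a i, (M * η + 2 * M ^ 2 * (C.badSet n hn).indicator (fun _ => (1 : ℝ)) x) := by
    refine norm_integral_le_of_norm_le hindi' ?_
    rw [ae_restrict_iff' (measurableSet_cell a i)]
    refine Eventually.of_forall fun x hx => ?_
    rw [norm_mul]
    refine (mul_le_mul (hUM x) (hv x hx) (norm_nonneg _) hM0).trans (le_of_eq ?_)
    ring
  have h1 : ‖(∫ x in cell a i, U x) * v‖ ≤
      ∫ _x in (cell a i : Set (Coord d)), M * (η + 4 * M / C.b n + 2 * M * κ) := by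
    rw [norm_mul, integral_const, measureReal_restrict_apply_univ, measureReal_cell ha0,
      smul_eq_mul]
    have he : 2 * M * e ≤ 2 * M * κ * (1 / a) := by
      rw [mul_one_div, le_div_iff₀ haR, mul_assoc]
      gcongr
    calc ‖∫ x in cell a i, U x‖ * ‖v‖
        ≤ ((η + 4 * M / C.b n) * (1 / a) + 2 * M * e) * M :=
          mul_le_mul e1 hvM (norm_nonneg _) ((norm_nonneg _).trans e1)
      _ ≤ ((η + 4 * M / C.b n) * (1 / a) + 2 * M * κ * (1 / a)) * M := by gcongr
      _ = _ := by ring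
  rw [hsplit]
  refine (norm_add_le _ _).trans ((add_le_add h1 h2).trans (le_of_eq ?_))
  rw [← integral_add (integrable_const _) hindi']
  refine integral_congr_ae (Eventually.of_forall fun x => ?_)
  simp only [corrBound]
  ring

theorem cell_subset_cell_one {A : ℕ} (hA : 0 < A) {j : ℕ} (hj : j < A) :
    (cell A (j : ℤ) : Set (Coord d)) ⊆ cell 1 0 := by
  intro x hx
  have hx' : x ∈ cell (1 * A) ((0 : ℤ) * A + j) := by simpa using hx
  exact ⟨floor_eq_of_mem_cell_mul hA hj hx', hx.2⟩

theorem cell_mul_subset {A N : ℕ} (hN : 0 < N) {l : ℤ} {j : ℕ} (hj : j < N) :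
    (cell (A * N) (l * N + j) : Set (Coord d)) ⊆ cell A l := fun _ hx =>
  ⟨floor_eq_of_mem_cell_mul hN hj hx, hx.2⟩

/-- The correlation of `X` and `Y` along the rotation, after the substitution by `h_n`. -/
theorem norm_setIntegral_correlation_le (n : ℕ) (hn : 1 ≤ n) {X Y : Coord d → ℂ}
    (hXm : Measurable X) (hYm : Measurable Y) {M : ℝ} (hXM : ∀ x, ‖X x‖ ≤ M)
    (hYM : ∀ x, ‖Y x‖ ≤ M) (hper : ∀ x, X (x + Pi.single 0 1) = X x) {η : ℝ}
    (hXη : ∀ x ∈ halfStrip d, ∀ y ∈ halfStrip d, |x 0 - y 0| ≤ 1 → ‖x - y‖ ≤ 1 / C.b n →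
      ‖X x - X y‖ ≤ η)
    (hYη : ∀ x ∈ halfStrip d, ∀ y ∈ halfStrip d, |x 0 - y 0| ≤ 1 →
      ‖x - y‖ ≤ 8 * C.b n / C.q n → ‖Y x - Y y‖ ≤ η)
    (h8 : 8 * C.b n / C.q n ≤ 1) (h0 : ∫ x in cell 1 0, X x = 0)
    {t e κ : ℝ} {k' : ℤ} (ht : |t - 1 / ((n : ℝ) * C.q n) + (k' : ℝ) / C.q n| ≤ e)
    (hκ : ∀ k, 1 ≤ k → k < n → e * C.aFreq n k ≤ κ) (hκ0 : 0 ≤ κ) :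
    ‖∫ x in cell 1 0,
      X (C.g n hn (C.phi n hn (x + Pi.single 0 t))) * Y (C.g n hn (C.phi n hn x))‖ ≤
    (M * (η + 4 * M / C.b n + 2 * M * κ) + M * η) + 2 * M ^ 2 * badBound d n := by
  have hq := C.q_pos n hn
  have hb := C.b_pos n hn
  have hM0 : 0 ≤ M := (norm_nonneg _).trans (hXM 0)
  have hη0 : 0 ≤ η := nonneg_of_osc (one_div_nonneg.mpr (C.b_pos n hn).le) hXη
  have hnq : 0 < n * C.q n := by positivity
  set W : Coord d → ℂ := fun x =>
    X (C.g n hn (C.phi n hn (x + Pi.single 0 t))) * Y (C.g n hn (C.phi n hn x)) with hW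
  have hWm : Measurable W :=
    ((hXm.comp (C.measurable_g_phi n hn)).comp
      (measurable_id.add_const (Pi.single 0 t : Coord d))).mul
      (hYm.comp (C.measurable_g_phi n hn))
  have hWM : ∀ x, ‖W x‖ ≤ M * M := fun x => by
    rw [hW, norm_mul]
    exact mul_le_mul (hXM _) (hYM _) (norm_nonneg _) hM0
  have hWi : ∀ {A : ℕ} (_ : 0 < A) (i : ℤ), IntegrableOn W (cell A i) := fun hA i =>
    integrableOn_cell hA i hWm.aestronglyMeasurable hWM
  -- the last section of a sector is exceptional; every other section is divided into cells
  have hsection : ∀ l < n * C.q n, ‖∫ x in cell (n * C.q n) (l : ℤ), W x‖ ≤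
      ∫ x in cell (n * C.q n) (l : ℤ), C.corrBound n hn M η κ x := by
    intro l hl
    have hsubl := cell_subset_cell_one (d := d) hnq hl
    have hn0 : (0 : ℤ) < n := by exact_mod_cast hn
    by_cases hlast : l % n + 1 = n
    · refine norm_integral_le_of_norm_le (C.integrableOn_corrBound n hn M η κ hnq l) ?_
      rw [ae_restrict_iff' (measurableSet_cell _ _)]
      refine Eventually.of_forall fun x hx => ?_
      have hxB : x ∈ C.badSet n hn := by
        refine Or.inl ⟨hsubl hx, fun hcon => ?_⟩
        have hfl : ⌊((n * C.q n : ℕ) : ℝ) * x 0⌋ = l := hx.1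
        have hnR : (0 : ℝ) < n := by exact_mod_cast hn
        have h1 := (Int.floor_eq_iff.mp hfl).1
        have h2 := (Int.floor_eq_iff.mp hfl).2
        push_cast at h1 h2
        have hl' : (l : ℝ) = n * (l / n : ℕ) + (n - 1) := by
          have := Nat.div_add_mod l n
          have h3 : l = n * (l / n) + (n - 1) := by omega
          have h4 : ((n - 1 : ℕ) : ℝ) = n - 1 := by push_cast [hn]; rfl
          rw [← h4]
          exact_mod_cast h3
        have hqfl : ⌊(C.q n : ℝ) * x 0⌋ = ((l / n : ℕ) : ℤ) := by
          rw [Int.floor_eq_iff]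
          push_cast
          constructor
          · by_contra hlt
            push Not at hlt
            have : (n : ℝ) * (C.q n * x 0) < n * ((l / n : ℕ) : ℝ) :=
              mul_lt_mul_of_pos_left hlt hnR
            have hn1 : (1 : ℝ) ≤ n := by exact_mod_cast hn
            linarith
          · by_contra hlt
            push Not at hlt
            have : (n : ℝ) * (((l / n : ℕ) : ℝ) + 1) ≤ n * (C.q n * x 0) :=
              mul_le_mul_of_nonneg_left hlt hnR.le
            linarith
        have hfr : Int.fract ((C.q n : ℝ) * x 0) = C.q n * x 0 - (l / n : ℕ) := by
          rw [Int.fract, hqfl, Int.cast_natCast]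
        have h5 := hcon.2
        rw [hfr] at h5
        have h6 : (n : ℝ) * (C.q n * x 0 - (l / n : ℕ)) ≤ n * (1 - 2 / n) :=
          mul_le_mul_of_nonneg_left h5 hnR.le
        rw [mul_sub, mul_sub (n : ℝ) 1, mul_div_cancel₀ _ hnR.ne'] at h6
        linarith
      refine (hWM x).trans ?_
      have hpos : 0 ≤ M * (η + 4 * M / C.b n + 2 * M * κ) + M * η := by positivity
      rw [corrBound, indicator_of_mem hxB, mul_one]
      nlinarith [sq_nonneg M]
    · have hkn : l % n + 1 < n := by
        have := Nat.mod_lt l (show 0 < n by omega)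
        omega
      have hN0 : 0 < C.cellCount n (l % n + 1) := pow_pos hq _
      refine norm_setIntegral_cell_le_of_mul hnq hN0 l (hWi hnq l)
        (C.integrableOn_corrBound n hn M η κ hnq l) fun j hj => ?_
      refine C.norm_setIntegral_corr_small_le n hn hXm hYm hXM hYM hper hXη hYη h8 h0 ht
        (Nat.succ_pos _) hkn (hκ _ (Nat.succ_pos _) hkn) (by push_cast; rfl) hj
        ((cell_mul_subset hN0 hj).trans hsubl)
  have hmain : ‖∫ x in cell 1 0, W x‖ ≤ ∫ x in cell 1 0, C.corrBound n hn M η κ x := by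
    refine norm_setIntegral_cell_le_of_mul one_pos hnq 0 (hWi one_pos 0)
      (C.integrableOn_corrBound n hn M η κ one_pos 0) fun l hl => ?_
    simpa using hsection l hl
  refine hmain.trans ?_
  have : NeZero 1 := ⟨one_ne_zero⟩
  simp only [corrBound]
  rw [integral_add (integrable_const _), integral_const, integral_const_mul,
    setIntegral_indicator (C.measurableSet_badSet n hn), setIntegral_const,
    measureReal_restrict_apply_univ, measureReal_cell one_pos]
  · have hvol : volume.real (cell 1 0 ∩ C.badSet n hn) ≤ badBound d n := by
      refine ENNReal.toReal_le_of_le_ofReal (by unfold badBound; positivity) ?_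
      exact (measure_mono inter_subset_right).trans (C.volume_badSet_le n hn)
    simp only [Nat.cast_one, div_one, one_mul, smul_eq_mul, mul_one]
    gcongr
  · refine Integrable.const_mul ?_ _
    exact (integrable_const (1 : ℝ)).indicator (C.measurableSet_badSet n hn)

/-! ### The times of the iterates and the growth of the parameters -/

/-- The infimum in the definition of `mTime` is over a nonempty set of times: as `α_{n+1}` is a
reduced fraction with denominator `q'`, up to a factor, its multiples meet every residue class
modulo one with precision `1 / q'`. -/
theorem exists_mTime (n : ℕ) (hn : 1 ≤ n) :
    ∃ k : ℤ, |(C.mTime n : ℝ) * C.α (n + 1) - 1 / ((n : ℝ) * C.q n) + (k : ℝ) / C.q n| ≤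
      2 * (260 * ((n : ℝ) + 1) ^ 4 / C.q (n + 1)) := by
  have hq := C.q_pos n hn
  have hqR : (C.q n : ℝ) ≠ 0 := by positivity
  have hq' : (0 : ℝ) < C.q (n + 1) := by exact_mod_cast C.q_pos (n + 1) (by omega)
  have hE : 0 < 260 * ((n : ℝ) + 1) ^ 4 / C.q (n + 1) := by positivity
  have hne : {t : ℕ | 1 ≤ t ∧ t ≤ C.q (n + 1) ∧
      ⨅ k : ℤ, |(t : ℝ) * C.α (n + 1) - 1 / ((n : ℝ) * C.q n) + (k : ℝ) / C.q n| ≤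
        260 * ((n : ℝ) + 1) ^ 4 / C.q (n + 1)}.Nonempty := by
    obtain ⟨p', q', hq0, hcop, hp, hqq⟩ := C.reduced (n + 1) (by omega)
    have hq0R : (0 : ℝ) < q' := by exact_mod_cast hq0
    have hα : C.α (n + 1) = p' / q' := by
      unfold α
      rw [hp, hqq]
      push_cast
      rw [mul_div_mul_left _ _ (by positivity)]
    have hE' : 260 * ((n : ℝ) + 1) ^ 4 / C.q (n + 1) = 1 / q' := by
      rw [hqq]
      push_cast
      field_simp
    obtain ⟨u, v, huv⟩ := hcop
    -- `u` inverts `p'` modulo `q'`; the time `t` is a representative of `s u` in `{1, …, q'}`.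
    set s : ℤ := ⌊(q' : ℝ) / (n * C.q n)⌋ with hs
    have hq0Z : (0 : ℤ) < q' := by exact_mod_cast hq0
    set t : ℤ := (s * u - 1) % q' + 1 with ht
    have ht1 : 1 ≤ t := by
      have := Int.emod_nonneg (s * u - 1) hq0Z.ne'
      omega
    have ht2 : t ≤ q' := by
      have := Int.emod_lt_of_pos (s * u - 1) hq0Z
      omega
    have ht3 : t = s * u - q' * ((s * u - 1) / q') := by
      have := Int.emod_add_mul_ediv (s * u - 1) q'
      omega
    set w : ℤ := -s * v - (s * u - 1) / q' * p' with hw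
    have ht4 : t * p' = s + w * q' := by
      rw [ht3, hw]
      linear_combination s * huv
    clear_value t
    lift t to ℕ using by omega
    refine ⟨t, by omega, ?_, ?_⟩
    · have h1 : t ≤ q' := by exact_mod_cast ht2
      refine h1.trans ?_
      rw [hqq]
      exact Nat.le_mul_of_pos_left _ (by positivity)
    · refine (ciInf_le ⟨0, ?_⟩ (-w * C.q n)).trans ?_
      · rintro _ ⟨k, rfl⟩
        exact abs_nonneg _
      · have h4 : (t : ℝ) * p' = s + w * q' := by exact_mod_cast ht4
        have h5 : (t : ℝ) * (p' / q') - 1 / ((n : ℝ) * C.q n) + ((-w * C.q n : ℤ) : ℝ) / C.q n =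
            -((q' : ℝ) / (n * C.q n) - s) / q' := by
          push_cast
          rw [mul_div_assoc', h4]
          field_simp
          ring
        have h6 := Int.fract_nonneg ((q' : ℝ) / (n * C.q n))
        have h7 := (Int.fract_lt_one ((q' : ℝ) / (n * C.q n))).le
        rw [Int.fract, ← hs] at h6 h7
        rw [hα, h5, hE', abs_div, abs_neg, abs_of_nonneg h6, abs_of_pos hq0R]
        gcongr
  have hmem := (Nat.sInf_mem hne).2.2
  obtain ⟨k, hk⟩ := exists_lt_of_ciInf_lt (hmem.trans_lt (lt_two_mul_self hE))
  exact ⟨k, hk.le⟩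

theorem le_q (n : ℕ) (hn : 1 ≤ n) : 260 * n ^ 4 ≤ C.q n :=
  Nat.le_of_dvd (C.q_pos n hn) (C.dvd_q n hn)

/-- The error of the rotation by `m_n α_{n+1}` is small compared with the cells of all sections. -/
theorem mul_aFreq_le (n k : ℕ) (hn : 1 ≤ n) (hk : k < n) :
    2 * (260 * ((n : ℝ) + 1) ^ 4 / C.q (n + 1)) * C.aFreq n k ≤ 1 / n := by
  have hq := C.q_pos n hn
  have hq' := C.q_pos (n + 1) (by omega)
  have h1 : C.aFreq n k ≤ n * C.q n ^ ((d + 1) * n ^ 2 + 3) := by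
    unfold aFreq
    refine Nat.mul_le_mul_left _ (Nat.pow_le_pow_right hq ?_)
    have h2 : k * (k + 1) / 2 ≤ n ^ 2 := by
      refine (Nat.div_le_self _ _).trans ?_
      rw [sq]
      exact Nat.mul_le_mul hk.le hk
    have := Nat.mul_le_mul_left (d + 1) h2
    omega
  have h2 : 520 * (n + 1) ^ 4 * C.aFreq n k * n ≤ C.q (n + 1) := by
    refine le_trans ?_ (C.growth n hn)
    have h3 : n ^ 2 ≤ n ^ 11 := Nat.pow_le_pow_right hn (by norm_num)
    calc 520 * (n + 1) ^ 4 * C.aFreq n k * n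
        ≤ 520 * (n + 1) ^ 4 * (n * C.q n ^ ((d + 1) * n ^ 2 + 3)) * n := by gcongr
      _ = 520 * (n + 1) ^ 4 * n ^ 2 * C.q n ^ ((d + 1) * n ^ 2 + 3) := by ring
      _ ≤ 64 * 260 * (n + 1) ^ 4 * n ^ 11 * C.q n ^ ((d + 1) * n ^ 2 + 3) := by
        gcongr
        norm_num
  have hnR : (0 : ℝ) < n := by exact_mod_cast hn
  have hqR : (0 : ℝ) < C.q (n + 1) := by exact_mod_cast hq'
  rw [le_div_iff₀ hnR, mul_div_assoc', div_mul_eq_mul_div, div_mul_eq_mul_div, div_le_one hqR]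
  have h3 : (520 : ℝ) * (n + 1) ^ 4 * C.aFreq n k * n ≤ C.q (n + 1) := by exact_mod_cast h2
  linarith

theorem nat_le_q (n : ℕ) : n ≤ C.q n := by
  rcases Nat.eq_zero_or_pos n with rfl | hn
  · exact Nat.zero_le _
  · refine le_trans ?_ (C.le_q n hn)
    have := Nat.le_self_pow (show 4 ≠ 0 by norm_num) n
    omega

theorem tendsto_q : Tendsto (fun n => (C.q n : ℝ)) atTop atTop :=
  tendsto_natCast_atTop_atTop.comp (tendsto_atTop_mono C.nat_le_q tendsto_id)

theorem half_le_b (n : ℕ) (hn : 1 ≤ n) : (n : ℝ) * (C.q n : ℝ) ^ C.σ / 2 ≤ C.b n := by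
  have h1 := C.one_le_b n hn
  have h2 : (n : ℝ) * (C.q n : ℝ) ^ C.σ < C.b n + 1 := Nat.lt_floor_add_one _
  linarith

theorem b_le (n : ℕ) : C.b n ≤ (n : ℝ) * (C.q n : ℝ) ^ C.σ :=
  Nat.floor_le (by positivity)

theorem tendsto_log_q_div_rpow {s : ℝ} (hs : 0 < s) :
    Tendsto (fun n => Real.log (C.q n) / (C.q n : ℝ) ^ s) atTop (𝓝 0) :=
  (isLittleO_log_rpow_atTop hs).tendsto_div_nhds_zero.comp C.tendsto_q

/-- The denominators grow so fast that `n` is dominated by `log q_n`. -/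
theorem nat_le_log_q (n : ℕ) (hn : 2 ≤ n) : (n : ℝ) ≤ 2 * Real.log (C.q n) := by
  obtain ⟨n, rfl⟩ : ∃ k, n = k + 1 := ⟨n - 1, by omega⟩
  have hn1 : 1 ≤ n := by omega
  have h3 : 3 ≤ C.q n := by
    have h := C.le_q n hn1
    have : 1 ≤ n ^ 4 := Nat.one_le_pow _ _ hn1
    omega
  have h1 : 3 ^ (n + 1) ≤ C.q (n + 1) := by
    refine le_trans ?_ (C.growth n hn1)
    have h4 : n + 1 ≤ (d + 1) * n ^ 2 + 3 := by nlinarith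
    calc 3 ^ (n + 1) ≤ C.q n ^ (n + 1) := Nat.pow_le_pow_left h3 _
      _ ≤ C.q n ^ ((d + 1) * n ^ 2 + 3) := Nat.pow_le_pow_right (by omega) h4
      _ ≤ _ := Nat.le_mul_of_pos_left _ (by positivity)
  have h2 : ((n + 1 : ℕ) : ℝ) * Real.log 3 ≤ Real.log (C.q (n + 1)) := by
    rw [← Real.log_pow]
    exact Real.log_le_log (by positivity) (by exact_mod_cast h1)
  have h5 : (1 : ℝ) ≤ Real.log 3 := by
    rw [Real.le_log_iff_exp_le (by norm_num)]
    exact Real.exp_one_lt_three.le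
  have h6 : (0 : ℝ) ≤ ((n + 1 : ℕ) : ℝ) := by positivity
  nlinarith

theorem log_q_nonneg (n : ℕ) : 0 ≤ Real.log (C.q n) := Real.log_natCast_nonneg _

theorem tendsto_one_div_b : Tendsto (fun n => 1 / C.b n) atTop (𝓝 0) := by
  have h := (tendsto_const_div_atTop_nhds_zero_nat (2 : ℝ))
  refine squeeze_zero' ?_ ?_ h
  · filter_upwards [eventually_ge_atTop 1] with n hn
    exact one_div_nonneg.mpr (C.b_pos n hn).le
  · filter_upwards [eventually_ge_atTop 1] with n hn
    have hnR : (0 : ℝ) < n := by exact_mod_cast hn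
    have hq : (1 : ℝ) ≤ C.q n := by exact_mod_cast C.q_pos n hn
    have h1 := Real.one_le_rpow hq C.σ_pos.le
    have h2 := C.half_le_b n hn
    rw [div_le_div_iff₀ (C.b_pos n hn) hnR]
    nlinarith

theorem tendsto_log_mul_one_div_b :
    Tendsto (fun n => Real.log (C.q n) / n * (1 / C.b n)) atTop (𝓝 0) := by
  have h := (C.tendsto_log_q_div_rpow C.σ_pos).const_mul 2
  rw [mul_zero] at h
  refine squeeze_zero' ?_ ?_ h
  · filter_upwards [eventually_ge_atTop 1] with n hn
    have := C.b_pos n hn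
    have := C.log_q_nonneg n
    positivity
  · filter_upwards [eventually_ge_atTop 1] with n hn
    have hnR : (1 : ℝ) ≤ n := by exact_mod_cast hn
    have hq : (0 : ℝ) < C.q n := by exact_mod_cast C.q_pos n hn
    have h1 : 0 < (C.q n : ℝ) ^ C.σ := Real.rpow_pos_of_pos hq _
    have h2 := C.half_le_b n hn
    have h3 := C.log_q_nonneg n
    have h4 : (C.q n : ℝ) ^ C.σ / 2 ≤ n * C.b n := by
      have h5 : (C.q n : ℝ) ^ C.σ / 2 ≤ C.b n := by nlinarith
      nlinarith [C.b_pos n hn]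
    calc Real.log (C.q n) / n * (1 / C.b n) = Real.log (C.q n) / (n * C.b n) := by
          rw [div_mul_div_comm, mul_one]
      _ ≤ Real.log (C.q n) / ((C.q n : ℝ) ^ C.σ / 2) := by gcongr
      _ = _ := by rw [div_div_eq_mul_div]; ring

theorem b_div_q_le (n : ℕ) (hn : 1 ≤ n) :
    C.b n / C.q n ≤ n / (C.q n : ℝ) ^ (1 - C.σ) := by
  have hq : (0 : ℝ) < C.q n := by exact_mod_cast C.q_pos n hn
  rw [div_le_div_iff₀ hq (Real.rpow_pos_of_pos hq _)]
  calc C.b n * (C.q n : ℝ) ^ (1 - C.σ)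
      ≤ n * (C.q n : ℝ) ^ C.σ * (C.q n : ℝ) ^ (1 - C.σ) := by gcongr; exact C.b_le n
    _ = n * C.q n := by rw [mul_assoc, ← Real.rpow_add hq, add_sub_cancel, Real.rpow_one]

theorem tendsto_b_div_q : Tendsto (fun n => 8 * C.b n / C.q n) atTop (𝓝 0) := by
  have h := (C.tendsto_log_q_div_rpow (sub_pos.mpr C.σ_lt_one)).const_mul 16
  rw [mul_zero] at h
  refine squeeze_zero' ?_ ?_ h
  · filter_upwards [eventually_ge_atTop 1] with n hn
    have := C.b_pos n hn
    positivity
  · filter_upwards [eventually_ge_atTop 2] with n hn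
    have h1 := C.b_div_q_le n (by omega)
    have h2 : (n : ℝ) / (C.q n : ℝ) ^ (1 - C.σ) ≤
        2 * Real.log (C.q n) / (C.q n : ℝ) ^ (1 - C.σ) := by
      gcongr
      exact C.nat_le_log_q n hn
    calc 8 * C.b n / C.q n = 8 * (C.b n / C.q n) := by ring
      _ ≤ 8 * (2 * Real.log (C.q n) / (C.q n : ℝ) ^ (1 - C.σ)) := by linarith
      _ = _ := by ring

theorem tendsto_log_mul_b_div_q :
    Tendsto (fun n => Real.log (C.q n) / n * (8 * C.b n / C.q n)) atTop (𝓝 0) := by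
  have h := (C.tendsto_log_q_div_rpow (sub_pos.mpr C.σ_lt_one)).const_mul 8
  rw [mul_zero] at h
  refine squeeze_zero' ?_ ?_ h
  · filter_upwards [eventually_ge_atTop 1] with n hn
    have := C.b_pos n hn
    have := C.log_q_nonneg n
    positivity
  · filter_upwards [eventually_ge_atTop 1] with n hn
    have hnR : (0 : ℝ) < n := by exact_mod_cast hn
    have h3 := C.log_q_nonneg n
    calc Real.log (C.q n) / n * (8 * C.b n / C.q n)
        = 8 * (Real.log (C.q n) / n) * (C.b n / C.q n) := by ring
      _ ≤ 8 * (Real.log (C.q n) / n) * (n / (C.q n : ℝ) ^ (1 - C.σ)) := by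
        exact mul_le_mul_of_nonneg_left (C.b_div_q_le n hn) (by positivity)
      _ = _ := by field_simp

theorem tendsto_badBound (d : ℕ) : Tendsto (badBound d) atTop (𝓝 0) := by
  have h := (tendsto_const_div_atTop_nhds_zero_nat (4 + ((d : ℝ) + 1) * (d + 2)))
  refine squeeze_zero' (Eventually.of_forall fun n => by unfold badBound; positivity) ?_ h
  filter_upwards [eventually_ge_atTop 1] with n hn
  have hnR : (1 : ℝ) ≤ n := by exact_mod_cast hn
  have h1 : (n : ℝ) * (1 / (n : ℝ) ^ 4) ≤ 1 / n := by
    rw [mul_one_div, div_le_div_iff₀ (by positivity) (by positivity)]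
    nlinarith [pow_le_pow_right₀ hnR (show 2 ≤ 4 by norm_num)]
  calc badBound d n = 4 / n + ((d : ℝ) + 1) * (d + 2) * (n * (1 / (n : ℝ) ^ 4)) := by
        unfold badBound; ring
    _ ≤ 4 / n + ((d : ℝ) + 1) * (d + 2) * (1 / n) := by gcongr
    _ = _ := by ring

end ConjData

/-! ### The covering projection and the torus -/

theorem measurable_projIcc : Measurable (projIcc (0 : ℝ) 1 zero_le_one) :=
  continuous_projIcc.measurable

theorem measurePreserving_projIcc :
    MeasurePreserving (projIcc (0 : ℝ) 1 zero_le_one) (volume.restrict (Ico 0 1))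
      (volume : Measure unitInterval) := by
  refine ⟨measurable_projIcc, ?_⟩
  have h : MeasurePreserving ((↑) : unitInterval → ℝ) volume (volume.restrict (Icc 0 1)) :=
    measurePreserving_subtype_coe measurableSet_Icc
  rw [← Measure.restrict_congr_set Ico_ae_eq_Icc.symm, ← h.map_eq,
    Measure.map_map measurable_projIcc measurable_subtype_coe]
  have h1 : projIcc (0 : ℝ) 1 zero_le_one ∘ ((↑) : unitInterval → ℝ) = id :=
    funext fun x => projIcc_val _ x
  rw [h1, Measure.map_id]

theorem cell_eq_preimage :
    (cell 1 0 : Set (Coord d)) = MeasurableEquiv.piFinSuccAbove (fun _ => ℝ) 0 ⁻¹'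
      (Ico (0 : ℝ) 1 ×ˢ (Set.univ : Set (Fin (d + 1))).pi fun _ => Ico (0 : ℝ) 1) := by
  ext x
  rw [mem_cell_one_zero, Fin.forall_fin_succ]
  simp [MeasurableEquiv.piFinSuccAbove, Set.mem_pi, Fin.insertNthEquiv, Fin.tail]

/-- The manifold is, up to a null set, the half-open cube `[0,1)^m`. -/
theorem measurePreserving_proj :
    MeasurePreserving (proj : Coord d → Cyl d) (volume.restrict (cell 1 0)) volume := by
  have h1 := (volume_preserving_piFinSuccAbove (fun _ : Fin (d + 2) => ℝ) 0).restrict_preimage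
    (s := Ico (0 : ℝ) 1 ×ˢ (Set.univ : Set (Fin (d + 1))).pi fun _ => Ico (0 : ℝ) 1)
    (measurableSet_Ico.prod (MeasurableSet.univ_pi fun _ => measurableSet_Ico))
  rw [← cell_eq_preimage, Measure.volume_eq_prod, ← Measure.prod_restrict,
    volume_pi (ι := Fin (d + 1)), Measure.restrict_pi_pi] at h1
  have h2 : MeasurePreserving ((↑) : ℝ → UnitAddCircle) (volume.restrict (Ico 0 1)) volume := by
    have := UnitAddCircle.measurePreserving_mk 0
    rwa [zero_add, ← Measure.restrict_congr_set Ico_ae_eq_Ioc] at this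
  have h3 := measurePreserving_pi (fun _ : Fin (d + 1) => volume.restrict (Ico (0 : ℝ) 1))
    (fun _ => (volume : Measure unitInterval)) fun _ => measurePreserving_projIcc
  exact (h2.prod h3).comp h1

/-- The torus `(ℝ/ℤ)^m`.  As coordinate functions are compared modulo integers, distances of maps
make sense in this quotient of the universal cover, which identifies `r_i = 0` with `r_i = 1`. -/
abbrev Torus (d : ℕ) : Type := Fin (d + 2) → UnitAddCircle

/-- Reduction of all coordinates modulo integers. -/
def torus (x : Coord d) : Torus d := fun i => (x i : UnitAddCircle)

theorem continuous_torus : Continuous (torus : Coord d → Torus d) :=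
  continuous_pi fun i => (AddCircle.continuous_mk' 1).comp (continuous_apply i)

theorem torus_add_one (x : Coord d) : torus (x + Pi.single 0 1) = torus x := by
  ext i
  by_cases hi : i = 0
  · subst hi
    simp [torus]
  · simp [torus, hi]

theorem dist_coe_le (x y : ℝ) (p : ℤ) :
    dist (x : UnitAddCircle) (y : UnitAddCircle) ≤ |x - y + p| := by
  have h : (x : UnitAddCircle) - y = ((x - y + p : ℝ) : UnitAddCircle) := by
    have hp : ((p : ℝ) : UnitAddCircle) = 0 := by
      rw [AddCircle.coe_eq_zero_iff]
      exact ⟨p, by simp⟩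
    rw [AddCircle.coe_add, hp, add_zero, AddCircle.coe_sub]
  rw [dist_eq_norm, h]
  exact QuotientAddGroup.norm_mk_le_norm

theorem dist_torus_le (x y : Coord d) : dist (torus x) (torus y) ≤ ‖x - y‖ := by
  refine (dist_pi_le_iff (norm_nonneg _)).mpr fun i => ?_
  refine (dist_coe_le (x i) (y i) 0).trans ?_
  simpa using norm_le_pi_norm (x - y) i

theorem dist_torus_le_of_tildeDist0 {F G : Coord d → Coord d} {r : ℝ} (hr : 0 ≤ r)
    (h : tildeDist0 F G < ENNReal.ofReal r) {z : Coord d} (hz : z ∈ openCube d) :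
    dist (torus (F z)) (torus (G z)) ≤ r := by
  refine (dist_pi_le_iff hr).mpr fun i => ?_
  have h1 := (le_iSup (fun i => ⨅ p : ℤ, supNorm fun z => (F z i - G z i) + (p : ℝ)) i).trans_lt h
  obtain ⟨p, hp⟩ := iInf_lt_iff.mp h1
  refine (dist_coe_le _ _ p).trans ?_
  have h2 := (le_iSup₂ (f := fun z (_ : z ∈ openCube d) =>
    ENNReal.ofReal |(F z i - G z i) + (p : ℝ)|) z hz).trans hp.le
  exact (ENNReal.ofReal_le_ofReal_iff hr).mp h2

theorem tildeDist0_le_diffDist (k : ℕ) (F F' G G' : Coord d → Coord d) :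
    tildeDist0 F G ≤ diffDist k F F' G G' :=
  (le_max_left _ _).trans (le_max_left _ _)

theorem cell_subset_strip : (cell 1 0 : Set (Coord d)) ⊆ strip d := fun _ hx i =>
  Ico_subset_Icc_self (mem_cell_one_zero.mp hx i.succ)

theorem ae_mem_openCube : ∀ᵐ x ∂volume.restrict (cell 1 0 : Set (Coord d)), x ∈ openCube d := by
  rw [ae_restrict_iff' (measurableSet_cell 1 0)]
  have h : ∀ᵐ x : Coord d, ∀ i, x i ≠ 0 := by
    rw [ae_all_iff]
    exact fun i => Measure.ae_eval_ne (μ := fun _ : Fin (d + 2) => (volume : Measure ℝ)) i 0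
  filter_upwards [h] with x hx hc i
  have hci := mem_cell_one_zero.mp hc i
  exact ⟨hci.1.lt_of_ne' (hx i), hci.2⟩

/-- The map from the manifold to the torus that `torus` induces. -/
def cylTorus (y : Cyl d) : Torus d := Fin.cons y.1 fun i => ((y.2 i : ℝ) : UnitAddCircle)

theorem cylTorus_proj {x : Coord d} (hx : x ∈ strip d) : cylTorus (proj x) = torus x := by
  ext i
  refine Fin.cases ?_ (fun j => ?_) i
  · rfl
  · simp only [cylTorus, proj, torus, Fin.cons_succ]
    rw [projIcc_of_mem zero_le_one (hx j)]

theorem measurable_cylTorus : Measurable (cylTorus : Cyl d → Torus d) := by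
  refine measurable_pi_lambda _ fun i => ?_
  refine Fin.cases ?_ (fun j => ?_) i
  · exact measurable_fst
  · exact (AddCircle.continuous_mk' 1).measurable.comp
      (measurable_subtype_coe.comp ((measurable_pi_apply j).comp measurable_snd))

/-- The representative of a point of the manifold with angle in `[0,1)`. -/
def cylLift (y : Cyl d) : Coord d :=
  Fin.cons (AddCircle.equivIco 1 0 y.1 : ℝ) fun i => (y.2 i : ℝ)

theorem cylLift_mem_strip (y : Cyl d) : cylLift y ∈ strip d := fun i => (y.2 i).2

theorem measurable_equivIco : Measurable fun c : UnitAddCircle => (AddCircle.equivIco 1 0 c : ℝ) :=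
  measurable_subtype_coe.comp (AddCircle.measurableEquivIco 1 0).measurable

theorem measurable_cylLift : Measurable (cylLift : Cyl d → Coord d) := by
  refine measurable_pi_lambda _ fun i => ?_
  refine Fin.cases ?_ (fun j => ?_) i
  · exact measurable_equivIco.comp measurable_fst
  · exact measurable_subtype_coe.comp ((measurable_pi_apply j).comp measurable_snd)

theorem proj_cylLift (y : Cyl d) : proj (cylLift y) = y := by
  refine Prod.ext ?_ (funext fun i => ?_)
  · exact AddCircle.coe_equivIco
  · exact projIcc_val zero_le_one _

/-- A measurable left inverse of `cylTorus` off the points with `r_i = 1` for some `i`. -/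
def torusCyl (t : Torus d) : Cyl d :=
  (t 0, fun i => projIcc (0 : ℝ) 1 zero_le_one (AddCircle.equivIco 1 0 (t i.succ) : ℝ))

theorem measurable_torusCyl : Measurable (torusCyl : Torus d → Cyl d) :=
  (measurable_pi_apply 0).prodMk (measurable_pi_lambda _ fun i =>
    measurable_projIcc.comp (measurable_equivIco.comp (measurable_pi_apply i.succ)))

theorem torusCyl_cylTorus {y : Cyl d} (hy : ∀ i : Fin (d + 1), cylTorus y i.succ ≠ 0) :
    torusCyl (cylTorus y) = y := by
  refine Prod.ext rfl (funext fun i => ?_)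
  have h1 : (y.2 i : ℝ) < 1 := by
    refine (y.2 i).2.2.lt_of_ne fun h => hy i ?_
    simp only [cylTorus, Fin.cons_succ]
    rw [h]
    simp
  simp only [torusCyl, cylTorus, Fin.cons_succ]
  rw [AddCircle.equivIco_coe_of_mem (by simpa using ⟨(y.2 i).2.1, h1⟩)]
  exact projIcc_val _ _

/-- The points of the torus with a vanishing radial coordinate. -/
def radialZero (d : ℕ) : Set (Torus d) := {t | ∃ i : Fin (d + 1), t i.succ = 0}

theorem measurableSet_radialZero : MeasurableSet (radialZero d) := by
  have : radialZero d = ⋃ i : Fin (d + 1), {t | t i.succ = 0} := by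
    ext t; simp [radialZero]
  rw [this]
  exact MeasurableSet.iUnion fun i => (measurable_pi_apply i.succ) (measurableSet_singleton 0)

theorem map_cylTorus_radialZero :
    (volume : Measure (Cyl d)).map cylTorus (radialZero d) = 0 := by
  rw [← measurePreserving_proj.map_eq,
    Measure.map_map measurable_cylTorus measurePreserving_proj.measurable,
    Measure.map_apply (measurable_cylTorus.comp measurePreserving_proj.measurable)
      measurableSet_radialZero]
  have h : ∀ᵐ x ∂volume.restrict (cell 1 0 : Set (Coord d)),
      x ∉ cylTorus ∘ proj ⁻¹' radialZero d := by
    filter_upwards [ae_mem_openCube, ae_restrict_mem (measurableSet_cell 1 0)] with x hx hc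
    rintro ⟨i, hi⟩
    rw [Function.comp_apply, cylTorus_proj (cell_subset_strip hc), torus] at hi
    have h1 := hx i.succ
    obtain ⟨k, hk⟩ := (AddCircle.coe_eq_zero_iff (p := (1 : ℝ))).mp hi
    simp only [zsmul_eq_mul, mul_one] at hk
    rw [← hk] at h1
    have h2 : (0 : ℤ) < k := by exact_mod_cast h1.1
    have h3 : k < 1 := by exact_mod_cast h1.2
    omega
  exact measure_eq_zero_iff_ae_notMem.mpr h

theorem ae_torusCyl_cylTorus {ρ : Measure (Cyl d)} (hρ : ρ.map cylTorus (radialZero d) = 0) :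
    ∀ᵐ y ∂ρ, torusCyl (cylTorus y) = y := by
  rw [Measure.map_apply measurable_cylTorus measurableSet_radialZero] at hρ
  filter_upwards [measure_eq_zero_iff_ae_notMem.mp hρ] with y hy
  exact torusCyl_cylTorus fun i hi => hy ⟨i, hi⟩

/-- A measure on the manifold with the same image on the torus as the volume is the volume. -/
theorem eq_volume_of_map_cylTorus {ν : Measure (Cyl d)}
    (h : ν.map cylTorus = (volume : Measure (Cyl d)).map cylTorus) : ν = volume := by
  have key : ∀ ρ : Measure (Cyl d), ρ.map cylTorus (radialZero d) = 0 →
      (ρ.map cylTorus).map torusCyl = ρ := by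
    intro ρ hρ
    rw [Measure.map_map measurable_torusCyl measurable_cylTorus]
    conv_rhs => rw [← Measure.map_id (μ := ρ)]
    exact Measure.map_congr (ae_torusCyl_cylTorus hρ)
  rw [← key ν (by rw [h, map_cylTorus_radialZero]), h, key _ map_cylTorus_radialZero]

/-! ### Decay of correlations -/

theorem Admissible.inv {P : Equiv.Perm (Coord d)} (hP : Admissible P) : Admissible P⁻¹ where
  measurePreserving := measurePreserving_symm hP.measurePreserving
  mem_iff x := by
    rw [← hP.mem_iff, ← Equiv.Perm.mul_apply, mul_inv_cancel, Equiv.Perm.one_apply]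
  add_one x := by
    apply P.injective
    rw [hP.add_one]
    simp only [← Equiv.Perm.mul_apply, mul_inv_cancel, Equiv.Perm.one_apply]

theorem rot_pow (α : ℝ) (t : ℕ) : (rot α : Equiv.Perm (Coord d)) ^ t = rot (t * α) := by
  induction t with
  | zero => ext x; simp [rot]
  | succ t ih =>
    ext x : 1
    rw [pow_succ, ih, Equiv.Perm.mul_apply]
    change x + Pi.single 0 α + Pi.single 0 (t * α) = x + Pi.single 0 (((t + 1 : ℕ) : ℝ) * α)
    rw [add_assoc, ← Pi.single_add]
    push_cast
    ring_nf

theorem exists_norm_le_of_continuous {X : Torus d → ℂ} (hX : Continuous X) :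
    ∃ M : ℝ, ∀ t, ‖X t‖ ≤ M := by
  obtain ⟨M, hM⟩ := isCompact_univ.exists_bound_of_continuousOn hX.continuousOn
  exact ⟨M, fun t => hM t (mem_univ t)⟩

namespace ConjData

variable (C : ConjData d)

theorem H_eq (n : ℕ) (hn : 1 ≤ n) : C.H n = C.H (n - 1) * (C.g n hn * C.phi n hn) := by
  obtain ⟨n, rfl⟩ := Nat.exists_eq_add_of_le' hn
  rfl

theorem f_pow (n t : ℕ) :
    C.f n ^ t = C.H n * AbC.rot (t * C.α (n + 1)) * (C.H n)⁻¹ := by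
  rw [f, conj_pow, rot_pow]

theorem admissible_f_pow (n t : ℕ) : Admissible (C.f n ^ t) := by
  rw [f_pow]
  exact ((C.admissible_H n).mul (Admissible.rot _)).mul (C.admissible_H n).inv

/-- As `H_{n-1}` has Lipschitz constant of order `log q_n / n`, a continuous function composed with it
oscillates little at the scale `r n`. -/
theorem eventually_osc_le
    (hderiv : ∀ n : ℕ, 1 ≤ n → supNormD (C.H (n - 1)) ≤ ENNReal.ofReal (Real.log (C.q n) / n))
    {r : ℕ → ℝ} (hr : Tendsto (fun n => Real.log (C.q n) / n * r n) atTop (𝓝 0))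
    {X : Torus d → ℂ} (hX : Continuous X) {η : ℝ} (hη : 0 < η) :
    ∀ᶠ n in atTop, ∀ x ∈ halfStrip d, ∀ y ∈ halfStrip d, |x 0 - y 0| ≤ 1 → ‖x - y‖ ≤ r n →
      ‖X (torus (C.H (n - 1) x)) - X (torus (C.H (n - 1) y))‖ ≤ η := by
  obtain ⟨δ, hδ, hXδ⟩ := Metric.uniformContinuous_iff.mp
    (CompactSpace.uniformContinuous_of_continuous hX) η hη
  have h1 := hr.const_mul (2 * ((d : ℝ) + 2))
  rw [mul_zero] at h1
  filter_upwards [h1.eventually_lt_const hδ, eventually_ge_atTop 1] with n hn hn1 x hx y hy h01 hxy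
  have hK : 0 ≤ Real.log (C.q n) / n := div_nonneg (C.log_q_nonneg n) (Nat.cast_nonneg n)
  have h2 := norm_sub_le_of_strip (C.differentiable_H (n - 1)) (C.admissible_H (n - 1)).add_one hK
    (hderiv n hn1) hx hy h01
  rw [← dist_eq_norm]
  refine (hXδ ((dist_torus_le _ _).trans_lt (h2.trans_lt (lt_of_le_of_lt ?_ hn)))).le
  calc 2 * (((d : ℝ) + 2) * (Real.log (C.q n) / n)) * ‖x - y‖
      ≤ 2 * (((d : ℝ) + 2) * (Real.log (C.q n) / n)) * r n := by gcongr
    _ = _ := by ring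

/-- Along the times `m_n`, the maps `f_n` decorrelate continuous functions on the torus. -/
theorem tendsto_correlation_f
    (hderiv : ∀ n : ℕ, 1 ≤ n → supNormD (C.H (n - 1)) ≤ ENNReal.ofReal (Real.log (C.q n) / n))
    {X Y : Torus d → ℂ} (hX : Continuous X) (hY : Continuous Y)
    (h0 : ∫ x in (cell 1 0 : Set (Coord d)), X (torus x) = 0) :
    Tendsto (fun n => ∫ x in (cell 1 0 : Set (Coord d)),
      X (torus ((C.f n ^ C.mTime n) x)) * Y (torus x)) atTop (𝓝 0) := by
  obtain ⟨M₁, hM₁⟩ := exists_norm_le_of_continuous hX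
  obtain ⟨M₂, hM₂⟩ := exists_norm_le_of_continuous hY
  obtain ⟨M, hM, hXM, hYM⟩ : ∃ M : ℝ, 0 < M ∧ (∀ t, ‖X t‖ ≤ M) ∧ ∀ t, ‖Y t‖ ≤ M :=
    ⟨max 1 (max M₁ M₂), by positivity, fun t => (hM₁ t).trans (by simp),
      fun t => (hM₂ t).trans (by simp)⟩
  rw [tendsto_zero_iff_norm_tendsto_zero]
  refine (tendsto_order.mpr ⟨fun a ha => Eventually.of_forall fun n =>
    ha.trans_le (norm_nonneg _), fun ε hε => ?_⟩)
  -- the terms of the correlation bound that contain `η` add up to `2 * M * η = ε / 2`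
  set η := ε / (4 * M) with hη
  have hη0 : 0 < η := by positivity
  have hB : Tendsto (fun n : ℕ => (M * (η + 4 * M * (1 / C.b n) + 2 * M * (1 / n)) + M * η) +
      2 * M ^ 2 * badBound d n) atTop
      (𝓝 ((M * (η + 4 * M * 0 + 2 * M * 0) + M * η) + 2 * M ^ 2 * 0)) := by
    have h1 := C.tendsto_one_div_b.const_mul (4 * M)
    have h2 := tendsto_one_div_atTop_nhds_zero_nat (𝕜 := ℝ) |>.const_mul (2 * M)
    have h3 := (tendsto_badBound d).const_mul (2 * M ^ 2)
    exact ((((h1.const_add η).add h2).const_mul M).add_const (M * η)).add h3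
  have hlt : (M * (η + 4 * M * 0 + 2 * M * 0) + M * η) + 2 * M ^ 2 * 0 < ε := by
    have : (M * (η + 4 * M * 0 + 2 * M * 0) + M * η) + 2 * M ^ 2 * 0 = ε / 2 := by
      rw [hη]
      field_simp
      ring
    rw [this]
    exact half_lt_self hε
  filter_upwards [hB.eventually_lt_const hlt, eventually_ge_atTop 1,
    C.eventually_osc_le hderiv C.tendsto_log_mul_one_div_b hX hη0,
    C.eventually_osc_le hderiv C.tendsto_log_mul_b_div_q hY hη0,
    C.tendsto_b_div_q.eventually_le_const one_pos] with n hn hn1 hXη hYη h8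
  refine lt_of_le_of_lt ?_ hn
  set P := C.H (n - 1) with hP
  have hPa : Admissible P := C.admissible_H (n - 1)
  set t := (C.mTime n : ℝ) * C.α (n + 1) with ht
  -- substitution of `H_n x` for `x` turns the power of `f_n` into a rotation
  have hsubst : ∫ x in (cell 1 0 : Set (Coord d)),
        X (torus ((C.f n ^ C.mTime n) x)) * Y (torus x) =
      ∫ x in (cell 1 0 : Set (Coord d)),
        X (torus (P (C.g n hn1 (C.phi n hn1 (x + Pi.single 0 t))))) *
          Y (torus (P (C.g n hn1 (C.phi n hn1 x)))) := by
    rw [← (C.admissible_H n).setIntegral_comp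
      (fun x => X (torus ((C.f n ^ C.mTime n) x)) * Y (torus x)) fun x => by
        rw [(C.admissible_f_pow n _).add_one, torus_add_one, torus_add_one]]
    refine integral_congr_ae (Eventually.of_forall fun x => ?_)
    have e1 : (C.f n ^ C.mTime n) (C.H n x) = C.H n (x + Pi.single 0 t) := by
      rw [f_pow, ← Equiv.Perm.mul_apply, inv_mul_cancel_right, Equiv.Perm.mul_apply]
      rfl
    have e2 : ∀ y, C.H n y = P (C.g n hn1 (C.phi n hn1 y)) := fun y => by
      rw [C.H_eq n hn1, Equiv.Perm.mul_apply, Equiv.Perm.mul_apply]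
    dsimp only
    rw [e1, e2, e2]
  rw [hsubst]
  have hXc : Measurable fun x => X (torus (P x)) :=
    (hX.comp continuous_torus).measurable.comp hPa.measurePreserving.measurable
  have hYc : Measurable fun x => Y (torus (P x)) :=
    (hY.comp continuous_torus).measurable.comp hPa.measurePreserving.measurable
  obtain ⟨k', hk'⟩ := C.exists_mTime n hn1
  have hper : ∀ x, X (torus (P (x + Pi.single 0 1))) = X (torus (P x)) := fun x => by
    rw [hPa.add_one, torus_add_one]
  have h0' : ∫ x in cell 1 0, X (torus (P x)) = 0 := by
    rw [hPa.setIntegral_comp (fun x => X (torus x)) fun x => by rw [torus_add_one], h0]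
  have := C.norm_setIntegral_correlation_le n hn1 hXc hYc (fun x => hXM _) (fun x => hYM _) hper
    hXη hYη h8 h0' hk' (fun k _ hk => C.mul_aFreq_le n k hn1 hk) (by positivity)
  rw [mul_one_div (4 * M)]
  exact this

end ConjData

/-! ### Transfer to the limit diffeomorphism -/

theorem measureReal_cell_one : volume.real (cell 1 0 : Set (Coord d)) = 1 := by
  simpa using measureReal_cell (d := d) one_pos 0

/-- Maps that are uniformly close on the torus have close correlations. -/
theorem tendsto_setIntegral_sub {u v : ℕ → Coord d → Torus d}
    (huv : ∀ δ > 0, ∀ᶠ n in atTop, ∀ z ∈ openCube d, dist (u n z) (v n z) ≤ δ)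
    (hu : ∀ n, AEMeasurable (u n) (volume.restrict (cell 1 0)))
    (hv : ∀ n, AEMeasurable (v n) (volume.restrict (cell 1 0)))
    {X Y : Torus d → ℂ} (hX : Continuous X) (hY : Continuous Y) :
    Tendsto (fun n => (∫ x in (cell 1 0 : Set (Coord d)), X (u n x) * Y (torus x)) -
      ∫ x in (cell 1 0 : Set (Coord d)), X (v n x) * Y (torus x)) atTop (𝓝 0) := by
  have : NeZero 1 := ⟨one_ne_zero⟩
  obtain ⟨M₁, hM₁⟩ := exists_norm_le_of_continuous hX
  obtain ⟨M₂, hM₂⟩ := exists_norm_le_of_continuous hY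
  have hM₁0 : 0 ≤ M₁ := (norm_nonneg _).trans (hM₁ 0)
  have hM₂0 : 0 ≤ M₂ := (norm_nonneg _).trans (hM₂ 0)
  have hint : ∀ w : Coord d → Torus d, AEMeasurable w (volume.restrict (cell 1 0)) →
      Integrable (fun x => X (w x) * Y (torus x)) (volume.restrict (cell 1 0)) := by
    intro w hw
    refine Integrable.of_bound ((hX.measurable.comp_aemeasurable hw).mul
      (hY.comp continuous_torus).measurable.aemeasurable).aestronglyMeasurable (M₁ * M₂)
      (Eventually.of_forall fun x => ?_)
    rw [norm_mul]
    exact mul_le_mul (hM₁ _) (hM₂ _) (norm_nonneg _) hM₁0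
  refine Metric.tendsto_atTop'.mpr fun ε hε => ?_
  obtain ⟨δ, hδ, hXδ⟩ := Metric.uniformContinuous_iff.mp
    (CompactSpace.uniformContinuous_of_continuous hX) (ε / (M₂ + 1)) (by positivity)
  obtain ⟨N, hN⟩ := eventually_atTop.mp (huv (δ / 2) (half_pos hδ))
  refine ⟨N, fun n hn => ?_⟩
  rw [dist_zero_right, ← integral_sub (hint _ (hu n)) (hint _ (hv n))]
  have h1 : ∀ᵐ x ∂volume.restrict (cell 1 0 : Set (Coord d)),
      ‖X (u n x) * Y (torus x) - X (v n x) * Y (torus x)‖ ≤ ε / (M₂ + 1) * M₂ := by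
    filter_upwards [ae_mem_openCube] with x hx
    rw [← sub_mul, norm_mul]
    refine mul_le_mul ?_ (hM₂ _) (norm_nonneg _) (by positivity)
    rw [← dist_eq_norm]
    exact (hXδ ((hN n hn.le x hx).trans_lt (half_lt_self hδ))).le
  refine (norm_integral_le_of_norm_le_const h1).trans_lt ?_
  rw [measureReal_restrict_apply_univ, measureReal_cell_one, mul_one, div_mul_eq_mul_div,
    div_lt_iff₀ (by positivity)]
  nlinarith

namespace CylDiffeo

variable (f : CylDiffeo d)

theorem continuousOn_iterate_lift (m : ℕ) : ContinuousOn f.lift^[m] (strip d) :=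
  f.contDiffOn_lift.continuousOn.iterate f.mapsTo_lift m

theorem proj_iterate_lift (m : ℕ) {x : Coord d} (hx : x ∈ strip d) :
    proj (f.lift^[m] x) = f.toEquiv^[m] (proj x) := by
  induction m with
  | zero => rfl
  | succ m ih =>
    rw [Function.iterate_succ_apply', Function.iterate_succ_apply', ← ih,
      f.proj_lift _ (f.mapsTo_lift.iterate m hx)]

theorem aemeasurable_torus_lift (m : ℕ) :
    AEMeasurable (fun x => torus (f.lift^[m] x)) (volume.restrict (cell 1 0)) := by
  refine continuous_torus.measurable.comp_aemeasurable ?_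
  exact ((f.continuousOn_iterate_lift m).mono cell_subset_strip).aemeasurable
    (measurableSet_cell 1 0)

theorem measurable_toEquiv : Measurable f.toEquiv := by
  have h1 : Measurable ((strip d).domRestrict f.lift) :=
    (continuousOn_iff_continuous_domRestrict.mp f.contDiffOn_lift.continuousOn).measurable
  have h2 : Measurable fun y : Cyl d => (⟨cylLift y, cylLift_mem_strip y⟩ : strip d) :=
    measurable_cylLift.subtype_mk
  have h3 : (f.toEquiv : Cyl d → Cyl d) = fun y =>
      proj ((strip d).domRestrict f.lift ⟨cylLift y, cylLift_mem_strip y⟩) := by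
    funext y
    rw [Set.domRestrict_apply, f.proj_lift _ (cylLift_mem_strip y), proj_cylLift]
  rw [h3]
  exact measurePreserving_proj.measurable.comp (h1.comp h2)

/-- Correlations on the manifold, expressed by the coordinate functions. -/
theorem integral_cyl_eq {X Y : Torus d → ℂ} (hX : Continuous X) (hY : Continuous Y) (m : ℕ) :
    ∫ y : Cyl d, X (cylTorus (f.toEquiv^[m] y)) * Y (cylTorus y) =
      ∫ x in (cell 1 0 : Set (Coord d)), X (torus (f.lift^[m] x)) * Y (torus x) := by
  have hm : Measurable fun y : Cyl d => X (cylTorus (f.toEquiv^[m] y)) * Y (cylTorus y) :=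
    (hX.measurable.comp (measurable_cylTorus.comp (f.measurable_toEquiv.iterate m))).mul
      (hY.measurable.comp measurable_cylTorus)
  rw [← measurePreserving_proj.map_eq, integral_map measurePreserving_proj.aemeasurable
    hm.aestronglyMeasurable]
  refine setIntegral_congr_fun (measurableSet_cell 1 0) fun x hx => ?_
  have hx' := cell_subset_strip hx
  rw [cylTorus_proj hx', ← f.proj_iterate_lift m hx',
    cylTorus_proj (f.mapsTo_lift.iterate m hx')]

theorem tendsto_correlation (C : ConjData d)
    (hdist : ∀ n : ℕ, 1 ≤ n →
      diffDist 0 (f.lift^[C.mTime n]) (f.liftInv^[C.mTime n])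
        (C.f n ^ C.mTime n : Equiv.Perm (Coord d)) (C.f n ^ C.mTime n : Equiv.Perm (Coord d)).symm
          < ENNReal.ofReal (1 / 2 ^ n))
    (hderiv : ∀ n : ℕ, 1 ≤ n → supNormD (C.H (n - 1)) ≤ ENNReal.ofReal (Real.log (C.q n) / n))
    {X Y : Torus d → ℂ} (hX : Continuous X) (hY : Continuous Y)
    (h0 : ∫ y : Cyl d, X (cylTorus y) = 0) :
    Tendsto (fun n => ∫ y : Cyl d, X (cylTorus (f.toEquiv^[C.mTime n] y)) * Y (cylTorus y))
      atTop (𝓝 0) := by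
  have h0' : ∫ x in (cell 1 0 : Set (Coord d)), X (torus x) = 0 := by
    have := f.integral_cyl_eq hX continuous_const (Y := fun _ => 1) 0
    simpa [h0] using this.symm
  simp_rw [f.integral_cyl_eq hX hY]
  have h1 := C.tendsto_correlation_f hderiv hX hY h0'
  have h2 := tendsto_setIntegral_sub (u := fun n x => torus (f.lift^[C.mTime n] x))
    (v := fun n x => torus ((C.f n ^ C.mTime n) x)) ?_
    (fun n => f.aemeasurable_torus_lift _) (fun n => (continuous_torus.measurable.comp
      (C.admissible_f_pow n _).measurePreserving.measurable).aemeasurable) hX hY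
  · simpa using h2.add h1
  · intro δ hδ
    have h3 : Tendsto (fun n : ℕ => (1 : ℝ) / 2 ^ n) atTop (𝓝 0) := by
      simpa using tendsto_pow_atTop_nhds_zero_of_lt_one (r := (1 / 2 : ℝ)) (by norm_num)
        (by norm_num)
    filter_upwards [h3.eventually_le_const hδ, eventually_ge_atTop 1] with n hn hn1 z hz
    exact (dist_torus_le_of_tildeDist0 (by positivity)
      ((tildeDist0_le_diffDist _ _ _ _ _).trans_lt (hdist n hn1)) hz).trans hn

theorem measurePreserving_toEquiv (C : ConjData d)
    (hlim : ∀ k : ℕ, Tendsto (fun n : ℕ => diffDist k (C.f n) (C.f n).symm f.lift f.liftInv)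
      atTop (𝓝 0)) :
    MeasurePreserving f.toEquiv (volume : Measure (Cyl d)) volume := by
  refine ⟨f.measurable_toEquiv, eq_volume_of_map_cylTorus ?_⟩
  rw [Measure.map_map measurable_cylTorus f.measurable_toEquiv]
  have : IsFiniteMeasure ((volume : Measure (Cyl d)).map (cylTorus ∘ f.toEquiv)) :=
    Measure.isFiniteMeasure_map _ _
  have : IsFiniteMeasure ((volume : Measure (Cyl d)).map cylTorus) :=
    Measure.isFiniteMeasure_map _ _
  refine ext_of_forall_integral_eq_of_IsFiniteMeasure fun φ => ?_
  rw [integral_map (measurable_cylTorus.comp f.measurable_toEquiv).aemeasurable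
    φ.continuous.aestronglyMeasurable, integral_map measurable_cylTorus.aemeasurable
    φ.continuous.aestronglyMeasurable]
  have hX : Continuous fun t : Torus d => (φ t : ℂ) := Complex.continuous_ofReal.comp φ.continuous
  have hn : ∀ n, ∫ x in (cell 1 0 : Set (Coord d)), (φ (torus (C.f n x)) : ℂ) * 1 =
      ∫ x in (cell 1 0 : Set (Coord d)), (φ (torus x) : ℂ) * 1 := fun n => by
    have := C.admissible_f_pow n 1
    rw [pow_one] at this
    exact this.setIntegral_comp (fun x => (φ (torus x) : ℂ) * 1) fun x => by rw [torus_add_one]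
  have h2 := tendsto_setIntegral_sub (u := fun n x => torus (C.f n x))
    (v := fun n x => torus (f.lift x)) ?_ (fun n => ?_)
    (fun n => f.aemeasurable_torus_lift 1) hX continuous_const (Y := fun _ => 1)
  · simp_rw [hn] at h2
    have h3 := sub_eq_zero.mp (tendsto_nhds_unique tendsto_const_nhds h2)
    have h4 := f.integral_cyl_eq hX continuous_const (Y := fun _ => 1) 0
    have h5 := f.integral_cyl_eq hX continuous_const (Y := fun _ => 1) 1
    rw [Function.iterate_one, Function.iterate_one, ← h3] at h5
    rw [Function.iterate_zero, Function.iterate_zero] at h4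
    have h6 := h5.trans h4.symm
    simp only [mul_one, id_eq] at h6
    rw [integral_complex_ofReal, integral_complex_ofReal] at h6
    exact Complex.ofReal_injective h6
  · intro δ hδ
    filter_upwards [(hlim 0).eventually_lt_const (ENNReal.ofReal_pos.mpr hδ)] with n hn z hz
    exact dist_torus_le_of_tildeDist0 hδ.le ((tildeDist0_le_diffDist _ _ _ _ _).trans_lt hn) hz
  · have := C.admissible_f_pow n 1
    rw [pow_one] at this
    exact (continuous_torus.measurable.comp this.measurePreserving.measurable).aemeasurable

end CylDiffeo

/-! ### Eigenfunctions -/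

section Eigenfunction

variable {Ω : Type*} [MeasurableSpace Ω] {μ : Measure Ω} {T : Ω → Ω}

theorem iterate_eigenfunction (hT : MeasurePreserving T μ μ) {u : Ω → ℂ} {c : ℂ}
    (hu : ∀ᵐ x ∂μ, u (T x) = c * u x) (m : ℕ) : ∀ᵐ x ∂μ, u (T^[m] x) = c ^ m * u x := by
  induction m with
  | zero => simp
  | succ m ih =>
    filter_upwards [hT.quasiMeasurePreserving.ae ih, hu] with x h1 h2
    rw [Function.iterate_succ_apply, h1, h2, pow_succ, mul_assoc]

/-- The eigenvalue of an eigenfunction that does not vanish almost everywhere has modulus one, since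
a bounded strictly increasing function of the modulus has an invariant integral. -/
theorem norm_eq_one_or_ae_eq_zero [IsFiniteMeasure μ] (hT : MeasurePreserving T μ μ) {h : Ω → ℂ}
    (hm : Measurable h) {c : ℂ} (hc : ∀ᵐ x ∂μ, h (T x) = c * h x) :
    ‖c‖ = 1 ∨ ∀ᵐ x ∂μ, h x = 0 := by
  set w : Ω → ℝ := fun x => ‖h x‖ / (1 + ‖h x‖) with hw
  have hwm : Measurable w := hm.norm.div (hm.norm.const_add 1)
  have hwi : Integrable w μ := by
    refine Integrable.of_bound hwm.aestronglyMeasurable 1 (Eventually.of_forall fun x => ?_)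
    have h0 := norm_nonneg (h x)
    rw [Real.norm_of_nonneg (by positivity), div_le_one (by positivity)]
    linarith
  have hwT : Integrable (fun x => w (T x)) μ := hT.integrable_comp_of_integrable hwi
  have hint : ∫ x, w (T x) ∂μ = ∫ x, w x ∂μ := by
    rw [← integral_map hT.aemeasurable (by rw [hT.map_eq]; exact hwm.aestronglyMeasurable),
      hT.map_eq]
  have hmono : ∀ a b : ℝ, 0 ≤ a → a ≤ b → a / (1 + a) ≤ b / (1 + b) := fun a b ha hab => by
    rw [div_le_div_iff₀ (by positivity) (by linarith)]
    nlinarith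
  have heq : ∀ᵐ x ∂μ, w (T x) = w x := by
    rcases le_total ‖c‖ 1 with h1 | h1
    · have hle : (fun x => w (T x)) ≤ᵐ[μ] w := by
        filter_upwards [hc] with x hx
        simp only [hw, hx, norm_mul]
        exact hmono _ _ (by positivity) (mul_le_of_le_one_left (norm_nonneg _) h1)
      exact (integral_eq_iff_of_ae_le hwT hwi hle).mp hint
    · have hle : w ≤ᵐ[μ] fun x => w (T x) := by
        filter_upwards [hc] with x hx
        simp only [hw, hx, norm_mul]
        exact hmono _ _ (norm_nonneg _) (le_mul_of_one_le_left (norm_nonneg _) h1)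
      exact ((integral_eq_iff_of_ae_le hwi hwT hle).mp hint.symm).symm
  by_cases hc1 : ‖c‖ = 1
  · exact Or.inl hc1
  · right
    filter_upwards [heq, hc] with x h1 h2
    simp only [hw, h2, norm_mul] at h1
    rw [div_eq_div_iff (by positivity) (by positivity)] at h1
    have h3 : (‖c‖ - 1) * ‖h x‖ = 0 := by linarith
    rcases mul_eq_zero.mp h3 with h4 | h4
    · exact absurd (sub_eq_zero.mp h4) hc1
    · exact norm_eq_zero.mp h4

/-- To find all eigenfunctions it suffices to consider the bounded ones of mean zero, with an
eigenvalue of modulus one. -/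
theorem weaklyMixing_of_bounded [IsProbabilityMeasure μ] (hT : MeasurePreserving T μ μ)
    (H : ∀ (u : Ω → ℂ) (c : ℂ) (M : ℝ), Measurable u → (∀ x, ‖u x‖ ≤ M) → ∫ x, u x ∂μ = 0 →
      ‖c‖ = 1 → (∀ᵐ x ∂μ, u (T x) = c * u x) → ∀ᵐ x ∂μ, u x = 0) : WeaklyMixing μ T := by
  refine ⟨hT, fun h c hm hc => ?_⟩
  rcases norm_eq_one_or_ae_eq_zero hT hm hc with hc1 | h0
  swap
  · exact ⟨0, h0⟩
  -- the bounded eigenfunction `u` determines `h`, as `h = u / (1 - ‖u‖)`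
  set u : Ω → ℂ := fun x => h x / ((1 + ‖h x‖ : ℝ) : ℂ) with hu
  have hum : Measurable u := hm.div (Complex.measurable_ofReal.comp (hm.norm.const_add 1))
  have hun : ∀ x, ‖u x‖ = ‖h x‖ / (1 + ‖h x‖) := fun x => by
    have h0 := norm_nonneg (h x)
    simp only [hu, norm_div]
    rw [Complex.norm_of_nonneg (by positivity)]
  have hu1 : ∀ x, ‖u x‖ ≤ 1 := fun x => by
    have h0 := norm_nonneg (h x)
    rw [hun, div_le_one (by positivity)]
    linarith
  have hui : Integrable u μ :=
    Integrable.of_bound hum.aestronglyMeasurable 1 (Eventually.of_forall hu1)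
  have huT : ∀ᵐ x ∂μ, u (T x) = c * u x := by
    filter_upwards [hc] with x hx
    simp only [hu, hx, norm_mul, hc1, one_mul, mul_div_assoc]
  set a := ∫ x, u x ∂μ with ha
  have hca : c * a = a := by
    rw [ha, ← integral_const_mul, ← integral_congr_ae huT,
      ← integral_map hT.aemeasurable (by rw [hT.map_eq]; exact hum.aestronglyMeasurable), hT.map_eq]
  have h0 := H (fun x => u x - a) c (1 + ‖a‖) (hum.sub_const a)
    (fun x => (norm_sub_le _ _).trans (by gcongr; exact hu1 x))
    (by rw [integral_sub hui (integrable_const a)]; simp [ha]) hc1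
    (by filter_upwards [huT] with x hx; rw [hx, mul_sub, hca])
  refine ⟨a / ((1 - ‖a‖ : ℝ) : ℂ), ?_⟩
  filter_upwards [h0] with x hx
  rw [← sub_eq_zero.mp hx]
  have h2 := norm_nonneg (h x)
  have h3 : (1 - ‖u x‖ : ℝ) = (1 + ‖h x‖)⁻¹ := by
    rw [hun]
    field_simp
    ring
  rw [h3, hu]
  have h4 : ((1 + ‖h x‖ : ℝ) : ℂ) ≠ 0 := by
    rw [Complex.ofReal_ne_zero]
    positivity
  rw [Complex.ofReal_inv, div_inv_eq_mul, div_mul_cancel₀ _ h4]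

end Eigenfunction

instance isProbabilityMeasure_cyl : IsProbabilityMeasure (volume : Measure (Cyl d)) := by
  refine ⟨?_⟩
  rw [← measurePreserving_proj.measure_preimage MeasurableSet.univ.nullMeasurableSet,
    preimage_univ, Measure.restrict_apply_univ, volume_cell one_pos]
  simp

theorem exists_continuous_integral_sub_le {u : Cyl d → ℂ} (hum : Measurable u) {M : ℝ}
    (hM : ∀ y, ‖u y‖ ≤ M) {ε : ℝ} (hε : 0 < ε) :
    ∃ X : Torus d → ℂ, Continuous X ∧ ∫ y : Cyl d, ‖u y - X (cylTorus y)‖ ≤ ε := by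
  have : IsFiniteMeasure ((volume : Measure (Cyl d)).map cylTorus) :=
    Measure.isFiniteMeasure_map _ _
  have hi : Integrable (fun t => u (torusCyl t)) ((volume : Measure (Cyl d)).map cylTorus) :=
    Integrable.of_bound (hum.comp measurable_torusCyl).aestronglyMeasurable M
      (Eventually.of_forall fun t => hM _)
  obtain ⟨X, hX, -⟩ := hi.exists_boundedContinuous_integral_sub_le hε
  refine ⟨X, X.continuous, ?_⟩
  have hXm : Measurable fun t => ‖u (torusCyl t) - X t‖ :=
    ((hum.comp measurable_torusCyl).sub X.continuous.measurable).norm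
  rw [integral_map measurable_cylTorus.aemeasurable hXm.aestronglyMeasurable] at hX
  refine le_trans (le_of_eq (integral_congr_ae ?_)) hX
  filter_upwards [ae_torusCyl_cylTorus map_cylTorus_radialZero] with y hy
  rw [hy]

/-- If continuous functions on the torus decorrelate along some times, then every bounded
eigenfunction of mean zero vanishes: its correlations with itself have constant modulus, and are
approximated by correlations of continuous functions. -/
theorem ae_eq_zero_of_tendsto_correlation {T : Cyl d → Cyl d}
    (hT : MeasurePreserving T (volume : Measure (Cyl d)) volume) {τ : ℕ → ℕ}
    (hcorr : ∀ X Y : Torus d → ℂ, Continuous X → Continuous Y →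
      ∫ y : Cyl d, X (cylTorus y) = 0 →
      Tendsto (fun n => ∫ y : Cyl d, X (cylTorus (T^[τ n] y)) * Y (cylTorus y)) atTop (𝓝 0))
    {u : Cyl d → ℂ} {c : ℂ} {M : ℝ} (hum : Measurable u) (hM : ∀ y, ‖u y‖ ≤ M)
    (hu0 : ∫ y, u y = 0) (hc : ‖c‖ = 1) (hu : ∀ᵐ y, u (T y) = c * u y) : ∀ᵐ y, u y = 0 := by
  have hM0 : 0 ≤ M := (norm_nonneg _).trans (hM (proj 0))
  have hcm : Measurable fun y => (starRingEnd ℂ) (u y) := Complex.continuous_conj.measurable.comp hum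
  have hcM : ∀ y, ‖(starRingEnd ℂ) (u y)‖ ≤ M := fun y => by rw [RCLike.norm_conj]; exact hM y
  have hbdd : ∀ {v : Cyl d → ℂ} {K : ℝ}, Measurable v → (∀ y, ‖v y‖ ≤ K) → Integrable v :=
    fun hv hK => Integrable.of_bound hv.aestronglyMeasurable _ (Eventually.of_forall hK)
  set s : ℝ := ∫ y, ‖u y‖ ^ 2 with hs
  have hs0 : 0 ≤ s := integral_nonneg fun y => by positivity
  have hself : ∀ m : ℕ, ‖∫ y, u (T^[m] y) * (starRingEnd ℂ) (u y)‖ = s := by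
    intro m
    have h1 : ∫ y, u (T^[m] y) * (starRingEnd ℂ) (u y) = ∫ y, c ^ m * ((‖u y‖ ^ 2 : ℝ) : ℂ) := by
      refine integral_congr_ae ?_
      filter_upwards [iterate_eigenfunction hT hu m] with y hy
      rw [hy, mul_assoc, Complex.mul_conj, Complex.normSq_eq_norm_sq]
    rw [h1, integral_const_mul, integral_complex_ofReal, norm_mul, norm_pow, hc, one_pow, one_mul,
      Complex.norm_of_nonneg hs0]
  have hle : ∀ ε > 0, s ≤ M * ε + ε := by
    intro ε hε
    obtain ⟨Y, hY, hYu⟩ := exists_continuous_integral_sub_le hcm hcM hε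
    obtain ⟨K, hK⟩ := exists_norm_le_of_continuous hY
    have hK0 : 0 ≤ K := (norm_nonneg _).trans (hK 0)
    set η := ε / (2 * (K + 1)) with hη
    obtain ⟨X', hX', hXu'⟩ := exists_continuous_integral_sub_le hum hM
      (show 0 < η by positivity)
    obtain ⟨K', hK'⟩ := exists_norm_le_of_continuous hX'
    have hX'i : Integrable fun y : Cyl d => X' (cylTorus y) :=
      hbdd (hX'.measurable.comp measurable_cylTorus) fun y => hK' _
    -- subtracting its small mean from `X'` gives an approximation of mean zero
    set e := ∫ y : Cyl d, X' (cylTorus y) with he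
    have heη : ‖e‖ ≤ η := by
      have h1 : e = -∫ y, (u y - X' (cylTorus y)) := by
        rw [integral_sub (hbdd hum hM) hX'i, hu0, zero_sub, neg_neg]
      rw [h1, norm_neg]
      exact (norm_integral_le_integral_norm _).trans hXu'
    set X : Torus d → ℂ := fun t => X' t - e with hXdef
    have hX : Continuous X := hX'.sub continuous_const
    have hX0 : ∫ y : Cyl d, X (cylTorus y) = 0 := by
      simp only [hXdef]
      rw [integral_sub hX'i (integrable_const e)]
      simp [he]
    have hXc : Measurable fun y : Cyl d => X (cylTorus y) :=
      hX.measurable.comp measurable_cylTorus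
    have hYc : Measurable fun y : Cyl d => Y (cylTorus y) :=
      hY.measurable.comp measurable_cylTorus
    have hXK : ∀ t, ‖X t‖ ≤ K' + ‖e‖ := fun t => (norm_sub_le _ _).trans (by gcongr; exact hK' t)
    have hdX : Integrable fun y : Cyl d => ‖u y - X (cylTorus y)‖ :=
      (hbdd (hum.sub hXc) fun y => (norm_sub_le _ _).trans (add_le_add (hM y) (hXK _))).norm
    have hdY : Integrable fun y : Cyl d => ‖(starRingEnd ℂ) (u y) - Y (cylTorus y)‖ :=
      (hbdd (hcm.sub hYc) fun y => (norm_sub_le _ _).trans (add_le_add (hcM y) (hK _))).norm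
    have hdX' : Integrable fun y : Cyl d => ‖u y - X' (cylTorus y)‖ :=
      (hbdd (hum.sub (hX'.measurable.comp measurable_cylTorus)) fun y =>
        (norm_sub_le _ _).trans (add_le_add (hM y) (hK' _))).norm
    have hXu : ∫ y : Cyl d, ‖u y - X (cylTorus y)‖ ≤ 2 * η := by
      have h1 : ∫ y : Cyl d, ‖u y - X (cylTorus y)‖ ≤
          ∫ y : Cyl d, (‖u y - X' (cylTorus y)‖ + ‖e‖) := by
        refine integral_mono hdX (hdX'.add (integrable_const _)) fun y => ?_
        simp only [hXdef]
        rw [← sub_add]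
        exact norm_add_le _ _
      rw [integral_add hdX' (integrable_const _)] at h1
      simp only [integral_const, probReal_univ, smul_eq_mul, one_mul] at h1
      linarith
    have hstep : ∀ m : ℕ, s ≤ M * ε + ε +
        ‖∫ y : Cyl d, X (cylTorus (T^[m] y)) * Y (cylTorus y)‖ := by
      intro m
      have hTm := hT.iterate m
      have hdXT : Integrable fun y : Cyl d => ‖u (T^[m] y) - X (cylTorus (T^[m] y))‖ :=
        hTm.integrable_comp_of_integrable hdX
      have hXT : ∫ y : Cyl d, ‖u (T^[m] y) - X (cylTorus (T^[m] y))‖ ≤ 2 * η := by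
        refine le_trans (le_of_eq ?_) hXu
        rw [← integral_map (f := fun y => ‖u y - X (cylTorus y)‖) hTm.aemeasurable
          (hum.sub hXc).norm.aestronglyMeasurable, hTm.map_eq]
      have hi1 : Integrable fun y => u (T^[m] y) * (starRingEnd ℂ) (u y) :=
        hbdd ((hum.comp hTm.measurable).mul hcm) (K := M * M) fun y => by
          rw [norm_mul]
          exact mul_le_mul (hM _) (hcM _) (norm_nonneg _) hM0
      have hi2 : Integrable fun y : Cyl d => X (cylTorus (T^[m] y)) * Y (cylTorus y) :=
        hbdd ((hXc.comp hTm.measurable).mul hYc) (K := (K' + ‖e‖) * K) fun y => by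
          rw [norm_mul]
          exact mul_le_mul (hXK _) (hK _) (norm_nonneg _) ((norm_nonneg _).trans (hXK 0))
      rw [← hself m]
      set I := ∫ y : Cyl d, X (cylTorus (T^[m] y)) * Y (cylTorus y)
      have h1 := norm_add_le ((∫ y, u (T^[m] y) * (starRingEnd ℂ) (u y)) - I) I
      rw [sub_add_cancel] at h1
      refine h1.trans (add_le_add ?_ le_rfl)
      rw [← integral_sub hi1 hi2]
      have h2 : ‖∫ y : Cyl d, (u (T^[m] y) * (starRingEnd ℂ) (u y) -
          X (cylTorus (T^[m] y)) * Y (cylTorus y))‖ ≤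
          ∫ y : Cyl d, (M * ‖(starRingEnd ℂ) (u y) - Y (cylTorus y)‖ +
            K * ‖u (T^[m] y) - X (cylTorus (T^[m] y))‖) := by
        refine norm_integral_le_of_norm_le ((hdY.const_mul M).add (hdXT.const_mul K))
          (Eventually.of_forall fun y => ?_)
        have h3 : u (T^[m] y) * (starRingEnd ℂ) (u y) - X (cylTorus (T^[m] y)) * Y (cylTorus y) =
            u (T^[m] y) * ((starRingEnd ℂ) (u y) - Y (cylTorus y)) +
              Y (cylTorus y) * (u (T^[m] y) - X (cylTorus (T^[m] y))) := by ring
        rw [h3]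
        refine (norm_add_le _ _).trans ?_
        rw [norm_mul, norm_mul]
        gcongr
        · exact hM _
        · exact hK _
      rw [integral_add (hdY.const_mul M) (hdXT.const_mul K), integral_const_mul,
        integral_const_mul] at h2
      have h4 : K * (2 * η) ≤ ε := by
        rw [hη]
        have : K * (2 * (ε / (2 * (K + 1)))) = ε * (K / (K + 1)) := by field_simp
        rw [this]
        exact mul_le_of_le_one_right hε.le ((div_le_one (by positivity)).mpr (by linarith))
      have h5 := mul_le_mul_of_nonneg_left hYu hM0
      have h6 := mul_le_mul_of_nonneg_left hXT hK0
      linarith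
    have hlim := ((hcorr X Y hX hY hX0).norm.const_add (M * ε + ε))
    rw [norm_zero, add_zero] at hlim
    exact ge_of_tendsto' hlim fun n => hstep (τ n)
  have hs1 : s = 0 := by
    refine le_antisymm (le_of_forall_pos_le_add fun ε hε => ?_) hs0
    have h1 := hle (ε / (M + 1)) (by positivity)
    have h2 : M * (ε / (M + 1)) + ε / (M + 1) = ε := by field_simp
    linarith
  have h1 := (integral_eq_zero_iff_of_nonneg (f := fun y : Cyl d => ‖u y‖ ^ 2)
    (fun y => by positivity) (Integrable.of_bound
      (hum.norm.pow_const 2).aestronglyMeasurable (M ^ 2) (Eventually.of_forall fun y => by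
        rw [norm_pow, norm_norm]
        exact pow_le_pow_left₀ (norm_nonneg _) (hM y) 2))).mp hs1
  filter_upwards [h1] with y hy
  simpa using hy

end AbC

theorem mainTheorem4 (d : ℕ) (C : AbC.ConjData d) (f : AbC.CylDiffeo d)
    (hdist : ∀ n : ℕ, 1 ≤ n →
      AbC.diffDist 0 (f.lift^[C.mTime n]) (f.liftInv^[C.mTime n])
        (C.f n ^ C.mTime n : Equiv.Perm (AbC.Coord d)) (C.f n ^ C.mTime n : Equiv.Perm (AbC.Coord d)).symm
          < ENNReal.ofReal (1 / 2 ^ n))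
    (hderiv : ∀ n : ℕ, 1 ≤ n →
      AbC.supNormD (C.H (n - 1)) ≤ ENNReal.ofReal (Real.log (C.q n) / n))
    (hlim : ∀ k : ℕ, Tendsto (fun n : ℕ => AbC.diffDist k (C.f n) (C.f n).symm f.lift f.liftInv)
      atTop (𝓝 0)) :
    AbC.WeaklyMixing (volume : Measure (AbC.Cyl d)) f.toEquiv := by
  have hT := f.measurePreserving_toEquiv C hlim
  exact AbC.weaklyMixing_of_bounded hT fun u c M hum hM hu0 hc hu =>
    AbC.ae_eq_zero_of_tendsto_correlation hT (τ := C.mTime)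
      (fun X Y hX hY h0 => f.tendsto_correlation C hdist hderiv hX hY h0) hum hM hu0 hc hu
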